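/- Let $a,b\in\mathbb C[t]$ with $\deg a\le 12$ and $\deg b\le 18$, regarded as sections of $\mathcal O_{\mathbb P^1}(12)$ and $\mathcal O_{\mathbb P^1}(18)$, and let $$S=\{\,Y^2Z=X^3+aXZ^2+bZ^3\,\}\subset \mathbb P_{\mathbb P^1}(\mathcal O(6)\oplus\mathcal O(9)\oplus\mathcal O)$$ be the corresponding Weierstrass fibration over $\mathbb P^1$. Assume that the surface $S$ is smooth. Let $f\in \mathrm{NS}(S)$ be the class of a fibre, let $z$ be the zero section $[X:Y:Z]=[0:1:0]$ (we use the same letter for a curve and for its class in the Néron–Severi group $\mathrm{NS}(S)$), and recall that sections of $S\to\mathbb P^1$ correspond to $\mathbb C(t)$-rational points of the generic fibre, an elliptic curve over $\mathbb C(t)$ with origin given by $z$; the group of these points is the Mordell–Weil group. Let $\sigma\subset S$ be a section curve, let $k\in\mathbb Z$, and let $\sigma^{*k}$ be the section curve that is the $k$-th power (multiple) of $\sigma$ for the Mordell–Weil group law. Then in $\mathrm{NS}(S)$ $$[\sigma^{*k}] = k\,\sigma-(k-1)\,z+(z\cdot\sigma+3)\,k(k-1)\,f,$$ where $z\cdot\sigma$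 is the intersection number on $S$ (the self-intersection number of $z$ if $\sigma=z$). -/

import Mathlib

/-! ### Gluing affine charts inside a field -/

namespace Glue
open AlgebraicGeometry CategoryTheory Limits
section
variable {k F : Type} [Field k] [Field F] [Algebra k F]

/-- The elements `b` of the field `F` with `g ^ n * b ∈ A` for some `n`, i.e. `A[1 / g]`. -/
def away (A : Subalgebra k F) (g : F) (hg : g ∈ A) : Subalgebra k F where
  carrier := {b | ∃ n : ℕ, g ^ n * b ∈ A}
  mul_mem' := by
    rintro a b ⟨n, hn⟩ ⟨m, hm⟩
    exact ⟨n + m, by convert mul_mem hn hm using 1; ring⟩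
  add_mem' := by
    rintro a b ⟨n, hn⟩ ⟨m, hm⟩
    refine ⟨n + m, ?_⟩
    convert add_mem (mul_mem (pow_mem hg m) hn) (mul_mem (pow_mem hg n) hm) using 1
    ring
  algebraMap_mem' := fun r => ⟨0, by simp [A.algebraMap_mem]⟩

/-- `B = A[1 / g]` for a nonzero element `g` of `A`. -/
def IsAway (A B : Subalgebra k F) : Prop :=
  A ≤ B ∧ ∃ g, ∃ hg : g ∈ A, g ≠ 0 ∧ g⁻¹ ∈ B ∧ B ≤ away A g hg

theorem IsAway.le {A B : Subalgebra k F} (h : IsAway A B) : A ≤ B := h.1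

theorem IsAway.sup {A B C : Subalgebra k F} (hB : IsAway A B) (hC : IsAway A C) :
    IsAway A (B ⊔ C) := by
  obtain ⟨hAB, g, hg, hg0, hgB, hgn⟩ := hB
  obtain ⟨-, h, hh, hh0, hhC, hhn⟩ := hC
  refine ⟨hAB.trans le_sup_left, g * h, mul_mem hg hh, mul_ne_zero hg0 hh0, ?_,
    sup_le (fun b hb => ?_) fun b hb => ?_⟩
  · rw [mul_inv]
    exact mul_mem ((le_sup_left : B ≤ B ⊔ C) hgB) ((le_sup_right : C ≤ B ⊔ C) hhC)
  · obtain ⟨n, hn⟩ := hgn hb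
    exact ⟨n, by convert mul_mem (pow_mem hh n) hn using 1; ring⟩
  · obtain ⟨n, hn⟩ := hhn hb
    exact ⟨n, by convert mul_mem (pow_mem hg n) hn using 1; ring⟩

theorem IsAway.refl (A : Subalgebra k F) : IsAway A A :=
  ⟨le_rfl, 1, one_mem A, one_ne_zero, by simp, fun b hb => ⟨0, by simpa⟩⟩

theorem IsAway.isLocalization {A B : Subalgebra k F} (hAB : A ≤ B) {g : F} (hg : g ∈ A)
    (hg0 : g ≠ 0) (hgB : g⁻¹ ∈ B) (hgn : B ≤ away A g hg) :
    letI := (Subalgebra.inclusion hAB).toRingHom.toAlgebra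
    IsLocalization.Away (⟨g, hg⟩ : A) B := by
  let := (Subalgebra.inclusion hAB).toRingHom.toAlgebra
  refine IsLocalization.Away.mk _ ?_ ?_ ?_
  · exact IsUnit.of_mul_eq_one ⟨g⁻¹, hgB⟩ (Subtype.ext (mul_inv_cancel₀ hg0))
  · rintro ⟨b, hb⟩
    obtain ⟨n, hn⟩ := hgn hb
    exact ⟨n, ⟨_, hn⟩, Subtype.ext (mul_comm _ _)⟩
  · intro a b hab
    have h1 : a = b := Subtype.ext (congrArg (fun z : B => (z : F)) hab)
    exact ⟨0, by rw [h1]⟩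

variable {ι : Type} (R : ι → Subalgebra k F)

/-- The coordinate ring of the intersection of the charts with index in `I`. -/
def interRing (I : Finset ι) : Subalgebra k F := ⨆ i ∈ I, R i

theorem interRing_mono {I J : Finset ι} (h : I ⊆ J) : interRing R I ≤ interRing R J :=
  biSup_mono fun _ hi => h hi

/-- A family of subalgebras of a field that are the coordinate rings of affine charts:
the intersection of any two charts is a basic open subset of each of them. -/
class IsGluable : Prop where
  isAway : ∀ i j, ∃ g, ∃ hg : g ∈ R i, g ≠ 0 ∧ g⁻¹ ∈ R j ∧ R j ≤ away (R i) g hg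

theorem isAway_interRing [IsGluable R] {I J : Finset ι} (hI : I.Nonempty) (h : I ⊆ J) :
    IsAway (interRing R I) (interRing R J) := by
  classical
  obtain ⟨i, hi⟩ := hI
  have key : ∀ J : Finset ι, IsAway (interRing R I) (interRing R I ⊔ interRing R J) := by
    intro J
    induction J using Finset.induction_on with
    | empty => simpa [interRing] using IsAway.refl _
    | insert j J _ ih =>
      have h1 : IsAway (interRing R I) (interRing R I ⊔ R j) := by
        obtain ⟨g, hg, hg0, hgj, hj⟩ := IsGluable.isAway (R := R) i j
        have hiI : R i ≤ interRing R I := le_biSup R hi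
        refine ⟨le_sup_left, g, hiI hg, hg0, (le_sup_right : R j ≤ _) hgj,
          sup_le (fun b hb => ⟨0, by simpa⟩) fun b hb => ?_⟩
        obtain ⟨n, hn⟩ := hj hb
        exact ⟨n, hiI hn⟩
      have h2 : interRing R I ⊔ interRing R (insert j J) =
          (interRing R I ⊔ R j) ⊔ (interRing R I ⊔ interRing R J) := by
        rw [interRing, interRing, interRing, Finset.iSup_insert, sup_sup_sup_comm, sup_idem]
      rw [h2]
      exact h1.sup ih
  have h2 := key J
  rwa [sup_eq_right.mpr (interRing_mono R h)] at h2

/-- Nonempty finite sets of charts, ordered by reverse inclusion. -/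
abbrev Index (ι : Type) := {I : Finset ι // I.Nonempty}ᵒᵈ

/-- The morphism of spectra induced by an inclusion of subalgebras of `F`. -/
noncomputable def specIncl {A B : Subalgebra k F} (h : A ≤ B) :
    Spec (.of B) ⟶ Spec (.of A) :=
  Spec.map (CommRingCat.ofHom (Subalgebra.inclusion h).toRingHom)

theorem specIncl_refl (A : Subalgebra k F) : specIncl (le_refl A) = 𝟙 _ := by
  rw [← Spec.map_id]
  rfl

theorem specIncl_comp {A B C : Subalgebra k F} (h : A ≤ B) (h' : B ≤ C) :
    specIncl h' ≫ specIncl h = specIncl (h.trans h') := by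
  rw [specIncl, specIncl, specIncl, ← Spec.map_comp, ← CommRingCat.ofHom_comp]
  rfl

theorem IsAway.isOpenImmersion {A B : Subalgebra k F} (h : IsAway A B) :
    IsOpenImmersion (specIncl h.le) := by
  obtain ⟨hAB, g, hg, hg0, hgB, hgn⟩ := h
  have := IsAway.isLocalization hAB hg hg0 hgB hgn
  let := (Subalgebra.inclusion hAB).toRingHom.toAlgebra
  exact IsOpenImmersion.of_isLocalization (S := B) (⟨g, hg⟩ : A)

/-- The diagram of the finite intersections of the charts and their inclusions. -/
noncomputable def diagram : Index ι ⥤ Scheme.{0} where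
  obj I := Spec (.of (interRing R (OrderDual.ofDual I).1))
  map f := specIncl (interRing_mono R (OrderDual.ofDual_le_ofDual.mpr f.le))
  map_id _ := specIncl_refl _
  map_comp _ _ := (specIncl_comp _ _).symm

instance [IsGluable R] {I J : Index ι} (f : I ⟶ J) : IsOpenImmersion ((diagram R).map f) :=
  (isAway_interRing R (OrderDual.ofDual J).2
    (OrderDual.ofDual_le_ofDual.mpr f.le)).isOpenImmersion

theorem IsAway.exists_lift {A B C D : Subalgebra k F} (hAB : IsAway A B) (hAC : IsAway A C)
    (hBD : IsAway B D) (hCD : C ≤ D) (hD : D = B ⊔ C)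
    (x : Spec (.of B)) (y : Spec (.of C)) (h : specIncl hAB.le x = specIncl hAC.le y) :
    ∃ z : Spec (.of D), specIncl hBD.le z = x ∧ specIncl hCD z = y := by
  have hopen := hAC.isOpenImmersion
  obtain ⟨-, g, hg, hg0, hgC, hC⟩ := id hAC
  have hBD' : D ≤ away B g (hAB.le hg) := by
    rw [hD]
    refine sup_le (fun b hb => ⟨0, by simpa⟩) fun b hb => ?_
    obtain ⟨n, hn⟩ := hC hb
    exact ⟨n, hAB.1 hn⟩
  have hloc := IsAway.isLocalization hBD.le (hAB.le hg) hg0 (hCD hgC) hBD'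
  let := (Subalgebra.inclusion hBD.le).toRingHom.toAlgebra
  have hr := PrimeSpectrum.localization_away_comap_range D (⟨g, hAB.le hg⟩ : B)
  have hx : x ∈ Set.range (PrimeSpectrum.comap (algebraMap B D)) := by
    rw [hr]
    intro hgx
    have h1 : (⟨g, hg⟩ : A) ∈ (specIncl hAB.le x).asIdeal := hgx
    rw [h] at h1
    have h2 : (⟨g, hAC.le hg⟩ : C) ∈ y.asIdeal := h1
    refine y.2.ne_top (Ideal.eq_top_of_isUnit_mem _ h2 ?_)
    exact IsUnit.of_mul_eq_one ⟨g⁻¹, hgC⟩ (Subtype.ext (mul_inv_cancel₀ hg0))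
  obtain ⟨z', hz⟩ := hx
  let z : Spec (.of D) := z'
  refine ⟨z, hz, ?_⟩
  apply (specIncl hAC.le).isOpenEmbedding.injective
  rw [← h, ← show specIncl hBD.le z = x from hz, ← Scheme.Hom.comp_apply, ← Scheme.Hom.comp_apply,
    specIncl_comp, specIncl_comp]

instance [IsGluable R] : (diagram R ⋙ Scheme.forget).IsLocallyDirected where
  cond := by
    classical
    intro I J K fI fJ x y hxy
    let L : Index ι := OrderDual.toDual
      ⟨(OrderDual.ofDual I).1 ∪ (OrderDual.ofDual J).1, (OrderDual.ofDual I).2.mono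
        Finset.subset_union_left⟩
    let fLI : L ⟶ I := homOfLE (OrderDual.toDual_le.mpr Finset.subset_union_left)
    let fLJ : L ⟶ J := homOfLE (OrderDual.toDual_le.mpr Finset.subset_union_right)
    obtain ⟨z, hz, hz'⟩ := IsAway.exists_lift
      (isAway_interRing R (OrderDual.ofDual K).2 (OrderDual.ofDual_le_ofDual.mpr fI.le))
      (isAway_interRing R (OrderDual.ofDual K).2 (OrderDual.ofDual_le_ofDual.mpr fJ.le))
      (isAway_interRing R (OrderDual.ofDual I).2 (OrderDual.ofDual_le_ofDual.mpr fLI.le))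
      (interRing_mono R (OrderDual.ofDual_le_ofDual.mpr fLJ.le))
      (by simp only [interRing, L]; exact Finset.iSup_union) x y hxy
    exact ⟨L, fLI, fLJ, z, hz, hz'⟩

theorem interRing_singleton (i : ι) : interRing R {i} = R i := by simp [interRing]

/-- The generic point of the spectrum of a subalgebra of `F`. -/
def botPt (A : Subalgebra k F) : Spec (.of A) := (⊥ : PrimeSpectrum A)

theorem specIncl_botPt {A B : Subalgebra k F} (h : A ≤ B) : specIncl h (botPt B) = botPt A := by
  refine PrimeSpectrum.ext ?_
  ext a
  change Subalgebra.inclusion h a ∈ (⊥ : Ideal B) ↔ a ∈ (⊥ : Ideal A)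
  exact map_eq_zero_iff _ (Subalgebra.inclusion_injective h)

variable [IsGluable R]

/-- The scheme obtained by gluing the affine charts `Spec (R i)` along the basic open subsets
`Spec (R i ⊔ R j)`. -/
noncomputable def glued : Scheme.{0} := colimit (diagram R)

/-- The inclusion into the glued scheme of the intersection of the charts with index in `I`. -/
noncomputable def interMap (I : Finset ι) (hI : I.Nonempty) :
    Spec (.of (interRing R I)) ⟶ glued R :=
  colimit.ι (diagram R) (OrderDual.toDual ⟨I, hI⟩)

instance (I : Finset ι) (hI : I.Nonempty) : IsOpenImmersion (interMap R I hI) :=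
  inferInstanceAs (IsOpenImmersion (colimit.ι (diagram R) (OrderDual.toDual ⟨I, hI⟩)))

theorem specIncl_interMap {I J : Finset ι} (hI : I.Nonempty) (h : I ⊆ J) :
    specIncl (interRing_mono R h) ≫ interMap R I hI = interMap R J (hI.mono h) :=
  colimit.w (diagram R) (homOfLE (OrderDual.toDual_le_toDual.mpr h) :
    OrderDual.toDual ⟨J, hI.mono h⟩ ⟶ (OrderDual.toDual ⟨I, hI⟩ : Index ι))

/-- The inclusion of the chart `Spec (R i)` into the glued scheme. -/
noncomputable def chartMap (i : ι) : Spec (.of (R i)) ⟶ glued R :=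
  specIncl (interRing_singleton R i).le ≫ interMap R {i} (Finset.singleton_nonempty i)

theorem specIncl_chartMap {I : Finset ι} {i : ι} (hi : i ∈ I) (h : R i ≤ interRing R I) :
    specIncl h ≫ chartMap R i = interMap R I ⟨i, hi⟩ := by
  rw [chartMap, ← Category.assoc, specIncl_comp]
  exact specIncl_interMap R (Finset.singleton_nonempty i) (Finset.singleton_subset_iff.mpr hi)

instance (i : ι) : IsOpenImmersion (chartMap R i) := by
  have : IsOpenImmersion (specIncl (interRing_singleton R i).le) :=
    IsAway.isOpenImmersion (by rw [interRing_singleton]; exact .refl _)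
  unfold chartMap
  infer_instance

theorem chartMap_covers (x : glued R) : ∃ i, x ∈ Set.range (chartMap R i) := by
  obtain ⟨I, y, rfl⟩ := Scheme.IsLocallyDirected.ι_jointly_surjective (diagram R) x
  obtain ⟨i, hi⟩ := (OrderDual.ofDual I).2
  have h : R i ≤ interRing R (OrderDual.ofDual I).1 := le_biSup R hi
  let y' : Spec (.of (interRing R (OrderDual.ofDual I).1)) := y
  refine ⟨i, specIncl h y', ?_⟩
  rw [← Scheme.Hom.comp_apply, specIncl_chartMap R hi h]
  rfl

/-- The structure morphism of the glued scheme. -/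
noncomputable def gluedToSpec : glued R ⟶ Spec (.of k) :=
  colimit.desc (diagram R)
    { pt := Spec (.of k)
      ι :=
        { app := fun I => Spec.map (CommRingCat.ofHom
            (algebraMap k (interRing R (OrderDual.ofDual I).1)))
          naturality := fun I J f => by
            change specIncl _ ≫ _ = _ ≫ 𝟙 _
            rw [Category.comp_id, specIncl, ← Spec.map_comp, ← CommRingCat.ofHom_comp]
            rfl } }

/-- Sections of the structure sheaf over a chart. -/
noncomputable def chartIso (i : ι) :
    Γ(glued R, (chartMap R i).opensRange) ≅ CommRingCat.of (R i) :=
  (glued R).presheaf.mapIso (eqToIso (Scheme.Hom.image_top_eq_opensRange (chartMap R i))).op ≪≫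
    (chartMap R i).appIso ⊤ ≪≫ Scheme.ΓSpecIso _

instance [Finite ι] [∀ i, IsNoetherianRing (R i)] :
    AlgebraicGeometry.IsNoetherian (glued R) := by
  let S : ι → (glued R).affineOpens := fun i =>
    ⟨(chartMap R i).opensRange, isAffineOpen_opensRange (chartMap R i)⟩
  have hS : ⨆ i, (S i : (glued R).Opens) = ⊤ := by
    rw [eq_top_iff]
    rintro x -
    obtain ⟨i, hi⟩ := chartMap_covers R x
    exact TopologicalSpace.Opens.mem_iSup.mpr ⟨i, hi⟩
  rw [isNoetherian_iff_of_finite_iSup_eq_top hS]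
  intro i
  exact isNoetherianRing_of_ringEquiv _ (chartIso R i).symm.commRingCatIsoToRingEquiv

theorem chartMap_botPt (i j : ι) : chartMap R i (botPt (R i)) = chartMap R j (botPt (R j)) := by
  classical
  have key : ∀ l ∈ ({i, j} : Finset ι), chartMap R l (botPt (R l)) =
      interMap R {i, j} ⟨i, by simp⟩ (botPt _) := by
    intro l hl
    have h : R l ≤ interRing R {i, j} := le_biSup R hl
    rw [← specIncl_chartMap R hl h, Scheme.Hom.comp_apply, specIncl_botPt]
  rw [key i (by simp), key j (by simp)]

instance [Nonempty ι] : AlgebraicGeometry.IsIntegral (glued R) := by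
  obtain ⟨i₀⟩ := ‹Nonempty ι›
  have h1 : ∀ x : glued R, chartMap R i₀ (botPt (R i₀)) ⤳ x := by
    intro x
    obtain ⟨i, y, rfl⟩ := chartMap_covers R x
    rw [chartMap_botPt R i₀ i]
    refine Specializes.map ?_ (chartMap R i).continuous
    exact (PrimeSpectrum.le_iff_specializes (⊥ : PrimeSpectrum (R i)) y).mp bot_le
  have h2 : closure {chartMap R i₀ (botPt (R i₀))} = (Set.univ : Set (glued R)) :=
    Set.eq_univ_of_forall fun x => (h1 x).mem_closure
  have : IrreducibleSpace (glued R) := by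
    have h3 := isIrreducible_singleton (x := chartMap R i₀ (botPt (R i₀))).closure
    rw [h2] at h3
    exact { isPreirreducible_univ := h3.2, toNonempty := ⟨chartMap R i₀ (botPt (R i₀))⟩ }
  have : ∀ i, AlgebraicGeometry.IsReduced
      ((Scheme.IsLocallyDirected.openCover (diagram R)).X i) := fun i =>
    inferInstanceAs (AlgebraicGeometry.IsReduced
      (Spec (.of (interRing R (OrderDual.ofDual i).1))))
  have : AlgebraicGeometry.IsReduced (glued R) :=
    IsReduced.of_openCover _ (Scheme.IsLocallyDirected.openCover (diagram R))
  exact isIntegral_of_irreducibleSpace_of_isReduced _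

instance (i : ι) : Nonempty (chartMap R i).opensRange :=
  ⟨⟨chartMap R i (botPt (R i)), ⟨_, rfl⟩⟩⟩

/-- An element of the coordinate ring of a chart, as a rational function on the glued scheme. -/
noncomputable def chartToFunctionField [Nonempty ι] (i : ι) : R i →+* (glued R).functionField :=
  ((glued R).germToFunctionField (chartMap R i).opensRange).hom.comp (chartIso R i).inv.hom

theorem chartToFunctionField_injective [Nonempty ι] (i : ι) :
    Function.Injective (chartToFunctionField R i) :=
  ((glued R).germToFunctionField_injective _).comp
    (chartIso R i).symm.commRingCatIsoToRingEquiv.injective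

/-- The identification of the common field `F` with the function field of the glued scheme,
obtained from a chart with fraction field `F`. -/
noncomputable def fieldToFunctionField [Nonempty ι] (i : ι) [IsFractionRing (R i) F] :
    F →+* (glued R).functionField :=
  IsFractionRing.lift (chartToFunctionField_injective R i)

end
end Glue

/-! ### Divisors, intersection numbers and the Néron–Severi group -/

namespace DivisorTheory
open AlgebraicGeometry CategoryTheory Limits

/-- A prime divisor of a scheme, given by its generic point, a point of codimension one. -/
abbrev PrimeDivisor (X : Scheme.{0}) : Type := {x : X // Order.coheight x = 1}

/-- Weil divisors. -/
abbrev WeilDivisor (X : Scheme.{0}) : Type := PrimeDivisor X →₀ ℤ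

section
variable (X : Scheme.{0}) [AlgebraicGeometry.IsIntegral X] [AlgebraicGeometry.IsNoetherian X]

theorem finite_ord_ne_zero (g : X.functionField) :
    (Function.support fun x : PrimeDivisor X => Scheme.ord g x.1).Finite := by
  by_cases hg : g = 0
  · simp [hg]
  obtain ⟨U, -, f, hU, hf, hfu⟩ := exists_isUnit_germ_eq X g hg
  obtain ⟨S, hSf, hSc, hSi, hS⟩ :=
    TopologicalSpace.NoetherianSpace.exists_finite_set_isClosed_irreducible
      U.isOpen.isClosed_compl
  have key : ∀ x : PrimeDivisor X, Scheme.ord g x.1 ≠ 0 → ∃ t ∈ S, closure {x.1} = t := by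
    intro x hx
    have hxU : x.1 ∉ U := fun h => hx (by rw [← hf]; exact Scheme.ord_of_isUnit hfu h)
    have hxS : x.1 ∈ ⋃₀ S := hS ▸ hxU
    obtain ⟨t, ht, hxt⟩ := hxS
    refine ⟨t, ht, ?_⟩
    have hgen := (hSi t ht).isGenericPoint_genericPoint (hSc t ht)
    have hspec : (hSi t ht).genericPoint ⤳ x.1 := hgen.specializes hxt
    have hle : x.1 ≤ (hSi t ht).genericPoint := Scheme.le_iff_specializes.mpr hspec
    have hnlt : ¬ x.1 < (hSi t ht).genericPoint := by
      intro hlt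
      have h0 : Order.coheight (hSi t ht).genericPoint < (1 : ℕ) :=
        Order.coheight_le_coe_iff.mp (by rw [x.2]; rfl) _ hlt
      have h1 : Order.coheight (hSi t ht).genericPoint = 0 := by
        simpa using h0
      have h2 : IsMax (hSi t ht).genericPoint := Order.coheight_eq_zero.mp h1
      have h3 : genericPoint X ≤ (hSi t ht).genericPoint :=
        h2 (Scheme.le_iff_specializes.mpr (genericPoint_specializes _))
      have h4 : genericPoint X ∈ U :=
        ((genericPoint_spec X).mem_open_set_iff U.isOpen).mpr (by simpa using hU)
      have h5 : (hSi t ht).genericPoint ∈ (U : Set X) :=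
        (Scheme.le_iff_specializes.mp h3).mem_open U.isOpen h4
      have h6 : (hSi t ht).genericPoint ∈ (U : Set X)ᶜ :=
        hS ▸ Set.mem_sUnion.mpr ⟨t, ht, hgen.mem⟩
      exact h6 h5
    have hge : (hSi t ht).genericPoint ≤ x.1 := by
      by_contra h
      exact hnlt (lt_iff_le_not_ge.mpr ⟨hle, h⟩)
    have heq : x.1 = (hSi t ht).genericPoint :=
      ((Scheme.le_iff_specializes.mp hge).antisymm hspec).eq
    rw [heq]
    exact hgen.def
  refine Set.Finite.of_finite_image (f := fun x : PrimeDivisor X => closure {x.1})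
    (hSf.subset ?_) ?_
  · rintro _ ⟨x, hx, rfl⟩
    obtain ⟨t, ht, h⟩ := key x hx
    change closure {x.1} ∈ S
    rwa [h]
  · intro x _ y _ h
    have hx : IsGenericPoint x.1 (closure {y.1}) := h
    exact Subtype.ext (hx.eq (show IsGenericPoint y.1 (closure {y.1}) from rfl))

variable {X}

/-- The divisor of zeros and poles of a rational function. -/
noncomputable def divOf (g : X.functionField) : WeilDivisor X :=
  Finsupp.ofSupportFinite (fun x => Scheme.ord g x.1) (finite_ord_ne_zero X g)

/-- The divisor of zeros of a rational function. -/
noncomputable def zerosOf (g : X.functionField) : WeilDivisor X :=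
  (divOf g).mapRange (fun n => max n 0) (max_self 0)

/-! ### Intersection numbers with a curve -/

open Classical in
/-- The ideal in the local ring at `p` of the integral closed subscheme with generic point `x`. -/
noncomputable def localIdeal (x p : X) : Ideal (X.presheaf.stalk p) :=
  if h : x ⤳ p then
    (IsLocalRing.maximalIdeal (X.presheaf.stalk x)).comap (X.presheaf.stalkSpecializes h).hom
  else ⊤

/-- The intersection number of two distinct prime divisors of a nonsingular projective surface
over an algebraically closed field: the sum over all points `p` of the lengths of
`𝒪_p / (I_C + I_C')`. -/
noncomputable def primeInter (C C' : PrimeDivisor X) : ℕ :=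
  ∑ᶠ p : X, (Module.length (X.presheaf.stalk p)
    (X.presheaf.stalk p ⧸ (localIdeal C.1 p ⊔ localIdeal C'.1 p))).toNat

/-- `n` is the degree of the line bundle `𝒪(D)` on the curve `C`, computed by means of a divisor
that is linearly equivalent to `D` and does not contain `C`. -/
def IsInterNumber (D : WeilDivisor X) (C : PrimeDivisor X) (n : ℤ) : Prop :=
  ∃ g : X.functionField, g ≠ 0 ∧ (D + divOf g) C = 0 ∧
    n = (D + divOf g).sum fun C' m => m * (primeInter C' C : ℤ)

/-- The intersection number `D · C` of a divisor with a curve on a nonsingular projective surface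
over an algebraically closed field. -/
noncomputable def interNumber (D : WeilDivisor X) (C : PrimeDivisor X) : ℤ :=
  Classical.epsilon (IsInterNumber D C)

/-! ### Algebraic equivalence and the Néron–Severi group -/

/-- The ideal sheaf of an effective Cartier divisor. -/
def IsEffectiveCartier {Y : Scheme.{0}} (I : Y.IdealSheafData) : Prop :=
  ∀ p : Y, ∃ U : Y.affineOpens, p ∈ U.1 ∧
    ∃ f ∈ nonZeroDivisors Γ(Y, U.1), I.ideal U = Ideal.span {f}

/-- `I` is the ideal sheaf of an effective Cartier divisor whose Weil divisor is `D`. -/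
def IsIdealSheafOf (I : X.IdealSheafData) (D : WeilDivisor X) : Prop :=
  ∀ p : X, ∃ (U : X.affineOpens) (hp : p ∈ U.1) (f : Γ(X, U.1)), f ≠ 0 ∧
    I.ideal U = Ideal.span {f} ∧
    ∀ x : PrimeDivisor X, x.1 ∈ U.1 →
      haveI : Nonempty U.1 := ⟨⟨p, hp⟩⟩
      D x = Scheme.ord (X.germToFunctionField U.1 f) x.1

/-- The divisors of nonzero rational functions. -/
def principalDivisors (X : Scheme.{0}) [AlgebraicGeometry.IsIntegral X]
    [AlgebraicGeometry.IsNoetherian X] : Set (WeilDivisor X) :=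
  {D | ∃ g : X.functionField, g ≠ 0 ∧ D = divOf g}

variable {k : Type} [Field k]

/-- The inclusion of the fibre of `X × T → T` over a rational point of `T`. -/
noncomputable def fiberIncl {T : Scheme.{0}} (p : X ⟶ Spec (.of k)) (q : T ⟶ Spec (.of k))
    (t : Spec (.of k) ⟶ T) (ht : t ≫ q = 𝟙 _) : X ⟶ pullback p q :=
  pullback.lift (𝟙 X) (p ≫ t) (by simp [ht])

/-- The differences `D₀ - D₁` of two fibres of a flat family of effective divisors on `X`
that is parametrized by a nonsingular irreducible curve `T` over `k`. -/
def algTrivialDivisors (p : X ⟶ Spec (.of k)) : Set (WeilDivisor X) :=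
  {D | ∃ (T : Scheme.{0}) (q : T ⟶ Spec (.of k)) (I : (pullback p q).IdealSheafData)
      (t₀ t₁ : Spec (.of k) ⟶ T) (h₀ : t₀ ≫ q = 𝟙 _) (h₁ : t₁ ≫ q = 𝟙 _)
      (D₀ D₁ : WeilDivisor X),
    AlgebraicGeometry.IsIntegral T ∧ SmoothOfRelativeDimension 1 q ∧ IsSeparated q ∧
    LocallyOfFiniteType q ∧ QuasiCompact q ∧
    IsEffectiveCartier I ∧ Flat (I.subschemeι ≫ pullback.snd p q) ∧
    IsIdealSheafOf (I.comap (fiberIncl p q t₀ h₀)) D₀ ∧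
    IsIdealSheafOf (I.comap (fiberIncl p q t₁ h₁)) D₁ ∧ D = D₀ - D₁}

/-- The Néron–Severi group of a nonsingular projective variety `X` over an algebraically closed
field `k`: divisors modulo linear equivalence and algebraic equivalence. -/
abbrev NeronSeveri (p : X ⟶ Spec (.of k)) : Type :=
  WeilDivisor X ⧸ AddSubgroup.closure (principalDivisors X ∪ algTrivialDivisors p)

/-- The class of a divisor in the Néron–Severi group. -/
noncomputable def nsClass (p : X ⟶ Spec (.of k)) (D : WeilDivisor X) : NeronSeveri p :=
  QuotientAddGroup.mk D

end
end DivisorTheory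

/-! ### Weierstrass fibrations over the projective line -/

namespace EllipticSurface
open AlgebraicGeometry CategoryTheory Polynomial Glue DivisorTheory

section
variable {k : Type} [Field k] (a b : k[X])

noncomputable instance : DecidableEq (RatFunc k) := Classical.decEq _

/-- The generic fibre `y² = x³ + a x + b`, a Weierstrass curve over `k(t)`. -/
noncomputable def genericFiber : WeierstrassCurve.Affine (RatFunc k) :=
  ⟨0, 0, 0, algebraMap k[X] (RatFunc k) a, algebraMap k[X] (RatFunc k) b⟩

/-- The function field `k(t)(x, y)` of the surface. -/
abbrev FunField : Type := (genericFiber a b).FunctionField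

/-- A rational function of `t`, as a rational function on the surface. -/
noncomputable def baseFun (r : RatFunc k) : FunField a b :=
  algebraMap (genericFiber a b).CoordinateRing (FunField a b) (algebraMap _ _ r)

/-- The coordinate `t` of the base. -/
noncomputable def tFun : FunField a b := baseFun a b RatFunc.X

/-- The Weierstrass coordinate `x`. -/
noncomputable def xFun : FunField a b :=
  algebraMap (genericFiber a b).CoordinateRing (FunField a b)
    (WeierstrassCurve.Affine.CoordinateRing.mk _ (C X))

/-- The Weierstrass coordinate `y`. -/
noncomputable def yFun : FunField a b :=
  algebraMap (genericFiber a b).CoordinateRing (FunField a b)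
    (WeierstrassCurve.Affine.CoordinateRing.mk _ X)

theorem baseFun_injective : Function.Injective (baseFun a b) :=
  (algebraMap (RatFunc k) (FunField a b)).injective

theorem tFun_ne_zero : tFun a b ≠ 0 := by
  intro h
  have h1 : baseFun a b RatFunc.X = baseFun a b 0 := by
    rw [show baseFun a b 0 = 0 from map_zero (algebraMap (RatFunc k) (FunField a b))]
    exact h
  exact RatFunc.X_ne_zero (baseFun_injective a b h1)

theorem yFun_ne_zero : yFun a b ≠ 0 := by
  have h := WeierstrassCurve.Affine.CoordinateRing.YClass_ne_zero (W' := genericFiber a b) 0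
  rw [WeierstrassCurve.Affine.CoordinateRing.YClass, map_zero, sub_zero] at h
  exact (map_ne_zero_iff _ (IsFractionRing.injective _ _)).mpr h

/-- The coordinates on the four affine charts of the surface `Y² Z = X³ + a X Z² + b Z³` in the
bundle `ℙ(𝒪(6) ⊕ 𝒪(9) ⊕ 𝒪)` over `ℙ¹`, where `x = X / Z` and `y = Y / Z`.  The first index tells
whether the chart lies over the complement of `t = ∞` or of `t = 0`, the second one whether it is
the locus `Z ≠ 0` or the locus `Y ≠ 0`.  Near `t = ∞` the coordinates are
`1 / t`, `x / t ^ 6` and `y / t ^ 9`. -/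
noncomputable def coord : Bool × Bool → Fin 3 → FunField a b
  | (false, false) => ![tFun a b, xFun a b, yFun a b]
  | (false, true) => ![tFun a b, xFun a b / yFun a b, 1 / yFun a b]
  | (true, false) => ![1 / tFun a b, xFun a b / tFun a b ^ 6, yFun a b / tFun a b ^ 9]
  | (true, true) => ![1 / tFun a b, (xFun a b / tFun a b ^ 6) / (yFun a b / tFun a b ^ 9),
      1 / (yFun a b / tFun a b ^ 9)]

/-- The coordinate rings of the four affine charts, as subrings of the function field. -/
noncomputable def chartRing (i : Bool × Bool) : Subalgebra k (FunField a b) :=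
  Algebra.adjoin k (Set.range (coord a b i))

theorem monomial_mem (i : Bool × Bool) {f : FunField a b} (l m n : ℕ)
    (h : f = coord a b i 0 ^ l * coord a b i 1 ^ m * coord a b i 2 ^ n) :
    f ∈ chartRing a b i := by
  have hc : ∀ j, coord a b i j ∈ chartRing a b i := fun j => Algebra.subset_adjoin ⟨j, rfl⟩
  rw [h]
  exact mul_mem (mul_mem (pow_mem (hc 0) _) (pow_mem (hc 1) _)) (pow_mem (hc 2) _)

theorem chartRing_overlap (i j : Bool × Bool) (g : FunField a b) (hg0 : g ≠ 0)
    (l m n l' m' n' N₀ l₀ m₀ n₀ N₁ l₁ m₁ n₁ N₂ l₂ m₂ n₂ : ℕ)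
    (hg : g = coord a b i 0 ^ l * coord a b i 1 ^ m * coord a b i 2 ^ n)
    (hg' : g⁻¹ = coord a b j 0 ^ l' * coord a b j 1 ^ m' * coord a b j 2 ^ n')
    (h₀ : g ^ N₀ * coord a b j 0 =
      coord a b i 0 ^ l₀ * coord a b i 1 ^ m₀ * coord a b i 2 ^ n₀)
    (h₁ : g ^ N₁ * coord a b j 1 =
      coord a b i 0 ^ l₁ * coord a b i 1 ^ m₁ * coord a b i 2 ^ n₁)
    (h₂ : g ^ N₂ * coord a b j 2 =
      coord a b i 0 ^ l₂ * coord a b i 1 ^ m₂ * coord a b i 2 ^ n₂) :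
    ∃ g, ∃ hg : g ∈ chartRing a b i, g ≠ 0 ∧ g⁻¹ ∈ chartRing a b j ∧
      chartRing a b j ≤ away (chartRing a b i) g hg := by
  refine ⟨g, monomial_mem a b i l m n hg, hg0, monomial_mem a b j l' m' n' hg', ?_⟩
  refine Algebra.adjoin_le ?_
  rintro _ ⟨r, rfl⟩
  fin_cases r
  · exact ⟨N₀, monomial_mem a b i l₀ m₀ n₀ h₀⟩
  · exact ⟨N₁, monomial_mem a b i l₁ m₁ n₁ h₁⟩
  · exact ⟨N₂, monomial_mem a b i l₂ m₂ n₂ h₂⟩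

instance : IsGluable (chartRing a b) where
  isAway := by
    have ht := tFun_ne_zero a b
    have hy := yFun_ne_zero a b
    have refl : ∀ i, ∃ g, ∃ hg : g ∈ chartRing a b i, g ≠ 0 ∧ g⁻¹ ∈ chartRing a b i ∧
        chartRing a b i ≤ away (chartRing a b i) g hg := fun i =>
      ⟨1, one_mem _, one_ne_zero, by simp, fun c hc => ⟨0, by simpa⟩⟩
    rintro ⟨_ | _, _ | _⟩ ⟨_ | _, _ | _⟩
    · exact refl _
    · exact chartRing_overlap a b _ _ (yFun a b) (by simp [ht, hy]) 0 0 1 0 0 1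
        0 1 0 0 1 0 1 0 1 0 0 0
        (by simp [coord]; try field_simp) (by simp [coord]; try field_simp) (by simp [coord]; try field_simp)
        (by simp [coord]; try field_simp) (by simp [coord]; try field_simp)
    · exact chartRing_overlap a b _ _ (tFun a b) (by simp [ht, hy]) 1 0 0 1 0 0
        1 0 0 0 6 0 1 0 9 0 0 1
        (by simp [coord]; try field_simp) (by simp [coord]; try field_simp) (by simp [coord]; try field_simp)
        (by simp [coord]; try field_simp) (by simp [coord]; try field_simp)
    · exact chartRing_overlap a b _ _ (tFun a b * yFun a b) (by simp [ht, hy]) 1 0 1 10 0 1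
        1 0 0 1 1 4 1 0 1 10 0 0
        (by simp [coord]; try field_simp) (by simp [coord]; try field_simp) (by simp [coord]; try field_simp)
        (by simp [coord]; try field_simp) (by simp [coord]; try field_simp)
    · exact chartRing_overlap a b _ _ (1 / yFun a b) (by simp [ht, hy]) 0 0 1 0 0 1
        0 1 0 0 1 0 1 0 1 0 0 0
        (by simp [coord]; try field_simp) (by simp [coord]; try field_simp) (by simp [coord]; try field_simp)
        (by simp [coord]; try field_simp) (by simp [coord]; try field_simp)
    · exact refl _
    · exact chartRing_overlap a b _ _ (tFun a b ^ 10 / yFun a b) (by simp [ht, hy]) 10 0 1 1 0 1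
        1 9 0 1 1 4 1 0 1 1 0 0
        (by simp [coord]; try field_simp) (by simp [coord]; try field_simp) (by simp [coord]; try field_simp)
        (by simp [coord]; try field_simp) (by simp [coord]; try field_simp)
    · exact chartRing_overlap a b _ _ (tFun a b) (by simp [ht, hy]) 1 0 0 1 0 0
        1 0 0 0 0 3 1 0 0 9 0 1
        (by simp [coord]; try field_simp) (by simp [coord]; try field_simp) (by simp [coord]; try field_simp)
        (by simp [coord]; try field_simp) (by simp [coord]; try field_simp)
    · exact chartRing_overlap a b _ _ (1 / tFun a b) (by simp [ht, hy]) 1 0 0 1 0 0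
        1 0 0 0 6 0 1 0 9 0 0 1
        (by simp [coord]; try field_simp) (by simp [coord]; try field_simp) (by simp [coord]; try field_simp)
        (by simp [coord]; try field_simp) (by simp [coord]; try field_simp)
    · exact chartRing_overlap a b _ _ (yFun a b / tFun a b ^ 10) (by simp [ht, hy]) 1 0 1 10 0 1
        1 0 0 1 1 4 1 0 1 10 0 0
        (by simp [coord]; try field_simp) (by simp [coord]; try field_simp) (by simp [coord]; try field_simp)
        (by simp [coord]; try field_simp) (by simp [coord]; try field_simp)
    · exact refl _
    · exact chartRing_overlap a b _ _ (yFun a b / tFun a b ^ 9) (by simp [ht, hy]) 0 0 1 0 0 1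
        0 1 0 0 1 0 1 0 1 0 0 0
        (by simp [coord]; try field_simp) (by simp [coord]; try field_simp) (by simp [coord]; try field_simp)
        (by simp [coord]; try field_simp) (by simp [coord]; try field_simp)
    · exact chartRing_overlap a b _ _ (1 / (tFun a b * yFun a b)) (by simp [ht, hy]) 10 0 1 1 0 1
        1 9 0 1 1 4 1 0 1 1 0 0
        (by simp [coord]; try field_simp) (by simp [coord]; try field_simp) (by simp [coord]; try field_simp)
        (by simp [coord]; try field_simp) (by simp [coord]; try field_simp)
    · exact chartRing_overlap a b _ _ (1 / tFun a b) (by simp [ht, hy]) 1 0 0 1 0 0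
        1 0 0 0 0 3 1 0 0 9 0 1
        (by simp [coord]; try field_simp) (by simp [coord]; try field_simp) (by simp [coord]; try field_simp)
        (by simp [coord]; try field_simp) (by simp [coord]; try field_simp)
    · exact chartRing_overlap a b _ _ (tFun a b ^ 9 / yFun a b) (by simp [ht, hy]) 0 0 1 0 0 1
        0 1 0 0 1 0 1 0 1 0 0 0
        (by simp [coord]; try field_simp) (by simp [coord]; try field_simp) (by simp [coord]; try field_simp)
        (by simp [coord]; try field_simp) (by simp [coord]; try field_simp)
    · exact refl _

theorem mem_adjoin_coord (f : FunField a b) :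
    f ∈ IntermediateField.adjoin k (Set.range (coord a b (false, false))) := by
  set L := IntermediateField.adjoin k (Set.range (coord a b (false, false)))
  have hc : ∀ j, coord a b (false, false) j ∈ L :=
    fun j => IntermediateField.subset_adjoin _ _ ⟨j, rfl⟩
  have hpoly : ∀ p : k[X], baseFun a b (algebraMap k[X] (RatFunc k) p) ∈ L := by
    intro p
    induction p using Polynomial.induction_on with
    | C c => exact L.algebraMap_mem c
    | add p q hp hq => simpa [baseFun] using add_mem hp hq
    | monomial n c h =>
      have h1 := mul_mem h (hc 0)
      convert h1 using 1
      simp [baseFun, coord, tFun, pow_succ, mul_assoc]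
  have hbase : ∀ r : RatFunc k, baseFun a b r ∈ L := by
    intro r
    have h1 := div_mem (hpoly r.num) (hpoly r.denom)
    convert h1 using 1
    change algebraMap (RatFunc k) (FunField a b) r = algebraMap (RatFunc k) (FunField a b) _ /
      algebraMap (RatFunc k) (FunField a b) _
    rw [← map_div₀, RatFunc.num_div_denom]
  have hx : ∀ p : (RatFunc k)[X], algebraMap (genericFiber a b).CoordinateRing (FunField a b)
      (WeierstrassCurve.Affine.CoordinateRing.mk _ (C p)) ∈ L := by
    intro p
    induction p using Polynomial.induction_on with
    | C c => exact hbase c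
    | add p q hp hq => simpa using add_mem hp hq
    | monomial n c h =>
      have h1 := mul_mem h (hc 1)
      convert h1 using 1
      simp [coord, xFun, pow_succ, mul_assoc]
  have hy : ∀ p : (RatFunc k)[X][X], algebraMap (genericFiber a b).CoordinateRing (FunField a b)
      (WeierstrassCurve.Affine.CoordinateRing.mk _ p) ∈ L := by
    intro p
    induction p using Polynomial.induction_on with
    | C c => exact hx c
    | add p q hp hq => simpa using add_mem hp hq
    | monomial n c h =>
      have h1 := mul_mem h (hc 2)
      convert h1 using 1
      simp [coord, yFun, pow_succ, mul_assoc]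
  have hR : ∀ r : (genericFiber a b).CoordinateRing,
      algebraMap (genericFiber a b).CoordinateRing (FunField a b) r ∈ L := by
    intro r
    obtain ⟨p, rfl⟩ := AdjoinRoot.mk_surjective r
    exact hy p
  obtain ⟨p, q, -, rfl⟩ := IsFractionRing.div_surjective
    (A := (genericFiber a b).CoordinateRing) f
  exact div_mem (hR p) (hR q)

instance : IsFractionRing (chartRing a b (false, false)) (FunField a b) :=
  .of_field _ _ fun f => by
    obtain ⟨p, hp, q, hq, h⟩ := IntermediateField.mem_adjoin_iff_div.mp (mem_adjoin_coord a b f)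
    exact ⟨⟨p, hp⟩, ⟨q, hq⟩, h⟩

instance (i : Bool × Bool) : IsNoetherianRing (chartRing a b i) := by
  have h : (chartRing a b i).FG := ⟨(Set.finite_range (coord a b i)).toFinset, by
    rw [Set.Finite.coe_toFinset]; rfl⟩
  have : Algebra.FiniteType k (chartRing a b i) := (Subalgebra.fg_iff_finiteType _).mp h
  exact Algebra.FiniteType.isNoetherianRing k _

/-- The Weierstrass fibration `Y² Z = X³ + a X Z² + b Z³` over `ℙ¹`. -/
noncomputable abbrev surface : Scheme.{0} := glued (chartRing a b)

/-- The structure morphism of the surface. -/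
noncomputable abbrev surfaceToSpec : surface a b ⟶ Spec (.of k) := gluedToSpec (chartRing a b)

/-- An element of `k(t)(x, y)` as a rational function on the surface. -/
noncomputable def toFunctionField : FunField a b →+* (surface a b).functionField :=
  fieldToFunctionField (chartRing a b) (false, false)

/-- The rational function `f` on the surface vanishes along the prime divisor `C`. -/
def VanishesAlong (f : FunField a b) (C : PrimeDivisor (surface a b)) : Prop :=
  f = 0 ∨ 0 < Scheme.ord (toFunctionField a b f) C.1

/-- `C` is the section curve of the rational point `P` of the generic fibre, i.e. the closure of
`P` in the surface: `C` dominates the base, and its intersection with the generic fibre is `P`. -/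
def IsSectionCurve (P : (genericFiber a b).Point) (C : PrimeDivisor (surface a b)) : Prop :=
  (∀ r : RatFunc k, r ≠ 0 → Scheme.ord (toFunctionField a b (baseFun a b r)) C.1 = 0) ∧
  match P with
  | .zero => VanishesAlong a b (xFun a b / yFun a b) C ∧ VanishesAlong a b (1 / yFun a b) C
  | .some x₀ y₀ _ => VanishesAlong a b (xFun a b - baseFun a b x₀) C ∧
      VanishesAlong a b (yFun a b - baseFun a b y₀) C

/-- The fibre of the fibration over the point `t = 0`. -/
noncomputable def fiberDivisor : WeilDivisor (surface a b) :=
  zerosOf (toFunctionField a b (tFun a b))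

/-- The class of a prime divisor in the Néron–Severi group of the surface. -/
noncomputable abbrev curveClass (C : PrimeDivisor (surface a b)) :
    NeronSeveri (surfaceToSpec a b) :=
  nsClass (surfaceToSpec a b) (Finsupp.single C 1)

/-- The class of a fibre in the Néron–Severi group of the surface. -/
noncomputable abbrev fiberClass : NeronSeveri (surfaceToSpec a b) :=
  nsClass (surfaceToSpec a b) (fiberDivisor a b)

end
end EllipticSurface

/-! Write `n` for the multiple, `F` for a fibre and `τ` for the section curve of `n P`. On the
generic fibre, an elliptic curve over `k(t)`, the divisor `(n P) - n (P) + (n - 1) (O)` has degree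
zero and sum zero in the group, so it is the divisor of a rational function `g`
(`exists_ordAt_eq_pointOrd_zsmul`). On the surface, `τ - n σ + (n - 1) z - div g` then consists of
vertical curves only. The fibres of a Weierstrass fibration are irreducible and reduced cubics, and
fibres over `ℙ¹` are linearly equivalent to each other. Hence `τ - n σ + (n - 1) z + m F` is
principal for some integer `m` (`exists_sub_mem`).

The integer `m` is found by intersecting with sections. A fibre meets a section once
(`interNumber_fiber`), and every section has self-intersection `-3` (`interNumber_self`): the
conormal bundle of a section is generated by the relative differential `dx / (2 y)`, which is
multiplied by the transition function of `𝒪(3)` between the two charts of the base. Intersecting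
with `z`, `σ` and `τ` gives three equations for `m`, `τ · z` and `τ · σ`; eliminating the last two
leaves `m = -(z · σ + 3) n (n - 1)`. Only linear equivalence is used, which is finer than equality
in the Néron–Severi group.

The intersection number is defined by moving a divisor and summing lengths, so its independence of
the choices has to be proved. This is done for curves `σ` that are locally given by one equation and
whose local rings are the valuation rings of a field with a sum formula. At a point of `σ` the local
ring of the surface is then factorial (`uniqueFactorizationMonoid_of_ker`), the local intersection
number of `div f` with `σ` is the valuation of the restriction of `f` (`localSum_divOf`), and
principal divisors have total intersection zero with `σ`.

Smoothness enters through the jacobian criterion (`jacobianCriterion_of_smooth`). It provides the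
local equations of sections (`coord_sub_div_gen_mem`) and excludes sections of order two
(`ne_zero_of_equation`). Throughout, local rings are treated as subrings of the function field, so
that points are handled by the functions that are regular or vanish there. -/

set_option linter.unusedSectionVars false

/-! ### The function field of a scheme glued from affine charts -/

namespace Glue
open AlgebraicGeometry CategoryTheory Limits
section
variable {X : Scheme.{0}} {A B : CommRingCat.{0}} (f : Spec A ⟶ X) [IsOpenImmersion f]
  (g : Spec B ⟶ X) [IsOpenImmersion g]

/-- Sections over an affine open subscheme. -/
noncomputable def affineSections : Γ(X, f.opensRange) ≅ A :=
  X.presheaf.mapIso (eqToIso (Scheme.Hom.image_top_eq_opensRange f)).op ≪≫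
    f.appIso ⊤ ≪≫ Scheme.ΓSpecIso _

theorem preimage_opensRange_eq_top : f ⁻¹ᵁ f.opensRange = ⊤ := by
  rw [← Scheme.Hom.image_top_eq_opensRange, Scheme.Hom.preimage_image_eq]

theorem affineSections_inv_appLE :
    (affineSections f).inv ≫ f.appLE _ ⊤ (preimage_opensRange_eq_top f).ge =
      (Scheme.ΓSpecIso A).inv := by
  rw [Iso.inv_comp_eq]
  simp only [affineSections, Iso.trans_hom, Functor.mapIso_hom, Category.assoc, Iso.hom_inv_id,
    Category.comp_id]
  rw [Scheme.Hom.appIso_hom', Iso.op_hom, eqToIso.hom, Scheme.Hom.map_appLE]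

theorem isUnit_germ_affineSections_inv (q : Spec A) (hq : f q ∈ f.opensRange) (c : A) :
    IsUnit (X.presheaf.germ f.opensRange (f q) hq ((affineSections f).inv c)) ↔
      c ∉ q.asIdeal := by
  have h := Scheme.basicOpen_appLE f ⊤ _ (preimage_opensRange_eq_top f).ge
    ((affineSections f).inv c)
  have h2 : f.appLE _ ⊤ (preimage_opensRange_eq_top f).ge ((affineSections f).inv c) =
      (Scheme.ΓSpecIso A).inv c := by
    rw [← affineSections_inv_appLE f]; rfl
  rw [h2, top_inf_eq] at h
  have h3 : q ∈ (Spec A).basicOpen ((Scheme.ΓSpecIso A).inv c) ↔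
      f q ∈ X.basicOpen ((affineSections f).inv c) := by
    rw [h]; rfl
  rw [basicOpen_eq_of_affine] at h3
  exact (Scheme.mem_basicOpen _ _ _ _).symm.trans h3.symm

/-- Sections over the range of `g` embed into the sections over `Spec B`, so the two maps may be
compared after pulling back along `g`. -/
theorem affineSections_inv_map (φ : A ⟶ B) (h : Spec.map φ ≫ f = g)
    (hle : g.opensRange ≤ f.opensRange) :
    (affineSections f).inv ≫ X.presheaf.map (homOfLE hle).op = φ ≫ (affineSections g).inv := by
  have hg : g.appLE _ ⊤ (preimage_opensRange_eq_top g).ge =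
      (affineSections g).hom ≫ (Scheme.ΓSpecIso B).inv := by
    rw [← affineSections_inv_appLE g, Iso.hom_inv_id_assoc]
  have : Mono (g.appLE _ ⊤ (preimage_opensRange_eq_top g).ge) := by
    rw [hg]; infer_instance
  rw [← cancel_mono (g.appLE _ ⊤ (preimage_opensRange_eq_top g).ge), Category.assoc,
    Category.assoc, affineSections_inv_appLE g, Scheme.Hom.map_appLE]
  have h3 : ⊤ ≤ g ⁻¹ᵁ f.opensRange := (preimage_opensRange_eq_top g).ge.trans
    (Scheme.Hom.preimage_mono g hle)
  have h4 : (⊤ : (Spec B).Opens) ≤ Spec.map φ ⁻¹ᵁ ⊤ := le_rfl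
  have h1 : g.appLE f.opensRange ⊤ h3 =
      f.appLE _ ⊤ (preimage_opensRange_eq_top f).ge ≫ (Spec.map φ).appLE ⊤ ⊤ h4 := by
    rw [Scheme.Hom.appLE_comp_appLE]
    subst h
    rfl
  have h2 : (Scheme.ΓSpecIso A).inv ≫ (Spec.map φ).appLE ⊤ ⊤ h4 =
      φ ≫ (Scheme.ΓSpecIso B).inv := by
    rw [Scheme.ΓSpecIso_inv_naturality]
    simp [Scheme.Hom.app_eq_appLE]
  rw [← h2, ← affineSections_inv_appLE f, Category.assoc, ← h1]

end

section
variable {k F : Type} [Field k] [Field F] [Algebra k F] {ι : Type} (R : ι → Subalgebra k F)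
  [IsGluable R]

theorem isUnit_germ_chartIso_inv (i : ι) (q : Spec (.of (R i)))
    (hq : chartMap R i q ∈ (chartMap R i).opensRange) (c : R i) :
    IsUnit ((glued R).presheaf.germ (chartMap R i).opensRange (chartMap R i q) hq
      ((chartIso R i).inv c)) ↔ c ∉ q.asIdeal :=
  isUnit_germ_affineSections_inv (chartMap R i) q hq c

/-- Functions on two charts become comparable in the coordinate ring of the intersection of the
charts; the germ at the generic point is not changed by restriction to it. -/
theorem exists_interRing_hom (i j : ι) [Nonempty ι] [DecidableEq ι] :
    ∃ ψ : interRing R {i, j} →+* (glued R).functionField,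
      (∀ (h : R i ≤ interRing R {i, j}) (c : R i),
        ψ (Subalgebra.inclusion h c) = chartToFunctionField R i c) ∧
      ∀ (h : R j ≤ interRing R {i, j}) (c : R j),
        ψ (Subalgebra.inclusion h c) = chartToFunctionField R j c := by
  let I : Finset ι := {i, j}
  have hiI : i ∈ I := by simp [I]
  have hjI : j ∈ I := by simp [I]
  have hI : I.Nonempty := ⟨i, hiI⟩
  have hR : ∀ l ∈ I, R l ≤ interRing R I := fun l hl => le_biSup R hl
  have hW : ∀ l (hl : l ∈ I), (interMap R I hI).opensRange ≤ (chartMap R l).opensRange := by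
    intro l hl y hy
    obtain ⟨x, rfl⟩ := Scheme.Hom.mem_opensRange.mp hy
    rw [← specIncl_chartMap R hl (hR l hl), Scheme.Hom.comp_apply]
    exact Scheme.Hom.mem_opensRange.mpr ⟨_, rfl⟩
  have hne : Nonempty (interMap R I hI).opensRange :=
    ⟨⟨interMap R I hI (botPt _), Scheme.Hom.mem_opensRange.mpr ⟨_, rfl⟩⟩⟩
  have key : ∀ l (hl : l ∈ I) (c : R l), (glued R).presheaf.map (homOfLE (hW l hl)).op
      ((chartIso R l).inv c) = (affineSections (interMap R I hI)).inv
        (Subalgebra.inclusion (hR l hl) c) := by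
    intro l hl c
    have h1 := affineSections_inv_map (chartMap R l) (interMap R I hI)
      (CommRingCat.ofHom (Subalgebra.inclusion (hR l hl)).toRingHom)
      (specIncl_chartMap R hl (hR l hl)) (hW l hl)
    exact congrArg (fun φ => φ.hom c) h1
  have h7 : ∀ l (hl : l ∈ I) (c : R l), (glued R).germToFunctionField (interMap R I hI).opensRange
      ((glued R).presheaf.map (homOfLE (hW l hl)).op ((chartIso R l).inv c)) =
      chartToFunctionField R l c := by
    intro l hl c
    exact TopCat.Presheaf.germ_res_apply _ _ _ _ _
  refine ⟨((glued R).germToFunctionField (interMap R I hI).opensRange).hom.comp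
    (affineSections (interMap R I hI)).inv.hom, fun h c => ?_, fun h c => ?_⟩
  · rw [← h7 i hiI, key i hiI]; rfl
  · rw [← h7 j hjI, key j hjI]; rfl

/-- The embedding of `F` was built from the chart `i₀` alone, and this makes it independent of the
chart. If `c = a / b` with `a` and `b` on the chart `i₀`, the relation `c * b = a` holds in the
coordinate ring of the intersection and can be read in the function field from either side. -/
theorem fieldToFunctionField_coe [Nonempty ι] (i₀ : ι) [IsFractionRing (R i₀) F] (j : ι)
    (c : R j) : fieldToFunctionField R i₀ c = chartToFunctionField R j c := by
  classical
  obtain ⟨ψ, h₀, h₁⟩ := exists_interRing_hom R i₀ j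
  have hi : R i₀ ≤ interRing R {i₀, j} := le_biSup R (by simp)
  have hj : R j ≤ interRing R {i₀, j} := le_biSup R (by simp)
  have hφ : ∀ d : R i₀, fieldToFunctionField R i₀ d = chartToFunctionField R i₀ d := fun d =>
    IsFractionRing.lift_algebraMap (chartToFunctionField_injective R i₀) d
  obtain ⟨a, b, hb, hab⟩ := IsFractionRing.div_surjective (A := R i₀) (c : F)
  have hb0 : b ≠ 0 := nonZeroDivisors.ne_zero hb
  have hb1 : (b : F) ≠ 0 := fun h => hb0 (Subtype.ext h)
  have hb2 : chartToFunctionField R i₀ b ≠ 0 :=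
    (map_ne_zero_iff _ (chartToFunctionField_injective R i₀)).mpr hb0
  have e : (c : F) * b = a := by
    rw [← hab]; exact div_mul_cancel₀ _ hb1
  have e1 := congrArg (fieldToFunctionField R i₀) e
  rw [map_mul, hφ, hφ] at e1
  have e2 : ψ (Subalgebra.inclusion hj c) * ψ (Subalgebra.inclusion hi b) =
      ψ (Subalgebra.inclusion hi a) := by
    rw [← map_mul]
    exact congrArg ψ (Subtype.ext e)
  rw [h₀, h₀, h₁] at e2
  exact mul_right_cancel₀ hb2 (e1.trans e2.symm)

theorem fieldToFunctionField_surjective [Nonempty ι] (i₀ : ι) [IsFractionRing (R i₀) F] :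
    Function.Surjective (fieldToFunctionField R i₀) := by
  intro f
  have := functionField_isFractionRing_of_isAffineOpen (glued R) (chartMap R i₀).opensRange
    (isAffineOpen_opensRange _)
  obtain ⟨a, b, -, rfl⟩ := IsFractionRing.div_surjective
    (A := Γ(glued R, (chartMap R i₀).opensRange)) f
  have h : ∀ c : Γ(glued R, (chartMap R i₀).opensRange),
      fieldToFunctionField R i₀ ((chartIso R i₀).hom c : R i₀) =
        algebraMap _ (glued R).functionField c := by
    intro c
    rw [fieldToFunctionField_coe]
    change (glued R).germToFunctionField _ ((chartIso R i₀).inv ((chartIso R i₀).hom c)) = _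
    rw [Iso.hom_inv_id_apply]
    rfl
  exact ⟨((chartIso R i₀).hom a : R i₀) / ((chartIso R i₀).hom b : R i₀), by
    rw [map_div₀, h, h]⟩

/-- The common field of fractions of the charts is the function field of the glued scheme. -/
noncomputable def fieldEquiv [Nonempty ι] (i₀ : ι) [IsFractionRing (R i₀) F] :
    F ≃+* (glued R).functionField :=
  RingEquiv.ofBijective (fieldToFunctionField R i₀)
    ⟨(fieldToFunctionField R i₀).injective, fieldToFunctionField_surjective R i₀⟩

end
end Glue

/-! ### Local rings as subrings of the function field -/

namespace DivisorTheory
open AlgebraicGeometry CategoryTheory Limits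

section
variable {X : Scheme.{0}} [AlgebraicGeometry.IsIntegral X]
  {F : Type} [Field F] (φ : F ≃+* X.functionField)

/-- The local ring of the scheme `X` at `p`, as a subring of the function field. -/
noncomputable def stk (p : X) : Subring F :=
  (algebraMap (X.presheaf.stalk p) X.functionField).range.comap φ.toRingHom

/-- The stalk at `p` as a subring of the function field. -/
noncomputable def stkEquiv (p : X) : X.presheaf.stalk p ≃+* stk φ p :=
  RingEquiv.ofBijective
    ((φ.symm.toRingHom.comp (algebraMap (X.presheaf.stalk p) X.functionField)).codRestrict
      (stk φ p) fun s => ⟨s, by simp⟩)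
    ⟨fun s t h => by
      have h1 := congrArg Subtype.val h
      exact IsFractionRing.injective _ X.functionField (φ.symm.injective h1),
    fun ⟨f, s, hs⟩ => ⟨s, Subtype.ext (by
      change φ.symm (algebraMap _ _ s) = f
      rw [hs]; simp)⟩⟩

theorem apply_stkEquiv (p : X) (s : X.presheaf.stalk p) :
    φ (stkEquiv φ p s) = algebraMap _ X.functionField s := by
  change φ (φ.symm _) = _
  simp

instance (p : X) : IsLocalRing (stk φ p) :=
  IsLocalRing.of_surjective' (stkEquiv φ p).toRingHom (stkEquiv φ p).surjective

instance [IsLocallyNoetherian X] (p : X) : IsNoetherianRing (stk φ p) :=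
  isNoetherianRing_of_ringEquiv _ (stkEquiv φ p)

instance (p : X) : IsFractionRing (stk φ p) F := by
  refine .of_field _ _ fun f => ?_
  obtain ⟨a, b, hb, h⟩ := IsFractionRing.div_surjective (A := X.presheaf.stalk p) (φ f)
  refine ⟨stkEquiv φ p a, stkEquiv φ p b, φ.injective ?_⟩
  change φ f = φ ((stkEquiv φ p a : F) / (stkEquiv φ p b : F))
  rw [map_div₀, apply_stkEquiv, apply_stkEquiv, h]

/-- The rational function `f` is defined at `p` and vanishes there. -/
def Van (p : X) (f : F) : Prop := ∃ h : f ∈ stk φ p, (⟨f, h⟩ : stk φ p) ∈ IsLocalRing.maximalIdeal (stk φ p)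

variable {φ} in
theorem Van.mem {p : X} {f : F} (h : Van φ p f) : f ∈ stk φ p :=
  h.1

variable {φ} {p : X} {f g : F}

theorem van_coe_iff {f : stk φ p} : Van φ p f ↔ f ∈ IsLocalRing.maximalIdeal (stk φ p) :=
  ⟨fun h => h.2, fun h => ⟨f.2, h⟩⟩

theorem van_zero : Van φ p 0 := ⟨zero_mem _, zero_mem _⟩

theorem not_van_one : ¬ Van φ p 1 := fun ⟨_, h'⟩ =>
  (IsLocalRing.mem_maximalIdeal _).mp h' isUnit_one

theorem Van.add (hf : Van φ p f) (hg : Van φ p g) : Van φ p (f + g) :=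
  ⟨add_mem hf.1 hg.1, add_mem hf.2 hg.2⟩

theorem Van.neg (hf : Van φ p f) : Van φ p (-f) :=
  ⟨neg_mem hf.1, neg_mem hf.2⟩

theorem Van.sub (hf : Van φ p f) (hg : Van φ p g) : Van φ p (f - g) :=
  ⟨sub_mem hf.1 hg.1, sub_mem hf.2 hg.2⟩

theorem Van.mul_left (hf : Van φ p f) (hg : g ∈ stk φ p) : Van φ p (g * f) :=
  ⟨mul_mem hg hf.1, Ideal.mul_mem_left _ ⟨g, hg⟩ hf.2⟩

theorem Van.mul_right (hf : Van φ p f) (hg : g ∈ stk φ p) : Van φ p (f * g) :=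
  mul_comm g f ▸ hf.mul_left hg

theorem van_mul_iff (hf : f ∈ stk φ p) (hg : g ∈ stk φ p) :
    Van φ p (f * g) ↔ Van φ p f ∨ Van φ p g := by
  refine ⟨fun h => ?_, fun h => h.elim (fun h => h.mul_right hg) fun h => h.mul_left hf⟩
  have h1 : (⟨f, hf⟩ * ⟨g, hg⟩ : stk φ p) ∈ IsLocalRing.maximalIdeal (stk φ p) := h.2
  rcases (inferInstance : (IsLocalRing.maximalIdeal (stk φ p)).IsPrime).mem_or_mem h1 with h | h
  · exact .inl ⟨hf, h⟩
  · exact .inr ⟨hg, h⟩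

theorem van_pow_iff (hf : f ∈ stk φ p) {n : ℕ} (hn : n ≠ 0) : Van φ p (f ^ n) ↔ Van φ p f := by
  induction n with
  | zero => exact absurd rfl hn
  | succ n ih =>
    rcases eq_or_ne n 0 with rfl | h0
    · simp
    · rw [pow_succ, van_mul_iff (pow_mem hf n) hf, ih h0, or_self]

theorem inv_mem_of_not_van (hf : f ∈ stk φ p) (h : ¬ Van φ p f) : f⁻¹ ∈ stk φ p := by
  have h1 : IsUnit (⟨f, hf⟩ : stk φ p) := by
    by_contra h2
    exact h ⟨hf, (IsLocalRing.mem_maximalIdeal _).mpr h2⟩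
  obtain ⟨u, hu⟩ := h1
  have h2 : f * ((u⁻¹ : (stk φ p)ˣ) : stk φ p) = 1 := by
    have := u.mul_inv
    rw [hu] at this
    exact congrArg Subtype.val this
  rw [inv_eq_of_mul_eq_one_right h2]
  exact Subtype.property _

theorem not_van_of_inv_mem (hf0 : f ≠ 0) (h : f⁻¹ ∈ stk φ p) : ¬ Van φ p f := by
  intro hv
  have h1 := hv.mul_left h
  rw [inv_mul_cancel₀ hf0] at h1
  exact not_van_one h1

theorem ne_zero_of_not_van (h : ¬ Van φ p f) : f ≠ 0 := by
  rintro rfl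
  exact h van_zero

theorem not_van_inv (hf : f ∈ stk φ p) (h0 : f ≠ 0) : ¬ Van φ p f⁻¹ :=
  not_van_of_inv_mem (inv_ne_zero h0) (by simpa)

theorem van_sub_congr (h : Van φ p (f - g)) : Van φ p f ↔ Van φ p g :=
  ⟨fun hf => by simpa using hf.sub h, fun hg => by simpa using h.add hg⟩

variable {x : X}

theorem algebraMap_stalkSpecializes (h : x ⤳ p) (s : X.presheaf.stalk p) :
    algebraMap (X.presheaf.stalk x) X.functionField (X.presheaf.stalkSpecializes h s) =
      algebraMap (X.presheaf.stalk p) X.functionField s := by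
  change (X.presheaf.stalkSpecializes h ≫ X.presheaf.stalkSpecializes _) s = _
  rw [TopCat.Presheaf.stalkSpecializes_comp]
  rfl

theorem stkEquiv_stalkSpecializes (h : x ⤳ p) (s : X.presheaf.stalk p) :
    (stkEquiv φ x (X.presheaf.stalkSpecializes h s) : F) = stkEquiv φ p s := by
  apply φ.injective
  rw [apply_stkEquiv, apply_stkEquiv, algebraMap_stalkSpecializes]

theorem stk_le (h : x ⤳ p) : stk φ p ≤ stk φ x := by
  intro f hf
  have h1 := stkEquiv_stalkSpecializes (φ := φ) h ((stkEquiv φ p).symm ⟨f, hf⟩)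
  rw [RingEquiv.apply_symm_apply] at h1
  rw [← show _ = f from h1]
  exact Subtype.property _

theorem van_stkEquiv {s : X.presheaf.stalk p} :
    Van φ p (stkEquiv φ p s) ↔ s ∈ IsLocalRing.maximalIdeal (X.presheaf.stalk p) := by
  rw [van_coe_iff, IsLocalRing.mem_maximalIdeal, IsLocalRing.mem_maximalIdeal, mem_nonunits_iff,
    mem_nonunits_iff, MulEquiv.isUnit_map (stkEquiv φ p)]

theorem mem_localIdeal (h : x ⤳ p) {s : X.presheaf.stalk p} :
    s ∈ localIdeal x p ↔ Van φ x (stkEquiv φ p s) := by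
  rw [localIdeal, dif_pos h, Ideal.mem_comap, ← van_stkEquiv (φ := φ)]
  change Van φ x (stkEquiv φ x (X.presheaf.stalkSpecializes h s)) ↔ _
  rw [stkEquiv_stalkSpecializes]

/-- If `f` were a unit at `p`, its inverse would belong to the larger local ring at `x`, against the
vanishing of `f` there. -/
theorem Van.of_specializes (h : x ⤳ p) (hf : f ∈ stk φ p) (hv : Van φ x f) : Van φ p f := by
  by_contra h1
  have h2 := stk_le h (inv_mem_of_not_van hf h1)
  exact not_van_of_inv_mem (by rintro rfl; exact h1 van_zero) h2 hv

omit [AlgebraicGeometry.IsIntegral X] in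
theorem exists_mem_affineOpens (p : X) : ∃ U : X.affineOpens, p ∈ U.1 := by
  obtain ⟨_, ⟨A, hA, rfl⟩, hxA, -⟩ :=
    X.isBasis_affineOpens.exists_subset_of_mem_open (show p ∈ (⊤ : X.Opens) from trivial)
      (⊤ : X.Opens).isOpen
  exact ⟨⟨A, hA⟩, hxA⟩

/-- The local ring at a generalization of `p` is a localization of the local ring at `p`. -/
theorem exists_div_of_specializes (h : x ⤳ p) (hf : f ∈ stk φ x) :
    ∃ a ∈ stk φ p, ∃ b ∈ stk φ p, ¬ Van φ x b ∧ f = a / b := by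
  obtain ⟨U, hp⟩ := exists_mem_affineOpens p
  have hx : x ∈ U.1 := h.mem_open U.1.isOpen hp
  have hne : Nonempty U.1 := ⟨⟨p, hp⟩⟩
  have hloc := U.2.isLocalization_stalk ⟨x, hx⟩
  let := TopCat.Presheaf.algebra_section_stalk X.presheaf (⟨x, hx⟩ : U.1)
  let s := (stkEquiv φ x).symm ⟨f, hf⟩
  obtain ⟨⟨a, b⟩, hab⟩ := IsLocalization.surj (M := (U.2.primeIdealOf ⟨x, hx⟩).asIdeal.primeCompl) s
  have hb := IsLocalization.map_units (M := (U.2.primeIdealOf ⟨x, hx⟩).asIdeal.primeCompl)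
    (X.presheaf.stalk x) b
  have hg : ∀ c : Γ(X, U.1), (stkEquiv φ p (X.presheaf.germ U.1 p hp c) : F) =
      stkEquiv φ x (X.presheaf.germ U.1 x hx c) := by
    intro c
    apply φ.injective
    rw [apply_stkEquiv, apply_stkEquiv, Scheme.algebraMap_germ_eq_germToFunctionField,
      Scheme.algebraMap_germ_eq_germToFunctionField]
  have hbv : ¬ Van φ x (stkEquiv φ p (X.presheaf.germ U.1 p hp b) : F) := by
    rw [hg, van_stkEquiv, IsLocalRing.mem_maximalIdeal, mem_nonunits_iff, not_not]
    exact hb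
  refine ⟨_, (stkEquiv φ p (X.presheaf.germ U.1 p hp a)).2, _,
    (stkEquiv φ p (X.presheaf.germ U.1 p hp b)).2, hbv, ?_⟩
  rw [eq_div_iff (ne_zero_of_not_van hbv), hg, hg]
  have h1 := congrArg (fun t => (stkEquiv φ x t : F)) hab
  simp only [map_mul, Subring.coe_mul] at h1
  rw [show stkEquiv φ x s = ⟨f, hf⟩ from (stkEquiv φ x).apply_symm_apply _] at h1
  exact h1

/-- A prime ideal of the local ring at `p` is the ideal of a generalization of `p`. -/
theorem exists_specializes (P : Ideal (stk φ p)) [hP : P.IsPrime] :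
    ∃ x : X, x ⤳ p ∧ ∀ f : stk φ p, Van φ x f ↔ f ∈ P := by
  let y : Spec (X.presheaf.stalk p) := ⟨P.comap (stkEquiv φ p).toRingHom, inferInstance⟩
  have hy : X.fromSpecStalk p y ⤳ p := by
    have h1 : X.fromSpecStalk p y ∈ Set.range (X.fromSpecStalk p) := ⟨y, rfl⟩
    rwa [Scheme.range_fromSpecStalk] at h1
  refine ⟨_, hy, fun f => ?_⟩
  -- The closed point of the local ring at the image of `y`, pushed to the spectrum of the local
  -- ring at `p`, has the same image as `y`. By injectivity it is `y`, which identifies the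
  -- functions vanishing at the image with the elements of `P`.
  have h1 := Scheme.fromSpecStalk_closedPoint (x := X.fromSpecStalk p y)
  rw [← Scheme.SpecMap_stalkSpecializes_fromSpecStalk hy] at h1
  change X.fromSpecStalk p (Spec.map (X.presheaf.stalkSpecializes hy) _) = X.fromSpecStalk p y at h1
  have h2 := (X.fromSpecStalk p).isEmbedding.injective h1
  have h3 : ∀ s, s ∈ localIdeal (X.fromSpecStalk p y) p ↔ s ∈ y.asIdeal := by
    intro s
    rw [localIdeal, dif_pos hy]
    exact SetLike.ext_iff.mp (congrArg PrimeSpectrum.asIdeal h2) s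
  have h4 := h3 ((stkEquiv φ p).symm f)
  rw [mem_localIdeal (φ := φ) hy, RingEquiv.apply_symm_apply] at h4
  rw [h4]
  change (stkEquiv φ p) ((stkEquiv φ p).symm f) ∈ P ↔ _
  rw [RingEquiv.apply_symm_apply]

/-- The points that specialize to `p` form the spectrum of the local ring at `p`, where
specialization is inclusion of prime ideals; it can therefore be tested on functions regular at `p`.
-/
theorem specializes_of_van_le {x y p : X} (hx : x ⤳ p) (hy : y ⤳ p)
    (h : ∀ f ∈ stk φ p, Van φ x f → Van φ y f) : x ⤳ y := by
  have key : ∀ z : X, z ⤳ p → ∃ w : PrimeSpectrum (X.presheaf.stalk p),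
      X.fromSpecStalk p w = z ∧ ∀ s, s ∈ w.asIdeal ↔ Van φ z (stkEquiv φ p s) := by
    intro z hz
    refine ⟨PrimeSpectrum.comap (X.presheaf.stalkSpecializes hz).hom (IsLocalRing.closedPoint _),
      ?_, fun s => ?_⟩
    · have h1 := Scheme.fromSpecStalk_closedPoint (x := z)
      rwa [← Scheme.SpecMap_stalkSpecializes_fromSpecStalk hz] at h1
    · rw [← mem_localIdeal hz, localIdeal, dif_pos hz]
      rfl
  obtain ⟨w, rfl, hw⟩ := key x hx
  obtain ⟨w', rfl, hw'⟩ := key y hy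
  refine Specializes.map ?_ (X.fromSpecStalk p).continuous
  refine (PrimeSpectrum.le_iff_specializes w w').mp ?_
  intro s hs
  exact (hw' s).mpr (h _ (Subtype.property _) ((hw s).mp hs))

end
end DivisorTheory

/-! ### Orders of rational functions along prime divisors -/

namespace DivisorTheory
open AlgebraicGeometry CategoryTheory Limits

section
variable {X : Scheme.{0}} [AlgebraicGeometry.IsIntegral X]

theorem coheight_lt_of_specializes {x y : X} (h : x ⤳ y) (hne : x ≠ y)
    (hx : Order.coheight x < ⊤) : Order.coheight x < Order.coheight y := by
  have hle : y ≤ x := Scheme.le_iff_specializes.mpr h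
  refine Order.coheight_strictAnti (lt_of_le_not_ge hle fun h' => hne ?_) hx
  exact (h.antisymm (Scheme.le_iff_specializes.mp h')).eq

theorem PrimeDivisor.eq_of_specializes {C C' : PrimeDivisor X} (h : C.1 ⤳ C'.1) : C = C' := by
  by_contra hne
  have h1 := coheight_lt_of_specializes h (fun h' => hne (Subtype.ext h')) (by rw [C.2]; simp)
  rw [C.2, C'.2] at h1
  exact lt_irrefl _ h1

variable {F : Type} [Field F] (φ : F ≃+* X.functionField) [IsLocallyNoetherian X]

/-- A Noetherian local domain with nonzero principal maximal ideal is a principal ideal ring of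
dimension one, and the dimension of the local ring is the coheight of the point. This is how points
are recognized as prime divisors below. -/
theorem coheight_eq_one_of_generator {x : X} {s : F} (hs0 : s ≠ 0) (hs : Van φ x s)
    (h : ∀ f, Van φ x f → f / s ∈ stk φ x) : Order.coheight x = 1 := by
  have hmax : IsLocalRing.maximalIdeal (stk φ x) = Ideal.span {⟨s, hs.1⟩} := by
    ext f
    rw [Ideal.mem_span_singleton, ← van_coe_iff]
    constructor
    · intro hf
      refine ⟨⟨_, h _ hf⟩, Subtype.ext ?_⟩
      simp [mul_div_cancel₀ _ hs0]
    · rintro ⟨c, rfl⟩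
      exact hs.mul_right c.2
  have hnf : ¬ IsField (stk φ x) := by
    rw [IsLocalRing.isField_iff_maximalIdeal_eq, hmax, Ideal.span_singleton_eq_bot]
    exact fun h0 => hs0 (congrArg Subtype.val h0)
  have hpr : (IsLocalRing.maximalIdeal (stk φ x)).IsPrincipal := by rw [hmax]; infer_instance
  have hpid : IsPrincipalIdealRing (stk φ x) :=
    ((tfae_of_isNoetherianRing_of_isLocalRing_of_isDomain (stk φ x)).out 0 4).mpr hpr
  have h1 := IsPrincipalIdealRing.ringKrullDim_eq_one (stk φ x) hnf
  rw [← ringKrullDim_eq_of_ringEquiv (stkEquiv φ x), ringKrullDim_stalk_eq_coheight] at h1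
  exact_mod_cast h1

/-- The order of the rational function `f` along the prime divisor `C`. -/
noncomputable def ordAt (C : PrimeDivisor X) (f : F) : ℤ := Scheme.ord (φ f) C.1

variable {φ} {C : PrimeDivisor X} {f g : F}

theorem ordAt_mul (hf : f ≠ 0) (hg : g ≠ 0) : ordAt φ C (f * g) = ordAt φ C f + ordAt φ C g := by
  rw [ordAt, map_mul, Scheme.ord_mul ((map_ne_zero φ).mpr hf) ((map_ne_zero φ).mpr hg)]
  rfl

theorem ordAt_zero : ordAt φ C 0 = 0 := by simp [ordAt]

theorem ordAt_one : ordAt φ C 1 = 0 := by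
  have h := ordAt_mul (φ := φ) (C := C) one_ne_zero one_ne_zero
  rw [mul_one] at h
  lia

theorem ordAt_inv : ordAt φ C f⁻¹ = - ordAt φ C f := by
  rcases eq_or_ne f 0 with rfl | hf
  · simp [ordAt_zero]
  have h := ordAt_mul (φ := φ) (C := C) hf (inv_ne_zero hf)
  rw [mul_inv_cancel₀ hf, ordAt_one] at h
  lia

theorem ordAt_div (hf : f ≠ 0) (hg : g ≠ 0) : ordAt φ C (f / g) = ordAt φ C f - ordAt φ C g := by
  rw [div_eq_mul_inv, ordAt_mul hf (inv_ne_zero hg), ordAt_inv, sub_eq_add_neg]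

theorem ordAt_pow (hf : f ≠ 0) (n : ℕ) : ordAt φ C (f ^ n) = n * ordAt φ C f := by
  induction n with
  | zero => simp [ordAt_one]
  | succ n ih => rw [pow_succ, ordAt_mul (pow_ne_zero n hf) hf, ih]; push_cast; ring

theorem ordAt_zpow (hf : f ≠ 0) (n : ℤ) : ordAt φ C (f ^ n) = n * ordAt φ C f := by
  obtain ⟨m, rfl | rfl⟩ := n.eq_nat_or_neg
  · rw [zpow_natCast, ordAt_pow hf]
  · rw [zpow_neg, zpow_natCast, ordAt_inv, ordAt_pow hf]; ring

theorem ordAt_stkEquiv {s : X.presheaf.stalk C.1} {n : ℕ} (hs : s ≠ 0)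
    (h : Ring.ord (X.presheaf.stalk C.1) s = n) : ordAt φ C (stkEquiv φ C.1 s) = n := by
  have : Ring.KrullDimLE 1 (X.presheaf.stalk C.1) := krullDimLE_of_coheight_le C.2.le
  rw [ordAt, apply_stkEquiv, Scheme.ord_eq_iff C.2 (by
    rwa [ne_eq, map_eq_zero_iff _ (IsFractionRing.injective _ _)])]
  change Ring.ordFrac (X.presheaf.stalk C.1) _ = _
  rw [Ring.ordFrac_eq_ord _ hs, Ring.ordMonoidWithZeroHom_eq_coe _ (by simpa using hs) h]

theorem exists_ordAt_eq (hf : f ∈ stk φ C.1) (h0 : f ≠ 0) :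
    ∃ (s : X.presheaf.stalk C.1) (n : ℕ), stkEquiv φ C.1 s = ⟨f, hf⟩ ∧
      Ring.ord (X.presheaf.stalk C.1) s = n ∧ ordAt φ C f = n := by
  have : Ring.KrullDimLE 1 (X.presheaf.stalk C.1) := krullDimLE_of_coheight_le C.2.le
  obtain ⟨s, hs⟩ := (stkEquiv φ C.1).surjective ⟨f, hf⟩
  have hs0 : s ≠ 0 := by
    rintro rfl
    rw [map_zero] at hs
    exact h0 (congrArg Subtype.val hs).symm
  obtain ⟨n, hn⟩ := ENat.ne_top_iff_exists.mp
    (Ring.ord_ne_top (R := X.presheaf.stalk C.1) (a := s) (by simpa using hs0))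
  have h1 := ordAt_stkEquiv (φ := φ) hs0 hn.symm
  rw [hs] at h1
  exact ⟨s, n, hs, hn.symm, h1⟩

theorem ordAt_nonneg (hf : f ∈ stk φ C.1) : 0 ≤ ordAt φ C f := by
  rcases eq_or_ne f 0 with rfl | h0
  · rw [ordAt_zero]
  · obtain ⟨s, n, -, -, h⟩ := exists_ordAt_eq hf h0
    rw [h]; positivity

/-- The order of an element of the local ring is the length of the quotient by it, which is zero
exactly for units. The local ring need not be a valuation ring for this. -/
theorem ordAt_pos_iff (hf : f ∈ stk φ C.1) (h0 : f ≠ 0) : 0 < ordAt φ C f ↔ Van φ C.1 f := by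
  obtain ⟨s, n, hs, hn, h⟩ := exists_ordAt_eq hf h0
  have h1 : Van φ C.1 f ↔ s ∈ IsLocalRing.maximalIdeal (X.presheaf.stalk C.1) := by
    rw [← van_stkEquiv (φ := φ), hs]
  have h2 : n = 0 ↔ IsUnit s := by
    rw [← Nat.cast_inj (R := ℕ∞), ← hn, Ring.ord, Nat.cast_zero, Module.length_eq_zero_iff,
      Submodule.Quotient.subsingleton_iff, Ideal.span_singleton_eq_top]
  rw [h, h1, IsLocalRing.mem_maximalIdeal, mem_nonunits_iff, ← h2]
  lia

theorem ordAt_eq_zero (hf : f ∈ stk φ C.1) (h : ¬ Van φ C.1 f) : ordAt φ C f = 0 := by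
  have h1 := ordAt_nonneg hf
  have h2 := ordAt_pos_iff hf (ne_zero_of_not_van h)
  by_contra h3
  exact h (h2.mp (lt_of_le_of_ne h1 (Ne.symm h3)))

/-- Such an `f` generates the maximal ideal, so the quotient by it is the residue field, of length
one. -/
theorem ordAt_eq_one (hf : Van φ C.1 f) (h : ∀ g, Van φ C.1 g → g / f ∈ stk φ C.1)
    (h0 : f ≠ 0) : ordAt φ C f = 1 := by
  obtain ⟨s, n, hs, hn, h1⟩ := exists_ordAt_eq hf.1 h0
  have hmax : IsLocalRing.maximalIdeal (X.presheaf.stalk C.1) = Ideal.span {s} := by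
    ext t
    rw [← van_stkEquiv (φ := φ), Ideal.mem_span_singleton]
    constructor
    · intro ht
      obtain ⟨c, hc⟩ := (stkEquiv φ C.1).surjective ⟨_, h _ ht⟩
      refine ⟨c, (stkEquiv φ C.1).injective (Subtype.ext ?_)⟩
      rw [map_mul, hs, hc]
      simp [mul_div_cancel₀ _ h0]
    · rintro ⟨c, rfl⟩
      rw [map_mul, hs]
      exact hf.mul_right (stkEquiv φ C.1 c).2
  have h2 : Ring.ord (X.presheaf.stalk C.1) s = 1 := by
    rw [Ring.ord, ← hmax, Module.length_eq_one_iff]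
    rw [isSimpleModule_iff_isSimpleModule_of_algebraMap_surjective
      (S := X.presheaf.stalk C.1 ⧸ IsLocalRing.maximalIdeal (X.presheaf.stalk C.1))
      Ideal.Quotient.mk_surjective]
    let := Ideal.Quotient.field (IsLocalRing.maximalIdeal (X.presheaf.stalk C.1))
    exact instIsSimpleModule _
  rw [h1]
  rw [hn] at h2
  exact_mod_cast h2

end
end DivisorTheory

/-! ### Discrete valuations and lengths -/

/-- A normalized discrete valuation of a field, written additively; its value at `0` is
arbitrary. -/
structure DiscPlace (L : Type) [Field L] where
  /-- the valuation -/
  v : L → ℤ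
  map_mul : ∀ {r s : L}, r ≠ 0 → s ≠ 0 → v (r * s) = v r + v s
  map_add : ∀ {r s : L}, r ≠ 0 → s ≠ 0 → r + s ≠ 0 → min (v r) (v s) ≤ v (r + s)
  exists_eq_one : ∃ r, r ≠ 0 ∧ v r = 1

namespace DiscPlace
variable {L : Type} [Field L] (P : DiscPlace L) {r s : L}

theorem map_one : P.v 1 = 0 := by
  have h := P.map_mul (one_ne_zero (α := L)) one_ne_zero
  rw [mul_one] at h
  lia

theorem map_neg_one : P.v (-1) = 0 := by
  have h := P.map_mul (neg_ne_zero.mpr (one_ne_zero (α := L))) (neg_ne_zero.mpr one_ne_zero)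
  rw [neg_mul_neg, one_mul, P.map_one] at h
  lia

theorem map_neg (r : L) : P.v (-r) = P.v r := by
  rcases eq_or_ne r 0 with rfl | hr
  · simp
  · rw [← neg_one_mul, P.map_mul (neg_ne_zero.mpr one_ne_zero) hr, P.map_neg_one, zero_add]

theorem map_inv (hr : r ≠ 0) : P.v r⁻¹ = - P.v r := by
  have h := P.map_mul hr (inv_ne_zero hr)
  rw [mul_inv_cancel₀ hr, P.map_one] at h
  lia

theorem map_div (hr : r ≠ 0) (hs : s ≠ 0) : P.v (r / s) = P.v r - P.v s := by
  rw [div_eq_mul_inv, P.map_mul hr (inv_ne_zero hs), P.map_inv hs, sub_eq_add_neg]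

theorem map_pow (hr : r ≠ 0) (n : ℕ) : P.v (r ^ n) = n * P.v r := by
  induction n with
  | zero => simp [P.map_one]
  | succ n ih => rw [pow_succ, P.map_mul (pow_ne_zero n hr) hr, ih]; push_cast; ring

/-- The valuation ring. -/
def ring : Subring L where
  carrier := {r | r = 0 ∨ 0 ≤ P.v r}
  zero_mem' := .inl rfl
  one_mem' := .inr P.map_one.ge
  mul_mem' := by
    rintro r s hr hs
    by_cases hr0 : r = 0
    · left; simp [hr0]
    by_cases hs0 : s = 0
    · left; simp [hs0]
    · right
      rw [P.map_mul hr0 hs0]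
      exact add_nonneg (hr.resolve_left hr0) (hs.resolve_left hs0)
  add_mem' := by
    rintro r s hr hs
    by_cases hr0 : r = 0
    · simpa [hr0] using hs
    by_cases hs0 : s = 0
    · simpa [hs0] using hr
    by_cases h0 : r + s = 0
    · exact .inl h0
    · exact .inr ((le_min (hr.resolve_left hr0) (hs.resolve_left hs0)).trans
        (P.map_add hr0 hs0 h0))
  neg_mem' := by
    rintro r hr
    by_cases hr0 : r = 0
    · left; simp [hr0]
    · right; rw [P.map_neg]; exact hr.resolve_left hr0

theorem mem_ring : r ∈ P.ring ↔ r = 0 ∨ 0 ≤ P.v r := Iff.rfl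

theorem mem_ring_iff (hr : r ≠ 0) : r ∈ P.ring ↔ 0 ≤ P.v r := by simp [mem_ring, hr]

theorem isUnit_iff {r : P.ring} (hr : (r : L) ≠ 0) : IsUnit r ↔ P.v r = 0 := by
  constructor
  · rintro ⟨u, rfl⟩
    have h1 : ((u : P.ring) : L) * ((u⁻¹ : (P.ring)ˣ) : P.ring) = 1 :=
      congrArg Subtype.val u.mul_inv
    have h2 : (((u⁻¹ : (P.ring)ˣ) : P.ring) : L) ≠ 0 := right_ne_zero_of_mul_eq_one h1
    have h3 := P.map_mul hr h2
    rw [h1, P.map_one] at h3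
    have h4 := (P.mem_ring_iff hr).mp (u : P.ring).2
    have h5 := (P.mem_ring_iff h2).mp ((u⁻¹ : (P.ring)ˣ) : P.ring).2
    lia
  · intro h
    have h1 : (r : L)⁻¹ ∈ P.ring := (P.mem_ring_iff (inv_ne_zero hr)).mpr (by
      rw [P.map_inv hr, h]; simp)
    exact IsUnit.of_mul_eq_one ⟨_, h1⟩ (Subtype.ext (mul_inv_cancel₀ hr))

theorem dvd_iff {r s : P.ring} (hr : (r : L) ≠ 0) (hs : (s : L) ≠ 0) :
    r ∣ s ↔ P.v r ≤ P.v s := by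
  constructor
  · rintro ⟨c, rfl⟩
    have hc : (c : L) ≠ 0 := by
      rintro h
      exact hs (by simp [h])
    have := (P.mem_ring_iff hc).mp c.2
    rw [Subring.coe_mul, P.map_mul hr hc]
    lia
  · intro h
    refine ⟨⟨s / r, (P.mem_ring_iff (div_ne_zero hs hr)).mpr ?_⟩, Subtype.ext ?_⟩
    · rw [P.map_div hs hr]; lia
    · simp [mul_div_cancel₀ _ hr]

theorem ord_eq_one {π : P.ring} (h0 : (π : L) ≠ 0) (h : P.v π = 1) : Ring.ord P.ring π = 1 := by
  have hmax : (Ideal.span {π}).IsMaximal := by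
    refine Ideal.isMaximal_iff.mpr ⟨fun h1 => ?_, fun J x _ hx hxJ => ?_⟩
    · have h2 := isUnit_of_dvd_one (Ideal.mem_span_singleton.mp h1)
      rw [P.isUnit_iff h0] at h2
      lia
    · have hx0 : (x : L) ≠ 0 := by
        intro h1
        exact hx (by rw [show x = 0 from Subtype.ext h1]; exact zero_mem _)
      rw [Ideal.mem_span_singleton, P.dvd_iff h0 hx0, h] at hx
      have h2 := (P.mem_ring_iff hx0).mp x.2
      have h3 : IsUnit x := (P.isUnit_iff hx0).mpr (by lia)
      rw [← Ideal.eq_top_iff_one]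
      exact Ideal.eq_top_of_isUnit_mem _ hxJ h3
  rw [Ring.ord, Module.length_eq_one_iff]
  rw [isSimpleModule_iff_isSimpleModule_of_algebraMap_surjective
      (S := P.ring ⧸ Ideal.span {π}) Ideal.Quotient.mk_surjective]
  let := Ideal.Quotient.field (Ideal.span {π})
  exact instIsSimpleModule _

/-- Every nonzero element is associated to a power of a uniformizer, and `Ring.ord` of a power is a
multiple. -/
theorem ord_eq {r : P.ring} (hr : (r : L) ≠ 0) : Ring.ord P.ring r = (P.v r).toNat := by
  obtain ⟨π, hπ0, hπ⟩ := P.exists_eq_one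
  have hπm : π ∈ P.ring := (P.mem_ring_iff hπ0).mpr (by lia)
  have hn := (P.mem_ring_iff hr).mp r.2
  have h1 : Associated (⟨π, hπm⟩ ^ (P.v r).toNat : P.ring) r := by
    have h2 : P.v (π ^ (P.v r).toNat) = P.v r := by
      rw [P.map_pow hπ0, hπ, mul_one, Int.toNat_of_nonneg hn]
    have h3 : ((⟨π, hπm⟩ ^ (P.v r).toNat : P.ring) : L) = π ^ (P.v r).toNat := by simp
    have h4 : π ^ (P.v r).toNat ≠ 0 := pow_ne_zero _ hπ0
    refine associated_of_dvd_dvd ?_ ?_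
    · rw [P.dvd_iff (by rwa [h3]) hr, h3, h2]
    · rw [P.dvd_iff hr (by rwa [h3]), h3, h2]
  rw [← Ring.ord_eq_of_associated h1, Ring.ord_pow, P.ord_eq_one (by exact hπ0) hπ]
  · simp
  · rw [mem_nonZeroDivisors_iff_ne_zero]
    exact fun h => hπ0 (congrArg Subtype.val h)

end DiscPlace

/-- By the isomorphism theorem the quotient is `B ⧸ (e a)`, and lengths over `A` and over `B` agree
because `e` is surjective. With the local ring of a surface for `A` and that of a curve for `B`,
this turns an intersection multiplicity into an order of vanishing on the curve. -/
theorem Module.length_quotient_sup_ker {A B : Type} [CommRing A] [CommRing B] (e : A →+* B)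
    (he : Function.Surjective e) (a : A) :
    Module.length A (A ⧸ (Ideal.span {a} ⊔ RingHom.ker e)) = Ring.ord B (e a) := by
  let := e.toAlgebra
  have h1 : Function.Surjective (algebraMap A B) := he
  let f : A →ₗ[A] B ⧸ Ideal.span {e a} :=
    ((Ideal.Quotient.mkₐ A (Ideal.span {e a})).comp (Algebra.ofId A B)).toLinearMap
  have hf : Function.Surjective f := Ideal.Quotient.mk_surjective.comp he
  have hk : LinearMap.ker f = Ideal.span {a} ⊔ RingHom.ker e := by
    have h2 := Ideal.comap_map_of_surjective e he (Ideal.span {a})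
    rw [Ideal.map_span, Set.image_singleton] at h2
    ext x
    rw [LinearMap.mem_ker, ← RingHom.ker_eq_comap_bot] at *
    rw [← h2, Ideal.mem_comap]
    exact Ideal.Quotient.eq_zero_iff_mem
  rw [Ring.ord, ← Module.length_eq_of_surjective (R := B) (S := A) h1, ← hk]
  exact (f.quotKerEquivOfSurjective hf).length_eq

/-! ### Local intersection numbers with a curve given by one equation -/

namespace DivisorTheory
open AlgebraicGeometry CategoryTheory Limits

/-- A Noetherian local domain with a nonzero element of the maximal ideal that is the kernel of a
surjection onto a discrete valuation ring is factorial. -/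
theorem uniqueFactorizationMonoid_of_ker {A L : Type} [CommRing A] [IsDomain A]
    [IsNoetherianRing A] [IsLocalRing A] [Field L] (P : DiscPlace L) (e : A →+* P.ring)
    (he : Function.Surjective e) {s : A} (hs0 : s ≠ 0) (hs : RingHom.ker e = Ideal.span {s}) :
    UniqueFactorizationMonoid A := by
  have hprime : (RingHom.ker e).IsPrime := RingHom.ker_isPrime e
  have hsm : s ∈ IsLocalRing.maximalIdeal A := by
    refine IsLocalRing.le_maximalIdeal hprime.ne_top ?_
    rw [hs]
    exact Ideal.mem_span_singleton_self s
  -- Kaplansky's criterion: every nonzero prime ideal `Q` has to contain a prime element. If `s`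
  -- lies in `Q` it serves; otherwise `Q` turns out to be principal.
  rw [UniqueFactorizationMonoid.iff_exists_prime_mem_of_isPrime]
  intro Q hQ0 hQ
  by_cases hsQ : s ∈ Q
  · exact ⟨s, hsQ, (Ideal.span_singleton_prime hs0).mp (hs ▸ hprime)⟩
  -- The element `q` of `Q` is chosen so that its restriction to the curve has the least valuation.
  -- Then `e q` divides the restriction of every element of `Q`, which gives divisibility by `q` up
  -- to multiples of `s`.
  obtain ⟨q, hqQ, hq⟩ : ∃ q ∈ Q, ∀ q' ∈ Q, ∃ c d, q' = q * c + s * d := by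
    have hne : ∃ n : ℕ, ∃ q ∈ Q, (e q : L) ≠ 0 ∧ (P.v (e q)).toNat = n := by
      obtain ⟨q, hq, hq0⟩ := Submodule.exists_mem_ne_zero_of_ne_bot hQ0
      by_contra! h
      -- If all elements of `Q` restricted to zero, a given one could be divided by `s` indefinitely
      -- without leaving `Q`, because `s ∉ Q`. Krull's intersection theorem then makes it zero.
      have key : ∀ n : ℕ, ∃ d, q = s ^ n * d := by
        intro n
        induction n with
        | zero => exact ⟨q, by simp⟩
        | succ n ih =>
          obtain ⟨d, hd⟩ := ih
          have hdQ : d ∈ Q := by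
            rw [hd] at hq
            exact (hQ.mem_or_mem hq).resolve_left fun h1 => hsQ (hQ.mem_of_pow_mem n h1)
          have h1 : d ∈ RingHom.ker e := by
            by_contra h2
            exact h _ d hdQ (fun h3 => h2 (Subtype.ext h3)) rfl
          rw [hs, Ideal.mem_span_singleton] at h1
          obtain ⟨d', rfl⟩ := h1
          exact ⟨d', by rw [hd]; ring⟩
      have hinf := Ideal.iInf_pow_eq_bot_of_isLocalRing (IsLocalRing.maximalIdeal A)
        (IsLocalRing.maximalIdeal.isMaximal A).ne_top
      refine hq0 ?_
      rw [← Ideal.mem_bot, ← hinf, Ideal.mem_iInf]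
      intro n
      obtain ⟨d, hd⟩ := key n
      rw [hd]
      exact Ideal.mul_mem_right _ _ (Ideal.pow_mem_pow hsm n)
    classical
    obtain ⟨q, hqQ, hq0, hqn⟩ := Nat.find_spec hne
    refine ⟨q, hqQ, fun q' hq' => ?_⟩
    have hdvd : e q ∣ e q' := by
      by_cases h0 : (e q' : L) = 0
      · rw [show e q' = 0 from Subtype.ext h0]; exact dvd_zero _
      rw [P.dvd_iff hq0 h0]
      have h1 := Nat.find_min' hne ⟨q', hq', h0, rfl⟩
      have h2 := (P.mem_ring_iff hq0).mp (e q).2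
      have h3 := (P.mem_ring_iff h0).mp (e q').2
      lia
    obtain ⟨c, hc⟩ := hdvd
    obtain ⟨c, rfl⟩ := he c
    have h1 : q' - q * c ∈ RingHom.ker e := by
      rw [RingHom.mem_ker, map_sub, map_mul, hc, sub_self]
    rw [hs, Ideal.mem_span_singleton] at h1
    obtain ⟨d, hd⟩ := h1
    exact ⟨c, d, by rw [← hd]; ring⟩
  have hQq : Q = Ideal.span {q} := by
    refine le_antisymm ?_ ((Ideal.span_singleton_le_iff_mem Q).mpr hqQ)
    -- Nakayama's lemma applies to `Q = (q) + s Q`: in `q' = q * c + s * d` the element `d` lies in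
    -- `Q`, since `s * d` does and `s` does not.
    refine Submodule.le_of_le_smul_of_le_jacobson_bot (I := IsLocalRing.maximalIdeal A)
      (IsNoetherian.noetherian Q) (IsLocalRing.maximalIdeal_le_jacobson _) ?_
    intro q' hq'
    obtain ⟨c, d, rfl⟩ := hq q' hq'
    have hd : d ∈ Q := by
      have h1 : s * d ∈ Q := by
        have := Q.sub_mem hq' (Q.mul_mem_right c hqQ)
        rwa [add_sub_cancel_left] at this
      exact (hQ.mem_or_mem h1).resolve_left hsQ
    exact Submodule.add_mem_sup (Ideal.mul_mem_right _ _ (Ideal.mem_span_singleton_self q))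
      (Submodule.smul_mem_smul hsm hd)
  refine ⟨q, hqQ, (Ideal.span_singleton_prime ?_).mp (hQq ▸ hQ)⟩
  rintro rfl
  exact hQ0 (by rw [hQq]; simp)

section
variable {X : Scheme.{0}} [AlgebraicGeometry.IsIntegral X] [AlgebraicGeometry.IsNoetherian X]

/-- The contribution of the point `p` to the intersection number of two prime divisors. -/
noncomputable def localInter (C C' : PrimeDivisor X) (p : X) : ℕ :=
  (Module.length (X.presheaf.stalk p)
    (X.presheaf.stalk p ⧸ (localIdeal C.1 p ⊔ localIdeal C'.1 p))).toNat

theorem localInter_eq_zero {C C' : PrimeDivisor X} {p : X} (h : ¬ C.1 ⤳ p ∨ ¬ C'.1 ⤳ p) :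
    localInter C C' p = 0 := by
  have h1 : localIdeal C.1 p ⊔ localIdeal C'.1 p = ⊤ := by
    rcases h with h | h
    · rw [localIdeal, dif_neg h, top_sup_eq]
    · rw [localIdeal.eq_1 C'.1, dif_neg h, sup_top_eq]
  rw [localInter, h1, Module.length_eq_zero]
  rfl

variable {F : Type} [Field F] (φ : F ≃+* X.functionField)
  {L : Type} [Field L] (σ : PrimeDivisor X) (p : X) (P : DiscPlace L)

/-- The prime divisor `σ` is a nonsingular curve at `p`, given near `p` by one equation. -/
structure LocalCurve where
  specializes : σ.1 ⤳ p
  /-- restriction of functions to the curve -/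
  e : stk φ p →+* P.ring
  surjective : Function.Surjective e
  apply_eq_zero_iff : ∀ f, e f = 0 ↔ Van φ σ.1 f
  /-- a local equation -/
  gen : F
  gen_ne_zero : gen ≠ 0
  gen_mem : gen ∈ stk φ p
  van_gen : Van φ σ.1 gen
  div_gen_mem : ∀ f ∈ stk φ p, Van φ σ.1 f → f / gen ∈ stk φ p

variable {φ σ p P} (S : LocalCurve φ σ p P)
namespace LocalCurve

theorem ker_e : RingHom.ker S.e = Ideal.span {⟨S.gen, S.gen_mem⟩} := by
  ext f
  rw [RingHom.mem_ker, S.apply_eq_zero_iff, Ideal.mem_span_singleton]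
  constructor
  · intro h
    exact ⟨⟨_, S.div_gen_mem f f.2 h⟩, Subtype.ext (by simp [mul_div_cancel₀ _ S.gen_ne_zero])⟩
  · rintro ⟨c, rfl⟩
    exact S.van_gen.mul_right (stk_le S.specializes c.2)

/-- Divisibility by the local equation passes from `p` to the generic point of the curve, since the
local ring there consists of fractions of elements of the local ring at `p`. -/
theorem div_gen_mem_of_van (g : F) (hg : Van φ σ.1 g) : g / S.gen ∈ stk φ σ.1 := by
  obtain ⟨a, ha, b, hb, hb', rfl⟩ := exists_div_of_specializes S.specializes hg.1
  have hb0 := ne_zero_of_not_van hb'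
  have h1 : Van φ σ.1 a := by
    have := hg.mul_right (stk_le S.specializes hb)
    rwa [div_mul_cancel₀ _ hb0] at this
  rw [div_div, mul_comm, ← div_div, div_eq_mul_inv _ b]
  exact mul_mem (stk_le S.specializes (S.div_gen_mem a ha h1))
    (inv_mem_of_not_van (stk_le S.specializes hb) hb')

theorem ordAt_gen : ordAt φ σ S.gen = 1 :=
  ordAt_eq_one S.van_gen S.div_gen_mem_of_van S.gen_ne_zero

theorem exists_pow_gen {f : F} (h0 : f ≠ 0) (hf : f ∈ stk φ σ.1) :
    ∃ n : ℕ, f / S.gen ^ n ∈ stk φ σ.1 ∧ ¬ Van φ σ.1 (f / S.gen ^ n) := by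
  obtain ⟨n, hn⟩ := Int.eq_ofNat_of_zero_le (ordAt_nonneg hf)
  induction n generalizing f with
  | zero =>
    refine ⟨0, by simpa using hf, ?_⟩
    rw [pow_zero, div_one, ← ordAt_pos_iff hf h0, hn]
    simp
  | succ n ih =>
    have hv : Van φ σ.1 f := by
      rw [← ordAt_pos_iff hf h0, hn]
      positivity
    obtain ⟨m, hm⟩ := ih (div_ne_zero h0 S.gen_ne_zero) (S.div_gen_mem_of_van f hv) (by
      rw [ordAt_div h0 S.gen_ne_zero, hn, S.ordAt_gen]; push_cast; ring)
    rw [div_div, ← pow_succ'] at hm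
    exact ⟨m + 1, hm⟩

include S in
/-- A rational function that has neither a zero nor a pole along the curve restricts to it. -/
theorem isUnit_of_ordAt_eq_zero {f : F} (h0 : f ≠ 0) (hf : ordAt φ σ f = 0) :
    f ∈ stk φ σ.1 ∧ ¬ Van φ σ.1 f := by
  obtain ⟨a, b, hb, rfl⟩ := IsFractionRing.div_surjective (A := stk φ σ.1) f
  have ha0 : (a : F) ≠ 0 := fun h => h0 (by change (a : F) / b = 0; rw [h, zero_div])
  have hb0 : (b : F) ≠ 0 := fun h => nonZeroDivisors.ne_zero hb (Subtype.ext h)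
  -- Numerator and denominator are each a power of the local equation times a unit; order zero of
  -- the quotient means that the two powers cancel.
  obtain ⟨n, hn, hn'⟩ := S.exists_pow_gen ha0 a.2
  obtain ⟨m, hm, hm'⟩ := S.exists_pow_gen hb0 b.2
  have e1 := ordAt_eq_zero hn hn'
  have e2 := ordAt_eq_zero hm hm'
  have hg := S.gen_ne_zero
  rw [ordAt_div ha0 (pow_ne_zero _ hg), ordAt_pow hg, S.ordAt_gen] at e1
  rw [ordAt_div hb0 (pow_ne_zero _ hg), ordAt_pow hg, S.ordAt_gen] at e2
  change ordAt φ σ ((a : F) / b) = 0 at hf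
  rw [ordAt_div ha0 hb0] at hf
  have hnm : n = m := by lia
  subst hnm
  have h1 : (a : F) / b = a / S.gen ^ n / (b / S.gen ^ n) :=
    (div_div_div_cancel_right₀ (pow_ne_zero _ hg) _ _).symm
  change (a : F) / b ∈ _ ∧ ¬ Van φ σ.1 ((a : F) / b)
  have h2 := inv_mem_of_not_van hm hm'
  rw [h1, div_eq_mul_inv, van_mul_iff hn h2]
  refine ⟨mul_mem hn h2, not_or.mpr ⟨hn', not_van_inv hm (ne_zero_of_not_van hm')⟩⟩

/-- Near `p` the ideal of `C` is generated by `q` and the ideal of `σ` is the kernel of the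
restriction `S.e`, so the length is evaluated by `Module.length_quotient_sup_ker`. -/
theorem localInter_eq (C : PrimeDivisor X) (hC : C.1 ⤳ p) {q : F} (hq : q ∈ stk φ p)
    (hqσ : ¬ Van φ σ.1 q) (h : ∀ f ∈ stk φ p, Van φ C.1 f ↔ f / q ∈ stk φ p) :
    (localInter C σ p : ℤ) = P.v (S.e ⟨q, hq⟩) := by
  have hq0 : q ≠ 0 := ne_zero_of_not_van hqσ
  let e' := S.e.comp (stkEquiv φ p).toRingHom
  have hk : localIdeal σ.1 p = RingHom.ker e' := by
    ext f
    rw [mem_localIdeal (φ := φ) S.specializes, RingHom.mem_ker, ← S.apply_eq_zero_iff]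
    rfl
  let q' := (stkEquiv φ p).symm ⟨q, hq⟩
  have hq' : stkEquiv φ p q' = ⟨q, hq⟩ := (stkEquiv φ p).apply_symm_apply _
  have hC' : localIdeal C.1 p = Ideal.span {q'} := by
    ext f
    rw [mem_localIdeal (φ := φ) hC, h _ (Subtype.property _), Ideal.mem_span_singleton]
    constructor
    · intro h1
      refine ⟨(stkEquiv φ p).symm ⟨_, h1⟩, (stkEquiv φ p).injective ?_⟩
      rw [map_mul, hq', RingEquiv.apply_symm_apply]
      exact Subtype.ext (mul_div_cancel₀ _ hq0).symm
    · rintro ⟨c, rfl⟩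
      rw [map_mul, hq', Subring.coe_mul, mul_div_cancel_left₀ _ hq0]
      exact Subtype.property _
  have he0 : (S.e ⟨q, hq⟩ : L) ≠ 0 := fun h0 =>
    hqσ ((S.apply_eq_zero_iff ⟨q, hq⟩).mp (Subtype.ext h0))
  rw [localInter, hk, hC', Module.length_quotient_sup_ker e'
    (S.surjective.comp (stkEquiv φ p).surjective)]
  rw [show e' q' = S.e ⟨q, hq⟩ from congrArg S.e hq', P.ord_eq he0]
  rw [ENat.toNat_natCast, Int.toNat_of_nonneg ((P.mem_ring_iff he0).mp (Subtype.property _))]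

/-- The local intersection number of a divisor with the curve. -/
noncomputable def _root_.DivisorTheory.localSum (E : WeilDivisor X) (σ : PrimeDivisor X) (p : X) :
    ℤ :=
  E.sum fun C m => m * (localInter C σ p : ℤ)

theorem _root_.DivisorTheory.localSum_add (E E' : WeilDivisor X) :
    localSum (E + E') σ p = localSum E σ p + localSum E' σ p :=
  Finsupp.sum_add_index' (fun _ => by simp) (fun _ _ _ => by ring)

theorem _root_.DivisorTheory.localSum_congr {E E' : WeilDivisor X}
    (h : ∀ C : PrimeDivisor X, C.1 ⤳ p → E C = E' C) : localSum E σ p = localSum E' σ p := by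
  classical
  rw [localSum, localSum, Finsupp.sum_of_support_subset _ (s := E.support ∪ E'.support)
    Finset.subset_union_left _ (by simp), Finsupp.sum_of_support_subset E'
    Finset.subset_union_right _ (by simp)]
  refine Finset.sum_congr rfl fun C _ => ?_
  by_cases hC : C.1 ⤳ p
  · rw [h C hC]
  · rw [localInter_eq_zero (.inl hC)]; simp

theorem divOf_apply (f : F) (C : PrimeDivisor X) : divOf (φ f) C = ordAt φ C f := rfl

theorem divOf_mul {f g : F} (hf : f ≠ 0) (hg : g ≠ 0) :
    divOf (φ (f * g)) = divOf (φ f) + divOf (φ g) := by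
  ext C
  simp only [Finsupp.add_apply, divOf_apply, ordAt_mul hf hg]

theorem localSum_eq_zero_of_isUnit {f : F} (hf : f ∈ stk φ p) (h : ¬ Van φ p f) :
    localSum (divOf (φ f)) σ p = 0 := by
  rw [localSum_congr (E' := 0) (fun C hC => ?_)]
  · simp [localSum]
  · rw [divOf_apply, ordAt_eq_zero (stk_le hC hf) fun h' => h (h'.of_specializes hC hf)]
    rfl

/-- The prime ideal generated by `q` is the ideal of a point specializing to `p`. That point is a
prime divisor because `q` generates the maximal ideal of its local ring, and near `p` the divisor of
`q` is this prime divisor with multiplicity one. -/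
theorem localSum_prime {q : stk φ p} (hq : Prime q) (hqσ : ¬ Van φ σ.1 q) :
    localSum (divOf (φ q)) σ p = P.v (S.e q) := by
  have hq0 : (q : F) ≠ 0 := ne_zero_of_not_van hqσ
  have hP : (Ideal.span {q}).IsPrime := (Ideal.span_singleton_prime hq.ne_zero).mpr hq
  obtain ⟨x, hx, hxq⟩ := exists_specializes (Ideal.span {q})
  have hxq' : ∀ f ∈ stk φ p, Van φ x f ↔ f / q ∈ stk φ p := by
    intro f hf
    rw [show f = ((⟨f, hf⟩ : stk φ p) : F) from rfl, hxq, Ideal.mem_span_singleton]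
    constructor
    · rintro ⟨c, hc⟩
      rw [hc, Subring.coe_mul, mul_div_cancel_left₀ _ hq0]
      exact c.2
    · intro h
      exact ⟨⟨_, h⟩, Subtype.ext (mul_div_cancel₀ _ hq0).symm⟩
  have hxv : Van φ x q := (hxq q).mpr (Ideal.mem_span_singleton_self q)
  have hxgen : ∀ g, Van φ x g → g / q ∈ stk φ x := by
    intro g hg
    obtain ⟨a, ha, b, hb, hb', rfl⟩ := exists_div_of_specializes hx hg.1
    have h1 : Van φ x a := by
      have := hg.mul_right (stk_le hx hb)
      rwa [div_mul_cancel₀ _ (ne_zero_of_not_van hb')] at this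
    rw [div_div, mul_comm, ← div_div, div_eq_mul_inv _ b]
    exact mul_mem (stk_le hx ((hxq' a ha).mp h1)) (inv_mem_of_not_van (stk_le hx hb) hb')
  let C : PrimeDivisor X := ⟨x, coheight_eq_one_of_generator φ hq0 hxv hxgen⟩
  have h1 : localSum (divOf (φ q)) σ p = localSum (Finsupp.single C 1) σ p := by
    refine localSum_congr fun C' hC' => ?_
    rw [divOf_apply]
    by_cases h : C = C'
    · subst h
      rw [Finsupp.single_eq_same]
      exact ordAt_eq_one hxv hxgen hq0
    · rw [Finsupp.single_eq_of_ne' h]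
      refine ordAt_eq_zero (stk_le hC' q.2) fun hv => h ?_
      refine PrimeDivisor.eq_of_specializes (specializes_of_van_le (φ := φ) hx hC' fun f hf hfv => ?_)
      have h2 := hv.mul_right (stk_le hC' ((hxq' f hf).mp hfv))
      rwa [mul_div_cancel₀ _ hq0] at h2
  rw [h1, localSum, Finsupp.sum_single_index (by simp), one_mul,
    S.localInter_eq C hx q.2 hqσ hxq']

/-- Both sides are additive in `a` and the local ring at `p` is factorial, so units and prime
elements are enough. -/
theorem localSum_coe (a : stk φ p) (ha : ¬ Van φ σ.1 a) :
    localSum (divOf (φ a)) σ p = P.v (S.e a) := by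
  have hgen0 : (⟨S.gen, S.gen_mem⟩ : stk φ p) ≠ 0 := fun h =>
    S.gen_ne_zero (congrArg Subtype.val h)
  have := uniqueFactorizationMonoid_of_ker P S.e S.surjective hgen0 S.ker_e
  induction a using UniqueFactorizationMonoid.induction_on_prime with
  | h₁ => exact absurd van_zero ha
  | h₂ u hu =>
    have h0 : (S.e u : L) ≠ 0 := fun h0 => ha ((S.apply_eq_zero_iff u).mp (Subtype.ext h0))
    rw [(P.isUnit_iff h0).mp (hu.map S.e), localSum_eq_zero_of_isUnit u.2]
    rw [van_coe_iff, IsLocalRing.mem_maximalIdeal, mem_nonunits_iff, not_not]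
    exact hu
  | h₃ b q hb hq ih =>
    have hm : ¬ (Van φ σ.1 q ∨ Van φ σ.1 b) := by
      rwa [← van_mul_iff (stk_le S.specializes q.2) (stk_le S.specializes b.2)]
    rw [not_or] at hm
    have h0 : ∀ c : stk φ p, ¬ Van φ σ.1 c → (S.e c : L) ≠ 0 := fun c hc h0 =>
      hc ((S.apply_eq_zero_iff c).mp (Subtype.ext h0))
    rw [Subring.coe_mul, divOf_mul (ne_zero_of_not_van hm.1) (ne_zero_of_not_van hm.2),
      localSum_add, ih hm.2, S.localSum_prime hq hm.1, map_mul, Subring.coe_mul,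
      P.map_mul (h0 q hm.1) (h0 b hm.2)]

end LocalCurve
end
end DivisorTheory

/-! ### Intersection numbers with a complete curve -/

/-- A family of discrete valuations of a field that satisfies the sum formula. -/
structure PlaceSystem (L Pl : Type) [Field L] where
  place : Pl → DiscPlace L
  finite_support : ∀ r : L, r ≠ 0 → (Function.support fun c => (place c).v r).Finite
  sum_eq_zero : ∀ r : L, r ≠ 0 → ∑ᶠ c, (place c).v r = 0
  exists_separating : ∀ c c', c ≠ c' → ∃ r ∈ (place c').ring, r ∉ (place c).ring

namespace DivisorTheory
open AlgebraicGeometry CategoryTheory Limits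

section
variable {X : Scheme.{0}} [AlgebraicGeometry.IsIntegral X] [AlgebraicGeometry.IsNoetherian X]
  {F : Type} [Field F] (φ : F ≃+* X.functionField)
  {L Pl : Type} [Field L] (V : PlaceSystem L Pl) (σ : PrimeDivisor X)

/-- The prime divisor `σ` is a nonsingular complete curve, with function field `L` and closed
points indexed by `Pl`, that is locally given by one equation. -/
structure CompleteCurve where
  /-- restriction of rational functions to the curve -/
  ev : stk φ σ.1 →+* L
  ev_eq_zero_iff : ∀ f, ev f = 0 ↔ Van φ σ.1 f
  /-- the points of the curve -/
  pt : Pl → X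
  specializes : ∀ c, σ.1 ⤳ pt c
  exists_pt_eq : ∀ p, σ.1 ⤳ p → p ≠ σ.1 → ∃ c, pt c = p
  ev_mem : ∀ c f (hf : f ∈ stk φ (pt c)), ev ⟨f, stk_le (specializes c) hf⟩ ∈ (V.place c).ring
  exists_ev_eq : ∀ c, ∀ r ∈ (V.place c).ring, ∃ f, ∃ hf : f ∈ stk φ (pt c),
    ev ⟨f, stk_le (specializes c) hf⟩ = r
  /-- a local equation -/
  gen : Pl → F
  gen_ne_zero : ∀ c, gen c ≠ 0
  gen_mem : ∀ c, gen c ∈ stk φ (pt c)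
  van_gen : ∀ c, Van φ σ.1 (gen c)
  div_gen_mem : ∀ c, ∀ f ∈ stk φ (pt c), Van φ σ.1 f → f / gen c ∈ stk φ (pt c)

variable {φ V σ} (S : CompleteCurve φ V σ)
namespace CompleteCurve

/-- The germ of a complete curve at one of its points. -/
noncomputable def localCurve (c : Pl) : LocalCurve φ σ (S.pt c) (V.place c) where
  specializes := S.specializes c
  e := (S.ev.comp (Subring.inclusion (stk_le (S.specializes c)))).codRestrict _
    fun f => S.ev_mem c f f.2
  surjective r := by
    obtain ⟨f, hf, h⟩ := S.exists_ev_eq c r r.2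
    exact ⟨⟨f, hf⟩, Subtype.ext h⟩
  apply_eq_zero_iff f := by
    rw [← show _ ↔ Van φ σ.1 f from S.ev_eq_zero_iff ⟨f, stk_le (S.specializes c) f.2⟩]
    exact Subtype.ext_iff
  gen := S.gen c
  gen_ne_zero := S.gen_ne_zero c
  gen_mem := S.gen_mem c
  van_gen := S.van_gen c
  div_gen_mem := S.div_gen_mem c

theorem eq_of_specializes {c c' : Pl} (h : S.pt c ⤳ S.pt c') : c = c' := by
  by_contra hne
  obtain ⟨r, hr, hr'⟩ := V.exists_separating c c' hne
  obtain ⟨f, hf, rfl⟩ := S.exists_ev_eq c' r hr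
  exact hr' (S.ev_mem c f (stk_le h hf))

theorem pt_injective : Function.Injective S.pt := fun c c' h =>
  S.eq_of_specializes (by rw [h])

/-- The intersection of the two curves is closed and has finitely many irreducible components. The
generic point of a component is not that of `σ`, since `C ≠ σ`, so it is a point of `σ`; no other
point of `σ` lies in its closure. Thus each point of the intersection is a component. -/
theorem finite_specializes {C : PrimeDivisor X} (hC : C ≠ σ) : {c | C.1 ⤳ S.pt c}.Finite := by
  obtain ⟨T, hTf, hTc, hTi, hT⟩ :=
    TopologicalSpace.NoetherianSpace.exists_finite_set_isClosed_irreducible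
      (isClosed_closure (s := {C.1}) |>.inter (isClosed_closure (s := {σ.1})))
  refine Set.Finite.of_finite_image (f := fun c => closure {S.pt c}) (hTf.subset ?_) ?_
  · rintro _ ⟨c, hc, rfl⟩
    have h1 : S.pt c ∈ ⋃₀ T := hT ▸ ⟨hc.mem_closure, (S.specializes c).mem_closure⟩
    obtain ⟨t, ht, hct⟩ := h1
    have hgen := (hTi t ht).isGenericPoint_genericPoint (hTc t ht)
    have h2 : (hTi t ht).genericPoint ∈ closure {C.1} ∩ closure {σ.1} :=
      hT ▸ Set.mem_sUnion.mpr ⟨t, ht, hgen.mem⟩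
    have h3 : (hTi t ht).genericPoint ≠ σ.1 := by
      intro h4
      rw [h4] at h2
      exact hC (PrimeDivisor.eq_of_specializes (specializes_iff_mem_closure.mpr h2.1))
    obtain ⟨c', hc'⟩ := S.exists_pt_eq _ (specializes_iff_mem_closure.mpr h2.2) h3
    have h5 : S.pt c' ⤳ S.pt c := by rw [hc']; exact hgen.specializes hct
    rw [S.eq_of_specializes h5] at hc'
    change closure {S.pt c} ∈ T
    rw [hc', show closure {(hTi t ht).genericPoint} = t from hgen]
    exact ht
  · intro c _ c' _ h
    refine S.eq_of_specializes (specializes_iff_mem_closure.mpr ?_)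
    rw [show closure {S.pt c} = closure {S.pt c'} from h]
    exact subset_closure rfl

/-- The sum over all points of the surface reduces to the points on both curves, and such a point is
not the generic point of `σ`. -/
theorem primeInter_eq {C : PrimeDivisor X} (hC : C ≠ σ) :
    (primeInter C σ : ℤ) = ∑ᶠ c, (localInter C σ (S.pt c) : ℤ) := by
  have h1 : primeInter C σ = ∑ᶠ c, localInter C σ (S.pt c) := by
    rw [← finsum_mem_range (f := fun p => localInter C σ p) S.pt_injective]
    rw [primeInter, ← finsum_mem_univ]
    refine finsum_mem_inter_support_eq' _ _ _ fun p hp => ?_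
    refine ⟨fun _ => ?_, fun _ => trivial⟩
    have h2 : C.1 ⤳ p ∧ σ.1 ⤳ p := by
      by_contra h
      exact hp (localInter_eq_zero (not_and_or.mp h))
    obtain ⟨c, rfl⟩ := S.exists_pt_eq p h2.2 fun h3 =>
      hC (PrimeDivisor.eq_of_specializes (by rw [← h3]; exact h2.1))
    exact ⟨c, rfl⟩
  rw [h1]
  refine (Nat.castAddMonoidHom ℤ).map_finsum ((S.finite_specializes hC).subset fun c hc => ?_)
  by_contra h
  exact hc (localInter_eq_zero (.inl h))

theorem sum_primeInter {E : WeilDivisor X} (hE : E σ = 0) :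
    (E.sum fun C m => m * (primeInter C σ : ℤ)) = ∑ᶠ c, localSum E σ (S.pt c) := by
  have hC : ∀ C ∈ E.support, C ≠ σ := by
    rintro C h rfl
    exact (Finsupp.mem_support_iff.mp h) hE
  have hfin : ∀ C ∈ E.support,
      (Function.support fun c => E C * (localInter C σ (S.pt c) : ℤ)).Finite := by
    intro C h
    refine (S.finite_specializes (hC C h)).subset fun c hc => ?_
    by_contra h'
    exact hc (by simp [localInter_eq_zero (.inl h')])
  simp only [localSum, Finsupp.sum]
  rw [finsum_sum_comm _ _ hfin]
  refine Finset.sum_congr rfl fun C h => ?_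
  rw [S.primeInter_eq (hC C h), mul_finsum]

theorem ev_ne_zero {f : F} (hf : f ∈ stk φ σ.1) (h : ¬ Van φ σ.1 f) : S.ev ⟨f, hf⟩ ≠ 0 :=
  fun h0 => h ((S.ev_eq_zero_iff ⟨f, hf⟩).mp h0)

/-- Write `f = a / b` with `a` and `b` regular at the point and not vanishing along `σ`. Both sides
are differences of the values for `a` and `b`, to which `localSum_coe` applies. -/
theorem localSum_divOf {f : F} (hf : f ∈ stk φ σ.1) (h : ¬ Van φ σ.1 f) (c : Pl) :
    localSum (divOf (φ f)) σ (S.pt c) = (V.place c).v (S.ev ⟨f, hf⟩) := by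
  obtain ⟨a, ha, b, hb, hbv, hab⟩ := exists_div_of_specializes (S.specializes c) hf
  have hb0 := ne_zero_of_not_van hbv
  have hf0 := ne_zero_of_not_van h
  have e1 : f * b = a := by rw [hab, div_mul_cancel₀ _ hb0]
  have ha' : ¬ Van φ σ.1 a := by
    rw [← e1, van_mul_iff hf (stk_le (S.specializes c) hb)]
    exact not_or.mpr ⟨h, hbv⟩
  have h1 := (S.localCurve c).localSum_coe ⟨a, ha⟩ ha'
  have h2 := (S.localCurve c).localSum_coe ⟨b, hb⟩ hbv
  have h3 : localSum (divOf (φ f)) σ (S.pt c) + localSum (divOf (φ b)) σ (S.pt c) =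
      localSum (divOf (φ a)) σ (S.pt c) := by
    rw [← localSum_add, ← LocalCurve.divOf_mul hf0 hb0, e1]
  have h4 : S.ev ⟨f, hf⟩ * S.ev ⟨b, stk_le (S.specializes c) hb⟩ =
      S.ev ⟨a, stk_le (S.specializes c) ha⟩ := by
    rw [← map_mul]
    exact congrArg S.ev (Subtype.ext e1)
  have h5 := (V.place c).map_mul (S.ev_ne_zero hf h)
    (S.ev_ne_zero (stk_le (S.specializes c) hb) hbv)
  rw [h4] at h5
  change _ = (V.place c).v (S.ev ⟨a, stk_le (S.specializes c) ha⟩) at h1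
  change _ = (V.place c).v (S.ev ⟨b, stk_le (S.specializes c) hb⟩) at h2
  lia

variable [Nonempty Pl]

include S in
theorem isUnit_of_ordAt_eq_zero {f : F} (h0 : f ≠ 0) (hf : ordAt φ σ f = 0) :
    f ∈ stk φ σ.1 ∧ ¬ Van φ σ.1 f :=
  (S.localCurve (Classical.arbitrary Pl)).isUnit_of_ordAt_eq_zero h0 hf

include S in
-- The local contributions are the valuations of the restriction of `f` to `σ`, and these satisfy
-- the sum formula. The independence of `interNumber` of its choices rests on this.
theorem sum_primeInter_divOf {f : F} (hf0 : f ≠ 0) (hf : ordAt φ σ f = 0) :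
    ((divOf (φ f)).sum fun C m => m * (primeInter C σ : ℤ)) = 0 := by
  obtain ⟨h1, h2⟩ := S.isUnit_of_ordAt_eq_zero hf0 hf
  rw [S.sum_primeInter hf]
  simp only [S.localSum_divOf h1 h2]
  exact V.sum_eq_zero _ (S.ev_ne_zero h1 h2)

variable (φ) in
theorem isInterNumber_iff (D : WeilDivisor X) (n : ℤ) : IsInterNumber D σ n ↔
    ∃ f : F, f ≠ 0 ∧ D σ + ordAt φ σ f = 0 ∧
      n = (D + divOf (φ f)).sum fun C m => m * (primeInter C σ : ℤ) := by
  constructor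
  · rintro ⟨g, hg0, hg, hn⟩
    refine ⟨φ.symm g, by simpa using hg0, ?_, ?_⟩
    · rw [← hg, ordAt, RingEquiv.apply_symm_apply]; rfl
    · rw [hn, RingEquiv.apply_symm_apply]
  · rintro ⟨f, hf0, hf, hn⟩
    exact ⟨φ f, (map_ne_zero φ).mpr hf0, hf, hn⟩

theorem sum_add (E E' : WeilDivisor X) :
    ((E + E').sum fun C m => m * (primeInter C σ : ℤ)) =
      (E.sum fun C m => m * (primeInter C σ : ℤ)) + E'.sum fun C m => m * (primeInter C σ : ℤ) :=
  Finsupp.sum_add_index' (fun _ => by simp) (fun _ _ _ => by ring)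

include S in
theorem isInterNumber_unique {D : WeilDivisor X} {n n' : ℤ} (h : IsInterNumber D σ n)
    (h' : IsInterNumber D σ n') : n = n' := by
  obtain ⟨f, hf0, hf, rfl⟩ := (isInterNumber_iff φ D n).mp h
  obtain ⟨f', hf0', hf', rfl⟩ := (isInterNumber_iff φ D n').mp h'
  have e : D + divOf (φ f) = D + divOf (φ f') + divOf (φ (f / f')) := by
    rw [add_assoc, ← LocalCurve.divOf_mul hf0' (div_ne_zero hf0 hf0'), mul_div_cancel₀ _ hf0']
  rw [e, sum_add, S.sum_primeInter_divOf (div_ne_zero hf0 hf0'), add_zero]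
  rw [ordAt_div hf0 hf0']
  lia

include S in
-- A local equation at any point has order one along `σ`, so a power of it removes `σ` from `D`.
theorem exists_isInterNumber (D : WeilDivisor X) : ∃ n, IsInterNumber D σ n := by
  let c := Classical.arbitrary Pl
  refine ⟨_, (isInterNumber_iff φ D _).mpr ⟨S.gen c ^ (- D σ), zpow_ne_zero _ (S.gen_ne_zero c), ?_,
    rfl⟩⟩
  rw [ordAt_zpow (S.gen_ne_zero c), show ordAt φ σ (S.gen c) = 1 from (S.localCurve c).ordAt_gen]
  ring

include S in
theorem isInterNumber_interNumber (D : WeilDivisor X) : IsInterNumber D σ (interNumber D σ) :=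
  Classical.epsilon_spec (S.exists_isInterNumber D)

include S in
theorem interNumber_eq {D : WeilDivisor X} {n : ℤ} (h : IsInterNumber D σ n) :
    interNumber D σ = n :=
  S.isInterNumber_unique (S.isInterNumber_interNumber D) h

include S in
theorem interNumber_add (D D' : WeilDivisor X) :
    interNumber (D + D') σ = interNumber D σ + interNumber D' σ := by
  obtain ⟨f, hf0, hf, h⟩ := (isInterNumber_iff φ D _).mp (S.isInterNumber_interNumber D)
  obtain ⟨f', hf0', hf', h'⟩ := (isInterNumber_iff φ D' _).mp (S.isInterNumber_interNumber D')
  refine S.interNumber_eq ((isInterNumber_iff φ _ _).mpr ⟨f * f', mul_ne_zero hf0 hf0', ?_, ?_⟩)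
  · rw [ordAt_mul hf0 hf0', Finsupp.add_apply]; lia
  · rw [h, h', ← sum_add, LocalCurve.divOf_mul hf0 hf0']
    congr 1
    abel

include S in
theorem interNumber_divOf {f : F} (hf : f ≠ 0) : interNumber (divOf (φ f)) σ = 0 := by
  refine S.interNumber_eq ((isInterNumber_iff φ _ _).mpr ⟨f⁻¹, inv_ne_zero hf, ?_, ?_⟩)
  · rw [LocalCurve.divOf_apply, ordAt_inv]; ring
  · rw [← LocalCurve.divOf_mul hf (inv_ne_zero hf), mul_inv_cancel₀ hf]
    have : divOf (φ (1 : F)) = 0 := by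
      ext C
      rw [LocalCurve.divOf_apply, ordAt_one]; rfl
    rw [this]; simp

include S in
theorem interNumber_zero : interNumber (0 : WeilDivisor X) σ = 0 := by
  have h := S.interNumber_add 0 0
  rw [add_zero] at h
  lia

include S in
theorem interNumber_neg (D : WeilDivisor X) : interNumber (-D) σ = - interNumber D σ := by
  have h := S.interNumber_add D (-D)
  rw [add_neg_cancel, S.interNumber_zero] at h
  lia

include S in
theorem interNumber_zsmul (n : ℤ) (D : WeilDivisor X) :
    interNumber (n • D) σ = n * interNumber D σ := by
  let I : WeilDivisor X →+ ℤ := ⟨⟨fun D => interNumber D σ, S.interNumber_zero⟩, S.interNumber_add⟩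
  have h := map_zsmul I n D
  rwa [smul_eq_mul] at h

include S in
theorem interNumber_single {C : PrimeDivisor X} (hC : C ≠ σ) :
    interNumber (Finsupp.single C 1) σ = primeInter C σ := by
  refine S.interNumber_eq ((isInterNumber_iff φ _ _).mpr ⟨1, one_ne_zero, ?_, ?_⟩)
  · rw [ordAt_one, Finsupp.single_eq_of_ne' hC, add_zero]
  · have : divOf (φ (1 : F)) = 0 := by
      ext C
      rw [LocalCurve.divOf_apply, ordAt_one]; rfl
    rw [this, add_zero, Finsupp.sum_single_index (by simp), one_mul]

/-- The degree of a divisor on the curve in terms of local equations. -/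
theorem interNumber_eq_finsum {D : WeilDivisor X} {f : F} (hf0 : f ≠ 0)
    (hf : D σ + ordAt φ σ f = 0) (h : Pl → F) (hm : ∀ c, h c ∈ stk φ σ.1)
    (hv : ∀ c, ¬ Van φ σ.1 (h c))
    (hD : ∀ c (C : PrimeDivisor X), C.1 ⤳ S.pt c → D C + ordAt φ C f = ordAt φ C (h c)) :
    interNumber D σ = ∑ᶠ c, (V.place c).v (S.ev ⟨h c, hm c⟩) := by
  refine S.interNumber_eq ((isInterNumber_iff φ _ _).mpr ⟨f, hf0, hf, ?_⟩)
  rw [S.sum_primeInter hf]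
  refine finsum_congr fun c => ?_
  rw [← S.localSum_divOf (hm c) (hv c) c]
  exact localSum_congr fun C hC => (hD c C hC).symm

end CompleteCurve
end
end DivisorTheory

/-! ### Places of the projective line -/

namespace RatFunc
open Polynomial
section
variable {k : Type} [Field k]

/-- The order of a rational function at a point of the affine line. -/
noncomputable def orderAt (c : k) (r : RatFunc k) : ℤ :=
  (r.num.rootMultiplicity c : ℤ) - r.denom.rootMultiplicity c

theorem orderAt_div (c : k) {p q : k[X]} (hp : p ≠ 0) (hq : q ≠ 0) :
    orderAt c (algebraMap k[X] (RatFunc k) p / algebraMap k[X] (RatFunc k) q) =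
      (p.rootMultiplicity c : ℤ) - q.rootMultiplicity c := by
  set r : RatFunc k := algebraMap k[X] (RatFunc k) p / algebraMap k[X] (RatFunc k) q with hr
  have hp' := RatFunc.algebraMap_ne_zero hp
  have hq' := RatFunc.algebraMap_ne_zero hq
  have hr0 : r ≠ 0 := div_ne_zero hp' hq'
  have hn := RatFunc.num_ne_zero hr0
  have hd := r.denom_ne_zero
  have h := RatFunc.num_div_denom r
  nth_rewrite 3 [hr] at h
  rw [div_eq_div_iff (RatFunc.algebraMap_ne_zero hd) hq', ← map_mul, ← map_mul] at h
  have h1 := congrArg (rootMultiplicity c) (RatFunc.algebraMap_injective k h)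
  rw [rootMultiplicity_mul (mul_ne_zero hn hq), rootMultiplicity_mul (mul_ne_zero hp hd)] at h1
  rw [orderAt]
  lia

theorem exists_eq_div {r : RatFunc k} (hr : r ≠ 0) : ∃ p q : k[X], p ≠ 0 ∧ q ≠ 0 ∧
    r = algebraMap k[X] (RatFunc k) p / algebraMap k[X] (RatFunc k) q :=
  ⟨r.num, r.denom, RatFunc.num_ne_zero hr, r.denom_ne_zero, (RatFunc.num_div_denom r).symm⟩

theorem orderAt_algebraMap (c : k) {p : k[X]} (hp : p ≠ 0) :
    orderAt c (algebraMap k[X] (RatFunc k) p) = p.rootMultiplicity c := by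
  have h := orderAt_div c hp one_ne_zero
  rw [map_one, div_one] at h
  rw [h, ← C_1, rootMultiplicity_C]
  simp

theorem orderAt_mul (c : k) {r s : RatFunc k} (hr : r ≠ 0) (hs : s ≠ 0) :
    orderAt c (r * s) = orderAt c r + orderAt c s := by
  obtain ⟨p, q, hp, hq, rfl⟩ := exists_eq_div hr
  obtain ⟨p', q', hp', hq', rfl⟩ := exists_eq_div hs
  rw [div_mul_div_comm, ← map_mul, ← map_mul, orderAt_div c (mul_ne_zero hp hp')
    (mul_ne_zero hq hq'), orderAt_div c hp hq, orderAt_div c hp' hq',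
    rootMultiplicity_mul (mul_ne_zero hp hp'), rootMultiplicity_mul (mul_ne_zero hq hq')]
  push_cast
  ring

theorem orderAt_add (c : k) {r s : RatFunc k} (hr : r ≠ 0) (hs : s ≠ 0) (hrs : r + s ≠ 0) :
    min (orderAt c r) (orderAt c s) ≤ orderAt c (r + s) := by
  obtain ⟨p, q, hp, hq, rfl⟩ := exists_eq_div hr
  obtain ⟨p', q', hp', hq', rfl⟩ := exists_eq_div hs
  have hq1 := RatFunc.algebraMap_ne_zero hq
  have hq1' := RatFunc.algebraMap_ne_zero hq'
  rw [div_add_div _ _ hq1 hq1', ← map_mul, ← map_mul, ← map_mul, ← map_add] at hrs ⊢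
  have hn : p * q' + q * p' ≠ 0 := by
    intro h
    rw [h, map_zero, zero_div] at hrs
    exact hrs rfl
  rw [orderAt_div c hp hq, orderAt_div c hp' hq', orderAt_div c hn (mul_ne_zero hq hq'),
    rootMultiplicity_mul (mul_ne_zero hq hq')]
  have h1 := rootMultiplicity_add (p := p * q') (q := q * p') c hn
  rw [rootMultiplicity_mul (mul_ne_zero hp hq'), rootMultiplicity_mul (mul_ne_zero hq hp')] at h1
  push_cast
  rcases min_le_iff.mp h1 with h2 | h2
  · exact min_le_of_left_le (by lia)
  · exact min_le_of_right_le (by lia)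

theorem algebraMap_X_sub_C (c : k) :
    algebraMap k[X] (RatFunc k) (Polynomial.X - Polynomial.C c) =
      RatFunc.X - RatFunc.C c := by
  simp

theorem X_sub_C_ne_zero (c : k) : (RatFunc.X - RatFunc.C c : RatFunc k) ≠ 0 := by
  rw [← algebraMap_X_sub_C]
  exact RatFunc.algebraMap_ne_zero (Polynomial.X_sub_C_ne_zero c)

theorem orderAt_X_sub_C [DecidableEq k] (c a : k) :
    orderAt c (RatFunc.X - RatFunc.C a : RatFunc k) = if c = a then 1 else 0 := by
  rw [← algebraMap_X_sub_C, orderAt_algebraMap c (Polynomial.X_sub_C_ne_zero a),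
    rootMultiplicity_X_sub_C]
  split_ifs <;> simp

theorem C_ne_zero {u : k} (hu : u ≠ 0) : (RatFunc.C u : RatFunc k) ≠ 0 :=
  (_root_.map_ne_zero _).mpr hu

theorem orderAt_C (c : k) {u : k} (hu : u ≠ 0) : orderAt c (RatFunc.C u : RatFunc k) = 0 := by
  rw [← RatFunc.algebraMap_C, orderAt_algebraMap c (Polynomial.C_ne_zero.mpr hu),
    rootMultiplicity_C]
  rfl

theorem intDegree_X_sub_C (a : k) : (RatFunc.X - RatFunc.C a : RatFunc k).intDegree = 1 := by
  rw [← algebraMap_X_sub_C, intDegree_polynomial, natDegree_X_sub_C]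
  rfl

/-- The discrete valuations of `k(t)` given by the points of the projective line; `none` is the
point at infinity. -/
noncomputable def place : Option k → DiscPlace (RatFunc k)
  | some c =>
    { v := orderAt c
      map_mul := orderAt_mul c
      map_add := orderAt_add c
      exists_eq_one := ⟨_, X_sub_C_ne_zero c, by classical simp [orderAt_X_sub_C]⟩ }
  | none =>
    { v := fun r => - r.intDegree
      map_mul := fun hr hs => by rw [intDegree_mul hr hs]; ring
      map_add := fun {r s} hr hs hrs => by
        have := intDegree_add_le hs hrs
        rcases le_max_iff.mp this with h | h
        · exact min_le_of_left_le (by lia)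
        · exact min_le_of_right_le (by lia)
      exists_eq_one := ⟨RatFunc.X⁻¹, inv_ne_zero RatFunc.X_ne_zero, by simp [intDegree_inv]⟩ }

/-- A uniformizer at a point of the projective line. -/
noncomputable def unif : Option k → RatFunc k
  | some c => RatFunc.X - RatFunc.C c
  | none => RatFunc.X⁻¹

theorem unif_ne_zero (c : Option k) : unif c ≠ 0 := by
  cases c
  · exact inv_ne_zero RatFunc.X_ne_zero
  · exact X_sub_C_ne_zero _

theorem place_unif (c : Option k) : (place c).v (unif c) = 1 := by
  classical
  cases c
  · simp [place, unif, intDegree_inv]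
  · simp [place, unif, orderAt_X_sub_C]

theorem place_C (c : Option k) {u : k} (hu : u ≠ 0) : (place c).v (RatFunc.C u) = 0 := by
  cases c
  · simp [place]
  · exact orderAt_C _ hu

/-- Multiplicative induction for rational functions over an algebraically closed field. -/
theorem induction_on_factors [IsAlgClosed k] {M : RatFunc k → Prop}
    (hC : ∀ u : k, u ≠ 0 → M (RatFunc.C u)) (hX : ∀ a : k, M (RatFunc.X - RatFunc.C a))
    (hmul : ∀ r s, r ≠ 0 → s ≠ 0 → M r → M s → M (r * s)) (hinv : ∀ r, r ≠ 0 → M r → M r⁻¹)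
    {r : RatFunc k} (hr : r ≠ 0) : M r := by
  have hp : ∀ p : k[X], p ≠ 0 → M (algebraMap k[X] (RatFunc k) p) := by
    intro p hp
    have h1 := (IsAlgClosed.splits p).eq_prod_roots
    have h0 : ∀ m : Multiset k,
        (m.map fun a => Polynomial.X - Polynomial.C a).prod ≠ 0 := fun m =>
      (monic_multiset_prod_of_monic _ _ fun a _ => monic_X_sub_C a).ne_zero
    have key : ∀ m : Multiset k, M (algebraMap k[X] (RatFunc k)
        (m.map fun a => Polynomial.X - Polynomial.C a).prod) := by
      intro m
      induction m using Multiset.induction_on with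
      | empty => simpa using hC 1 one_ne_zero
      | cons a m ih =>
        rw [Multiset.map_cons, Multiset.prod_cons, map_mul, algebraMap_X_sub_C]
        exact hmul _ _ (X_sub_C_ne_zero a) (RatFunc.algebraMap_ne_zero (h0 m)) (hX a) ih
    have hl := leadingCoeff_ne_zero.mpr hp
    rw [h1, map_mul, RatFunc.algebraMap_C]
    exact hmul _ _ (C_ne_zero hl) (RatFunc.algebraMap_ne_zero (h0 _)) (hC _ hl) (key _)
  obtain ⟨p, q, hp0, hq0, rfl⟩ := exists_eq_div hr
  rw [div_eq_mul_inv]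
  exact hmul _ _ (RatFunc.algebraMap_ne_zero hp0) (inv_ne_zero (RatFunc.algebraMap_ne_zero hq0))
    (hp p hp0) (hinv _ (RatFunc.algebraMap_ne_zero hq0) (hp q hq0))

theorem finite_support_and_sum [IsAlgClosed k] {r : RatFunc k} (hr : r ≠ 0) :
    (Function.support fun c => (place c).v r).Finite ∧ ∑ᶠ c, (place c).v r = 0 := by
  classical
  refine induction_on_factors (M := fun r => (Function.support fun c => (place c).v r).Finite ∧
    ∑ᶠ c, (place c).v r = 0) (fun u hu => ?_) (fun a => ?_) (fun r s hr hs h h' => ?_)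
    (fun r hr h => ?_) hr
  · have : (fun c => (place c).v (RatFunc.C u)) = fun _ => 0 := funext fun c => place_C c hu
    rw [this]
    simp
  · have h : (Function.support fun c => (place c).v (RatFunc.X - RatFunc.C a)) ⊆
        (({none, some a} : Finset (Option k)) : Set (Option k)) := by
      rintro (_ | c) hc
      · simp
      · have : c = a := by
          by_contra h
          exact hc (by simp [place, orderAt_X_sub_C, h])
        simp [this]
    refine ⟨(Finset.finite_toSet _).subset h, ?_⟩
    rw [finsum_eq_sum_of_support_subset _ h, Finset.sum_pair (by simp)]
    simp [place, orderAt_X_sub_C, intDegree_X_sub_C]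
  · have : (fun c => (place c).v (r * s)) = fun c => (place c).v r + (place c).v s :=
      funext fun c => (place c).map_mul hr hs
    rw [this]
    refine ⟨(h.1.union h'.1).subset (Function.support_add _ _), ?_⟩
    rw [finsum_add_distrib h.1 h'.1, h.2, h'.2, add_zero]
  · have : (fun c => (place c).v r⁻¹) = fun c => - (place c).v r :=
      funext fun c => (place c).map_inv hr
    rw [this]
    refine ⟨by rw [Function.support_fun_neg]; exact h.1, ?_⟩
    rw [finsum_neg_distrib, h.2, neg_zero]

/-- The valuations of `k(t)` given by the points of the projective line. -/
noncomputable def placeSystem [IsAlgClosed k] : PlaceSystem (RatFunc k) (Option k) where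
  place := place
  finite_support _ hr := (finite_support_and_sum hr).1
  sum_eq_zero _ hr := (finite_support_and_sum hr).2
  exists_separating := by
    classical
    rintro (_ | c) c' h
    · refine ⟨RatFunc.X, ?_, ?_⟩
      · obtain ⟨c', rfl⟩ := Option.ne_none_iff_exists'.mp h.symm
        right
        have h1 := orderAt_X_sub_C c' (0 : k)
        rw [map_zero, sub_zero] at h1
        change 0 ≤ orderAt c' _
        rw [h1]
        split_ifs <;> simp
      · rw [DiscPlace.mem_ring_iff _ RatFunc.X_ne_zero]
        simp [place]
    · have h0 := X_sub_C_ne_zero c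
      refine ⟨(RatFunc.X - RatFunc.C c)⁻¹, .inr ?_, ?_⟩
      · rw [DiscPlace.map_inv _ h0]
        cases c' with
        | none => simp [place, intDegree_X_sub_C]
        | some c' =>
          have h2 : c' ≠ c := by rintro rfl; exact h rfl
          simp [place, orderAt_X_sub_C, h2]
      · rw [DiscPlace.mem_ring_iff _ (inv_ne_zero h0), DiscPlace.map_inv _ h0]
        simp [place, orderAt_X_sub_C]

/-- At infinity `t - a = π⁻¹ (1 - a π)`; at a finite point `c ≠ a` the factor is `(c - a) + π`. By
multiplicativity the shape of these linear factors controls all rational functions in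
`ring_place_le`. -/
theorem place_X_sub_C_eq (c : Option k) (a : k) :
    ∃ n : ℤ, ∃ u w : k, u ≠ 0 ∧
      RatFunc.X - RatFunc.C a = unif c ^ n * (RatFunc.C u + RatFunc.C w * unif c) := by
  cases c with
  | none =>
    refine ⟨-1, 1, -a, one_ne_zero, ?_⟩
    have := RatFunc.X_ne_zero (K := k)
    simp only [unif]
    simp
    field_simp
    ring
  | some c =>
    by_cases h : c = a
    · exact ⟨1, 1, 0, one_ne_zero, by simp [unif, h]⟩
    · exact ⟨0, c - a, 1, sub_ne_zero.mpr h, by simp [unif]⟩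

theorem unif_mem (c : Option k) : unif c ∈ (place c).ring :=
  .inr (by rw [place_unif]; simp)

theorem C_mem (c : Option k) (u : k) : RatFunc.C u ∈ (place c).ring := by
  by_cases hu : u = 0
  · left; simp [hu]
  · right; rw [place_C c hu]

/-- The rational function `r` vanishes at the point `c` of the projective line. -/
def InMax (c : Option k) (r : RatFunc k) : Prop := ∃ s ∈ (place c).ring, r = unif c * s

section
variable {c : Option k} {r s : RatFunc k}

theorem inMax_iff : InMax c r ↔ r = 0 ∨ 1 ≤ (place c).v r := by
  have h0 := unif_ne_zero c
  constructor
  · rintro ⟨s, hs, rfl⟩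
    by_cases hs0 : s = 0
    · left; simp [hs0]
    · right
      rw [DiscPlace.map_mul _ h0 hs0, place_unif]
      have := (DiscPlace.mem_ring_iff _ hs0).mp hs
      lia
  · intro h
    by_cases hr : r = 0
    · exact ⟨0, zero_mem _, by simp [hr]⟩
    refine ⟨r / unif c, .inr ?_, (mul_div_cancel₀ r h0).symm⟩
    rw [DiscPlace.map_div _ hr h0, place_unif]
    have := h.resolve_left hr
    lia

theorem InMax.mem (h : InMax c r) : r ∈ (place c).ring := by
  obtain ⟨s, hs, rfl⟩ := h
  exact mul_mem (unif_mem c) hs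

theorem inMax_zero : InMax c 0 := ⟨0, zero_mem _, by simp⟩

theorem inMax_unif : InMax c (unif c) := ⟨1, one_mem _, by simp⟩

theorem InMax.add (h : InMax c r) (h' : InMax c s) : InMax c (r + s) := by
  obtain ⟨r, hr, rfl⟩ := h
  obtain ⟨s, hs, rfl⟩ := h'
  exact ⟨r + s, add_mem hr hs, by ring⟩

theorem InMax.neg (h : InMax c r) : InMax c (-r) := by
  obtain ⟨r, hr, rfl⟩ := h
  exact ⟨-r, neg_mem hr, by ring⟩

theorem InMax.sub (h : InMax c r) (h' : InMax c s) : InMax c (r - s) := by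
  rw [sub_eq_add_neg]
  exact h.add h'.neg

theorem InMax.mul_left (h : InMax c r) (hs : s ∈ (place c).ring) : InMax c (s * r) := by
  obtain ⟨r, hr, rfl⟩ := h
  exact ⟨s * r, mul_mem hs hr, by ring⟩

theorem InMax.mul_right (h : InMax c r) (hs : s ∈ (place c).ring) : InMax c (r * s) :=
  mul_comm s r ▸ h.mul_left hs

theorem not_inMax_one : ¬ InMax c 1 := by
  rw [inMax_iff, DiscPlace.map_one]
  simp

theorem inMax_inv (h : r ∉ (place c).ring) : InMax c r⁻¹ := by
  have hr : r ≠ 0 := by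
    rintro rfl
    exact h (zero_mem _)
  rw [inMax_iff, DiscPlace.map_inv _ hr]
  rw [DiscPlace.mem_ring_iff _ hr] at h
  lia

theorem place_eq_zero (hr : r ∈ (place c).ring) (h : ¬ InMax c r) : r ≠ 0 ∧ (place c).v r = 0 := by
  rw [inMax_iff, not_or] at h
  have := (DiscPlace.mem_ring_iff _ h.1).mp hr
  exact ⟨h.1, by lia⟩

theorem inv_mem_of_not_inMax (hr : r ∈ (place c).ring) (h : ¬ InMax c r) :
    r⁻¹ ∈ (place c).ring := by
  obtain ⟨h0, hv⟩ := place_eq_zero hr h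
  exact .inr (by rw [DiscPlace.map_inv _ h0, hv, neg_zero])

theorem InMax.of_mul (h : InMax c (r * s)) (hr : r ∈ (place c).ring) (hs : s ∈ (place c).ring) :
    InMax c r ∨ InMax c s := by
  by_contra h'
  rw [not_or] at h'
  have h1 := h.mul_left (mul_mem (inv_mem_of_not_inMax hr h'.1) (inv_mem_of_not_inMax hs h'.2))
  rw [← mul_inv, inv_mul_cancel₀ (mul_ne_zero (place_eq_zero hr h'.1).1 (place_eq_zero hs h'.2).1)]
    at h1
  exact not_inMax_one h1

theorem inMax_C_iff {u : k} : InMax c (RatFunc.C u) ↔ u = 0 := by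
  refine ⟨fun h => ?_, ?_⟩
  · by_contra hu
    rw [inMax_iff, place_C c hu] at h
    rcases h with h | h
    · exact C_ne_zero hu h
    · lia
  · rintro rfl
    rw [_root_.map_zero]
    exact inMax_zero

theorem inMax_sub_congr (h : InMax c (r - s)) : InMax c r ↔ InMax c s :=
  ⟨fun hf => by simpa using hf.sub h, fun hg => by simpa using h.add hg⟩

theorem place_C_add {u : k} (hs : s ∈ (place c).ring) (hu : u ≠ 0) :
    RatFunc.C u + s * unif c ≠ 0 ∧ (place c).v (RatFunc.C u + s * unif c) = 0 := by
  refine place_eq_zero (add_mem (C_mem c u) (mul_mem hs (unif_mem c))) fun h => hu ?_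
  rw [← inMax_C_iff (c := c)]
  simpa using h.sub (inMax_unif.mul_left hs)

end

/-- A subring that contains the constants and the uniformizer and in which elements of the form
`u + w π` with `u ≠ 0` are invertible contains the valuation ring. -/
theorem ring_place_le [IsAlgClosed k] (c : Option k) (S : Subring (RatFunc k))
    (hC : ∀ u, RatFunc.C u ∈ S) (hu : unif c ∈ S)
    (hinv : ∀ u w : k, u ≠ 0 → (RatFunc.C u + RatFunc.C w * unif c)⁻¹ ∈ S) :
    (place c).ring ≤ S := by
  -- Every nonzero rational function is a power of the uniformizer times an element that is
  -- invertible in `S` and has valuation zero. For elements of the valuation ring the exponent is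
  -- not negative.
  have key : ∀ r : RatFunc k, r ≠ 0 → ∃ n : ℤ, ∃ e ∈ S, e⁻¹ ∈ S ∧ e ≠ 0 ∧ (place c).v e = 0 ∧
      r = unif c ^ n * e := by
    intro r hr
    have h0 := unif_ne_zero c
    refine induction_on_factors (M := fun r => ∃ n : ℤ, ∃ e ∈ S, e⁻¹ ∈ S ∧ e ≠ 0 ∧
      (place c).v e = 0 ∧ r = unif c ^ n * e) (fun u hu => ?_) (fun a => ?_)
      (fun r s hr hs h h' => ?_) (fun r hr h => ?_) hr
    · exact ⟨0, _, hC u, by rw [← map_inv₀]; exact hC _, C_ne_zero hu, place_C c hu,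
        by simp⟩
    · obtain ⟨n, u, w, hu1, h⟩ := place_X_sub_C_eq c a
      exact ⟨n, _, add_mem (hC u) (mul_mem (hC w) hu), hinv u w hu1, (place_C_add (C_mem c w) hu1).1,
        (place_C_add (C_mem c w) hu1).2, h⟩
    · obtain ⟨n, e, he, hei, he0, hev, rfl⟩ := h
      obtain ⟨n', e', he', hei', he0', hev', rfl⟩ := h'
      refine ⟨n + n', e * e', mul_mem he he', by rw [mul_inv]; exact mul_mem hei hei',
        mul_ne_zero he0 he0', by rw [DiscPlace.map_mul _ he0 he0', hev, hev', zero_add], ?_⟩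
      rw [zpow_add₀ h0]
      ring
    · obtain ⟨n, e, he, hei, he0, hev, rfl⟩ := h
      exact ⟨-n, e⁻¹, hei, by simpa, inv_ne_zero he0, by rw [DiscPlace.map_inv _ he0, hev, neg_zero],
        by rw [mul_inv, zpow_neg]⟩
  intro r hr
  rcases hr with rfl | hr
  · exact zero_mem _
  by_cases hr0 : r = 0
  · rw [hr0]; exact zero_mem _
  obtain ⟨n, e, he, -, he0, hev, rfl⟩ := key r hr0
  have h0 := unif_ne_zero c
  have h1 : (place c).v (unif c ^ n) = n := by
    obtain ⟨m, rfl | rfl⟩ := n.eq_nat_or_neg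
    · rw [zpow_natCast, DiscPlace.map_pow _ h0, place_unif, mul_one]
    · rw [zpow_neg, zpow_natCast, DiscPlace.map_inv _ (pow_ne_zero _ h0), DiscPlace.map_pow _ h0,
        place_unif, mul_one]
  rw [DiscPlace.map_mul _ (zpow_ne_zero _ h0) he0, h1, hev, add_zero] at hr
  lift n to ℕ using hr
  rw [zpow_natCast]
  exact mul_mem (pow_mem hu n) he

/-- Every element of the valuation ring has a residue. -/
theorem exists_residue [IsAlgClosed k] (c : Option k) {r : RatFunc k} (hr : r ∈ (place c).ring) :
    ∃ u : k, ∃ s ∈ (place c).ring, r = RatFunc.C u + unif c * s := by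
  let S : Subring (RatFunc k) :=
    { carrier := {r | ∃ u : k, ∃ s ∈ (place c).ring, r = RatFunc.C u + unif c * s}
      zero_mem' := ⟨0, 0, zero_mem _, by simp⟩
      one_mem' := ⟨1, 0, zero_mem _, by simp⟩
      add_mem' := by
        rintro _ _ ⟨u, s, hs, rfl⟩ ⟨u', s', hs', rfl⟩
        exact ⟨u + u', s + s', add_mem hs hs', by rw [_root_.map_add]; ring⟩
      neg_mem' := by
        rintro _ ⟨u, s, hs, rfl⟩
        exact ⟨-u, -s, neg_mem hs, by rw [_root_.map_neg]; ring⟩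
      mul_mem' := by
        rintro _ _ ⟨u, s, hs, rfl⟩ ⟨u', s', hs', rfl⟩
        exact ⟨u * u', RatFunc.C u * s' + RatFunc.C u' * s + unif c * (s * s'),
          add_mem (add_mem (mul_mem (C_mem c u) hs') (mul_mem (C_mem c u') hs))
            (mul_mem (unif_mem c) (mul_mem hs hs')), by rw [_root_.map_mul]; ring⟩ }
  -- The elements with a residue form a subring `S`. It contains the required inverses because `(u +
  -- w π)⁻¹ = u⁻¹ - (w / u) (u + w π)⁻¹ π`.
  refine ring_place_le c S (fun u => ⟨u, 0, zero_mem _, by simp⟩)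
    ⟨0, 1, one_mem _, by simp⟩ (fun u w hu => ?_) hr
  obtain ⟨hne, hv⟩ := place_C_add (C_mem c w) hu
  have hCu := C_ne_zero hu
  refine ⟨u⁻¹, - RatFunc.C (w / u) * (RatFunc.C u + RatFunc.C w * unif c)⁻¹,
    mul_mem (neg_mem (C_mem c _)) (.inr ?_), ?_⟩
  · rw [DiscPlace.map_inv _ hne, hv, neg_zero]
  · rw [map_inv₀, map_div₀]
    field_simp
    ring

end
end RatFunc

/-! ### Points of the glued scheme in terms of its charts -/

namespace DivisorTheory
open AlgebraicGeometry CategoryTheory Limits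

section
variable {X : Scheme.{0}} [AlgebraicGeometry.IsIntegral X]
  {F : Type} [Field F] {φ : F ≃+* X.functionField}

theorem stkEquiv_germ {p : X} {U : X.Opens} [Nonempty U] (hp : p ∈ U) (c : Γ(X, U)) :
    φ (stkEquiv φ p (X.presheaf.germ U p hp c)) = X.germToFunctionField U c := by
  rw [apply_stkEquiv, Scheme.algebraMap_germ_eq_germToFunctionField]

theorem exists_germ_div_of_mem {U : X.Opens} [Nonempty U] (hU : IsAffineOpen U) {p : X}
    (hp : p ∈ U) {f : F} (hf : f ∈ stk φ p) : ∃ a b : Γ(X, U),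
      IsUnit (X.presheaf.germ U p hp b) ∧
      φ f = X.germToFunctionField U a / X.germToFunctionField U b := by
  have hloc := hU.isLocalization_stalk ⟨p, hp⟩
  let := TopCat.Presheaf.algebra_section_stalk X.presheaf (⟨p, hp⟩ : U)
  let s := (stkEquiv φ p).symm ⟨f, hf⟩
  obtain ⟨⟨a, b⟩, hab⟩ := IsLocalization.surj (M := (hU.primeIdealOf ⟨p, hp⟩).asIdeal.primeCompl) s
  have hb := IsLocalization.map_units (M := (hU.primeIdealOf ⟨p, hp⟩).asIdeal.primeCompl)
    (X.presheaf.stalk p) b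
  have hb : IsUnit (X.presheaf.germ U p hp b) := hb
  refine ⟨a, b, hb, ?_⟩
  have h1 := congrArg (fun t => (stkEquiv φ p t : F)) hab
  simp only [map_mul, Subring.coe_mul] at h1
  rw [show stkEquiv φ p s = ⟨f, hf⟩ from (stkEquiv φ p).apply_symm_apply _] at h1
  have h2 : f * (stkEquiv φ p (X.presheaf.germ U p hp b) : F) =
    stkEquiv φ p (X.presheaf.germ U p hp a) := h1
  have h3 := congrArg φ h2
  rw [map_mul, stkEquiv_germ, stkEquiv_germ] at h3
  rw [eq_div_iff ?_, h3]
  rw [ne_eq, map_eq_zero_iff _ (X.germToFunctionField_injective U)]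
  intro h0
  rw [h0, map_zero] at hb
  exact not_isUnit_zero hb

end
end DivisorTheory

namespace Glue
open AlgebraicGeometry CategoryTheory Limits DivisorTheory
section
variable {k F : Type} [Field k] [Field F] [Algebra k F] {ι : Type} (R : ι → Subalgebra k F)
  [IsGluable R] [Nonempty ι] (i₀ : ι) [IsFractionRing (R i₀) F]

theorem stkEquiv_chartMap (i : ι) (q : Spec (.of (R i))) (c : R i) :
    (stkEquiv (fieldEquiv R i₀) (chartMap R i q)
      ((glued R).presheaf.germ (chartMap R i).opensRange (chartMap R i q)
        (Scheme.Hom.mem_opensRange.mpr ⟨q, rfl⟩) ((chartIso R i).inv c)) : F) = c := by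
  apply (fieldEquiv R i₀).injective
  rw [stkEquiv_germ]
  exact (fieldToFunctionField_coe R i₀ i c).symm

theorem coe_mem_stk_chartMap (i : ι) (q : Spec (.of (R i))) (c : R i) :
    (c : F) ∈ stk (fieldEquiv R i₀) (chartMap R i q) := by
  rw [← stkEquiv_chartMap R i₀ i q c]
  exact Subtype.property _

theorem van_chartMap_iff (i : ι) (q : Spec (.of (R i))) (c : R i) :
    Van (fieldEquiv R i₀) (chartMap R i q) (c : F) ↔ c ∈ q.asIdeal := by
  rw [← stkEquiv_chartMap R i₀ i q c, van_stkEquiv, IsLocalRing.mem_maximalIdeal, mem_nonunits_iff,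
    isUnit_germ_chartIso_inv, not_not]

/-- The point `p` lies in the chart with index `i`. -/
def InChart (p : glued R) (i : ι) : Prop := ∀ f ∈ R i, f ∈ stk (fieldEquiv R i₀) p

theorem exists_inChart (p : glued R) : ∃ i, InChart R i₀ p i := by
  obtain ⟨i, q, rfl⟩ := chartMap_covers R p
  exact ⟨i, fun f hf => coe_mem_stk_chartMap R i₀ i q ⟨f, hf⟩⟩

variable {R i₀}

/-- Let `p` come from the chart `j`. The intersection of the charts is the locus `g ≠ 0` in the
chart `j`, and `g⁻¹` is regular on the chart `i`. As the functions of the chart `i` are regular at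
`p`, the function `g` does not vanish there and `p` lies in the intersection. -/
theorem InChart.exists_eq {p : glued R} {i : ι} (h : InChart R i₀ p i) :
    ∃ q : Spec (.of (R i)), chartMap R i q = p := by
  classical
  obtain ⟨j, q', rfl⟩ := chartMap_covers R p
  obtain ⟨g, hg, hg0, hgi, hi⟩ := IsGluable.isAway (R := R) j i
  have hgq : (⟨g, hg⟩ : R j) ∉ q'.asIdeal := by
    rw [← van_chartMap_iff R i₀]
    exact not_van_of_inv_mem hg0 (h _ hgi)
  have hiI : R i ≤ interRing R {i, j} := le_biSup R (by simp)
  have hjI : R j ≤ interRing R {i, j} := le_biSup R (by simp)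
  have haway : interRing R {i, j} ≤ away (R j) g hg := by
    rw [interRing]
    refine iSup₂_le fun l hl => ?_
    rcases Finset.mem_insert.mp hl with rfl | hl
    · exact hi
    · rw [Finset.mem_singleton.mp hl]
      exact fun b hb => ⟨0, by simpa⟩
  have hloc := IsAway.isLocalization hjI hg hg0 (hiI hgi) haway
  let := (Subalgebra.inclusion hjI).toRingHom.toAlgebra
  have hr := PrimeSpectrum.localization_away_comap_range (interRing R {i, j}) (⟨g, hg⟩ : R j)
  have hx : q' ∈ Set.range (PrimeSpectrum.comap (algebraMap (R j) (interRing R {i, j}))) := by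
    rw [hr]
    exact hgq
  obtain ⟨z', hz⟩ := hx
  let z : Spec (.of (interRing R {i, j})) := z'
  have hz : specIncl hjI z = q' := hz
  refine ⟨specIncl hiI z, ?_⟩
  rw [← hz, ← Scheme.Hom.comp_apply, ← Scheme.Hom.comp_apply,
    specIncl_chartMap R (show i ∈ {i, j} by simp), specIncl_chartMap R (show j ∈ {i, j} by simp)]

theorem InChart.exists_div {p : glued R} {i : ι} (h : InChart R i₀ p i) {f : F}
    (hf : f ∈ stk (fieldEquiv R i₀) p) :
    ∃ a ∈ R i, ∃ b ∈ R i, ¬ Van (fieldEquiv R i₀) p b ∧ f = a / b := by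
  obtain ⟨q, rfl⟩ := h.exists_eq
  have hq : chartMap R i q ∈ (chartMap R i).opensRange := Scheme.Hom.mem_opensRange.mpr ⟨q, rfl⟩
  obtain ⟨a, b, hb, hab⟩ := exists_germ_div_of_mem (isAffineOpen_opensRange (chartMap R i)) hq hf
  have key : ∀ c : Γ(glued R, (chartMap R i).opensRange),
      fieldEquiv R i₀ (((chartIso R i).hom c : R i) : F) =
        (glued R).germToFunctionField _ c := by
    intro c
    change fieldToFunctionField R i₀ _ = _
    rw [fieldToFunctionField_coe]
    change (glued R).germToFunctionField _ ((chartIso R i).inv ((chartIso R i).hom c)) = _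
    rw [Iso.hom_inv_id_apply]
  refine ⟨_, ((chartIso R i).hom a : R i).2, _, ((chartIso R i).hom b : R i).2, ?_, ?_⟩
  · rw [van_chartMap_iff, ← isUnit_germ_chartIso_inv R i q hq, Iso.hom_inv_id_apply]
    exact hb
  · apply (fieldEquiv R i₀).injective
    rw [map_div₀, key, key, hab]

theorem InChart.specializes {p x : glued R} {i : ι} (hp : InChart R i₀ p i)
    (hx : InChart R i₀ x i)
    (h : ∀ f ∈ R i, Van (fieldEquiv R i₀) x f → Van (fieldEquiv R i₀) p f) : x ⤳ p := by
  obtain ⟨q, rfl⟩ := hp.exists_eq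
  obtain ⟨q', rfl⟩ := hx.exists_eq
  refine Specializes.map ?_ (chartMap R i).continuous
  refine (PrimeSpectrum.le_iff_specializes (R := R i) q' q).mp fun c hc => ?_
  exact (van_chartMap_iff R i₀ i q c).mp (h c c.2 ((van_chartMap_iff R i₀ i q' c).mpr hc))

theorem InChart.ext {p x : glued R} {i : ι} (hp : InChart R i₀ p i) (hx : InChart R i₀ x i)
    (h : ∀ f ∈ R i, Van (fieldEquiv R i₀) x f ↔ Van (fieldEquiv R i₀) p f) : x = p :=
  ((hp.specializes hx fun f hf => (h f hf).mp).antisymm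
    (hx.specializes hp fun f hf => (h f hf).mpr)).eq

variable (R i₀) in
theorem exists_point (i : ι) (q : Ideal (R i)) [hq : q.IsPrime] :
    ∃ p : glued R, InChart R i₀ p i ∧ ∀ c : R i, Van (fieldEquiv R i₀) p (c : F) ↔ c ∈ q :=
  let q' : Spec (.of (R i)) := (⟨q, hq⟩ : PrimeSpectrum (R i))
  ⟨chartMap R i q', fun f hf => coe_mem_stk_chartMap R i₀ i q' ⟨f, hf⟩,
    fun c => van_chartMap_iff R i₀ i q' c⟩

end
end Glue

/-! ### Weierstrass equations over the charts of the projective line -/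

namespace EllipticSurface
open AlgebraicGeometry CategoryTheory Polynomial Glue DivisorTheory RatFunc

section
variable {k : Type} [Field k]

/-- The coordinate of the base on an affine chart of the projective line. -/
noncomputable def baseCoord : Bool → RatFunc k
  | false => RatFunc.X
  | true => RatFunc.X⁻¹

/-- The transition function of the line bundle `𝒪(3)`. -/
noncomputable def scale : Bool → RatFunc k
  | false => 1
  | true => RatFunc.X⁻¹ ^ 3

/-- A polynomial of degree at most `n` as a polynomial in the coordinate of a chart of the
projective line. -/
noncomputable def chartPoly (n : ℕ) (p : k[X]) : Bool → k[X]
  | false => p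
  | true => p.reflect n

theorem scale_ne_zero (ε : Bool) : (scale ε : RatFunc k) ≠ 0 := by
  cases ε
  · exact one_ne_zero
  · exact pow_ne_zero _ (inv_ne_zero RatFunc.X_ne_zero)

/-- Reversing the coefficients of `p` with respect to the degree `3 n` and substituting `1 / t`
gives `t ^ (-3 n) p(t)`. The cases `n = 4` and `n = 6` are the coefficients of the Weierstrass
equation. -/
theorem aeval_baseCoord_chartPoly {n : ℕ} {p : k[X]} (hp : p.natDegree ≤ 3 * n) (ε : Bool) :
    aeval (baseCoord ε) (chartPoly (3 * n) p ε) =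
      scale ε ^ n * algebraMap k[X] (RatFunc k) p := by
  have h0 := RatFunc.X_ne_zero (K := k)
  have h1 : ∀ q : k[X], aeval (RatFunc.X : RatFunc k) q = algebraMap k[X] (RatFunc k) q := by
    intro q
    rw [← RatFunc.algebraMap_X, aeval_algebraMap_apply, aeval_X_left_apply]
  cases ε
  · simp [baseCoord, chartPoly, scale, h1]
  · have := invertibleOfNonzero h0
    have h2 := eval₂_reflect_mul_pow (algebraMap k (RatFunc k)) RatFunc.X (3 * n) p hp
    rw [invOf_eq_inv] at h2
    change eval₂ (algebraMap k (RatFunc k)) RatFunc.X⁻¹ (reflect (3 * n) p) =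
      (RatFunc.X⁻¹ ^ 3) ^ n * _
    rw [← h1 p]
    change _ = _ * eval₂ (algebraMap k (RatFunc k)) RatFunc.X p
    rw [← h2, ← pow_mul, inv_pow]
    field_simp

/-- The chart of the projective line that is used near a point. -/
def chartAt : Option k → Bool
  | some _ => false
  | none => true

/-- The coordinate of a point of the projective line in its chart. -/
def coordAt : Option k → k
  | some c => c
  | none => 0

theorem baseCoord_chartAt (c : Option k) :
    baseCoord (chartAt c) = RatFunc.C (coordAt c) + unif c := by
  cases c <;> simp [baseCoord, chartAt, coordAt, unif]

theorem baseCoord_mem (c : Option k) : baseCoord (chartAt c) ∈ (place c).ring := by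
  rw [baseCoord_chartAt]
  exact add_mem (C_mem c _) (unif_mem c)

theorem place_scale (c : Option k) :
    (place c).v (scale (chartAt c)) = match c with
      | some _ => 0
      | none => 3 := by
  cases c with
  | some c => exact DiscPlace.map_one _
  | none =>
    have h := (place (none : Option k)).map_pow (inv_ne_zero RatFunc.X_ne_zero) 3
    rw [show (place none).v (RatFunc.X⁻¹ : RatFunc k) = 1 from place_unif none] at h
    exact h

theorem aeval_mem {R : Type*} [CommRing R] [Algebra k R] (S : Subring R)
    (hC : ∀ u : k, algebraMap k R u ∈ S) {t : R} (ht : t ∈ S) (p : k[X]) : aeval t p ∈ S := by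
  induction p using Polynomial.induction_on' with
  | add p q hp hq => rw [map_add]; exact add_mem hp hq
  | monomial n u => rw [aeval_monomial]; exact mul_mem (hC u) (pow_mem ht n)

/-- The first order expansion of a polynomial in the coordinate of the base. -/
theorem exists_taylor (c : Option k) (p : k[X]) : ∃ s ∈ (place c).ring,
    aeval (baseCoord (chartAt c)) p = RatFunc.C (p.eval (coordAt c)) +
      RatFunc.C (p.derivative.eval (coordAt c)) * unif c + s * unif c ^ 2 := by
  induction p using Polynomial.induction_on' with
  | add p q hp hq =>
    obtain ⟨s, hs, h⟩ := hp
    obtain ⟨s', hs', h'⟩ := hq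
    refine ⟨s + s', add_mem hs hs', ?_⟩
    rw [map_add, h, h', Polynomial.eval_add, derivative_add, Polynomial.eval_add, map_add, map_add]
    ring
  | monomial n u =>
    rw [baseCoord_chartAt]
    set x := coordAt c
    have key : ∃ s ∈ (place c).ring, (RatFunc.C x + unif c) ^ n =
        RatFunc.C (x ^ n) + RatFunc.C (n * x ^ (n - 1)) * unif c + s * unif c ^ 2 := by
      induction n with
      | zero => exact ⟨0, zero_mem _, by simp⟩
      | succ n ih =>
        obtain ⟨s, hs, h⟩ := ih
        refine ⟨RatFunc.C (n * x ^ (n - 1)) + s * (RatFunc.C x + unif c),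
          add_mem (C_mem c _) (mul_mem hs (add_mem (C_mem c _) (unif_mem c))), ?_⟩
        rw [pow_succ, h]
        have h1 : (n : k) * x ^ (n - 1) * x = n * x ^ n := by
          cases n with
          | zero => simp
          | succ n => simp [pow_succ, mul_assoc]
        have h2 := congrArg (RatFunc.C (K := k)) h1
        rw [Nat.add_sub_cancel]
        push_cast
        simp only [_root_.map_mul, map_add, map_pow, _root_.map_one] at h2 ⊢
        linear_combination unif c * h2
    obtain ⟨s, hs, h⟩ := key
    refine ⟨RatFunc.C u * s, mul_mem (C_mem c u) hs, ?_⟩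
    rw [aeval_monomial, h, derivative_monomial, eval_monomial, eval_monomial]
    change RatFunc.C u * _ = _
    simp only [_root_.map_mul]
    ring

variable (a b : k[X])

/-- The jacobian criterion for the affine charts `Y² = X³ + α(T) X + β(T)`. -/
def JacobianCriterion : Prop := ∀ (ε : Bool) (c ξ η : k),
  η ^ 2 = ξ ^ 3 + (chartPoly 12 a ε).eval c * ξ + (chartPoly 18 b ε).eval c →
  (chartPoly 12 a ε).derivative.eval c * ξ + (chartPoly 18 b ε).derivative.eval c = 0 →
  3 * ξ ^ 2 + (chartPoly 12 a ε).eval c = 0 → 2 * η ≠ 0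

/-- The coefficient of `X` in the Weierstrass equation over a chart of the base. -/
noncomputable def alpha (ε : Bool) : RatFunc k := scale ε ^ 4 * algebraMap k[X] (RatFunc k) a

/-- The constant coefficient in the Weierstrass equation over a chart of the base. -/
noncomputable def beta (ε : Bool) : RatFunc k := scale ε ^ 6 * algebraMap k[X] (RatFunc k) b

variable {a b}

theorem aeval_alpha (ha : a.natDegree ≤ 12) (ε : Bool) :
    aeval (baseCoord ε) (chartPoly 12 a ε) = alpha a ε :=
  aeval_baseCoord_chartPoly (n := 4) ha ε

theorem aeval_beta (hb : b.natDegree ≤ 18) (ε : Bool) :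
    aeval (baseCoord ε) (chartPoly 18 b ε) = beta b ε :=
  aeval_baseCoord_chartPoly (n := 6) hb ε

theorem alpha_mem (ha : a.natDegree ≤ 12) (c : Option k) : alpha a (chartAt c) ∈ (place c).ring := by
  rw [← aeval_alpha ha]
  exact aeval_mem _ (C_mem c) (baseCoord_mem c) _

theorem beta_mem (hb : b.natDegree ≤ 18) (c : Option k) : beta b (chartAt c) ∈ (place c).ring := by
  rw [← aeval_beta hb]
  exact aeval_mem _ (C_mem c) (baseCoord_mem c) _

/-- At a point of a section, the derivative of the equation in the direction of `y` or of `x` does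
not vanish. -/
theorem not_inMax_or [IsAlgClosed k] (hJ : JacobianCriterion a b) (ha : a.natDegree ≤ 12)
    (hb : b.natDegree ≤ 18) (c : Option k) {x y : RatFunc k} (hx : x ∈ (place c).ring)
    (hy : y ∈ (place c).ring) (h : y ^ 2 = x ^ 3 + alpha a (chartAt c) * x + beta b (chartAt c)) :
    ¬ InMax c (2 * y) ∨ ¬ InMax c (3 * x ^ 2 + alpha a (chartAt c)) := by
  by_contra! hcon
  obtain ⟨hcy, hcx⟩ := hcon
  obtain ⟨ξ, x₁, hx₁, rfl⟩ := exists_residue c hx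
  obtain ⟨η, y₁, hy₁, rfl⟩ := exists_residue c hy
  obtain ⟨α₂, hα₂, hα⟩ := exists_taylor c (chartPoly 12 a (chartAt c))
  obtain ⟨β₂, hβ₂, hβ⟩ := exists_taylor c (chartPoly 18 b (chartAt c))
  rw [aeval_alpha ha] at hα
  rw [aeval_beta hb] at hβ
  have hα1 := alpha_mem ha c
  rw [hα] at h hcx hα1
  rw [hβ] at h
  have hJ := hJ (chartAt c) (coordAt c) ξ η
  set α₀ := (chartPoly 12 a (chartAt c)).eval (coordAt c)
  set β₀ := (chartPoly 18 b (chartAt c)).eval (coordAt c)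
  set α₁ := (chartPoly 12 a (chartAt c)).derivative.eval (coordAt c)
  set β₁ := (chartPoly 18 b (chartAt c)).derivative.eval (coordAt c)
  set π := unif c
  have hπ : π ∈ (place c).ring := unif_mem c
  have hC := C_mem c
  have h0 := unif_ne_zero c
  have h2 : ∀ n : ℕ, (n : RatFunc k) ∈ (place c).ring := fun n => natCast_mem _ n
  have e2 : (2 : RatFunc k) ∈ (place c).ring := h2 2
  have e3 : (3 : RatFunc k) ∈ (place c).ring := h2 3
  -- the constant terms
  have c1 : 2 * η = 0 := by
    rw [← inMax_C_iff (c := c)]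
    refine (inMax_sub_congr (s := 2 * (RatFunc.C η + π * y₁)) ?_).mpr hcy
    exact ⟨-(2 * y₁), neg_mem (mul_mem e2 hy₁), by simp only [_root_.map_mul, map_ofNat]; ring⟩
  have c2 : 3 * ξ ^ 2 + α₀ = 0 := by
    rw [← inMax_C_iff (c := c)]
    refine (inMax_sub_congr ?_).mpr hcx
    refine ⟨-(3 * (2 * RatFunc.C ξ * x₁ + π * x₁ ^ 2) + RatFunc.C α₁ + α₂ * π), neg_mem
      (add_mem (add_mem (mul_mem e3 (add_mem (mul_mem (mul_mem e2 (hC _)) hx₁)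
        (mul_mem hπ (pow_mem hx₁ 2)))) (hC _)) (mul_mem hα₂ hπ)), ?_⟩
    simp only [_root_.map_mul, map_add, map_pow, map_ofNat]
    ring
  -- This is the expansion of the Weierstrass equation along the section in powers of the
  -- uniformizer, with everything from the second order on collected in `m`. As the derivatives in
  -- `x` and `y` vanish at the point, the first order term is the derivative in the direction of the
  -- base; it vanishes too, so the point would be singular on the surface.
  obtain ⟨m, hm, hm'⟩ : ∃ m ∈ (place c).ring, RatFunc.C (η ^ 2 - (ξ ^ 3 + α₀ * ξ + β₀)) +
      RatFunc.C (2 * η) * π * y₁ - RatFunc.C (3 * ξ ^ 2 + α₀) * π * x₁ -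
      RatFunc.C (α₁ * ξ + β₁) * π + m * π ^ 2 = 0 := by
    refine ⟨y₁ ^ 2 - (3 * RatFunc.C ξ * x₁ ^ 2 + π * x₁ ^ 3) - RatFunc.C α₁ * x₁ -
      α₂ * (RatFunc.C ξ + π * x₁) - β₂, ?_, ?_⟩
    · refine sub_mem (sub_mem (sub_mem (sub_mem (pow_mem hy₁ 2) (add_mem (mul_mem
        (mul_mem e3 (hC _)) (pow_mem hx₁ 2)) (mul_mem hπ (pow_mem hx₁ 3)))) (mul_mem (hC _) hx₁))
        (mul_mem hα₂ (add_mem (hC _) (mul_mem hπ hx₁)))) hβ₂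
    · simp only [_root_.map_mul, map_add, map_sub, map_pow, map_ofNat]
      linear_combination h
  rw [c1, c2, _root_.map_zero] at hm'
  have c3 : η ^ 2 - (ξ ^ 3 + α₀ * ξ + β₀) = 0 := by
    rw [← inMax_C_iff (c := c)]
    refine ⟨RatFunc.C (α₁ * ξ + β₁) - m * π, sub_mem (hC _) (mul_mem hm hπ), ?_⟩
    linear_combination hm'
  rw [c3, _root_.map_zero] at hm'
  have c4 : α₁ * ξ + β₁ = 0 := by
    rw [← inMax_C_iff (c := c)]
    refine ⟨m, hm, mul_right_cancel₀ h0 ?_⟩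
    linear_combination - hm'
  exact hJ (sub_eq_zero.mp c3) c4 c2 c1

/-- The equation is integral in `x`: if `x` had a pole, division by `x ^ 3` would express `1` by
elements of the maximal ideal. -/
theorem mem_of_sq_mem {c : Option k} {x y : RatFunc k} {α β : RatFunc k}
    (hα : α ∈ (place c).ring) (hβ : β ∈ (place c).ring)
    (hy : y ∈ (place c).ring) (h : y ^ 2 = x ^ 3 + α * x + β) : x ∈ (place c).ring := by
  by_contra hx
  have hx0 : x ≠ 0 := by
    rintro rfl
    exact hx (zero_mem _)
  have h1 := inMax_inv hx
  have e : y ^ 2 * x⁻¹ ^ 2 * x⁻¹ - α * x⁻¹ * x⁻¹ - β * x⁻¹ ^ 2 * x⁻¹ = 1 := by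
    field_simp
    linear_combination h
  have h2 := ((h1.mul_left (mul_mem (pow_mem hy 2) (pow_mem h1.mem 2))).sub
    (h1.mul_left (mul_mem hα h1.mem))).sub (h1.mul_left (mul_mem hβ (pow_mem h1.mem 2)))
  rw [e] at h2
  exact not_inMax_one h2

/-- If `u` had a pole, division of the equation by `u ^ 3` would put `1` in the maximal ideal. So
`u` is regular, and then `u ^ 3` is a multiple of `w`. Geometrically, the origin is the only point
of a fibre with `Z = 0`. -/
theorem inMax_of_eq {c : Option k} {u w : RatFunc k} {α β : RatFunc k}
    (hα : α ∈ (place c).ring) (hβ : β ∈ (place c).ring)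
    (hw : InMax c w) (h : w = u ^ 3 + α * u * w ^ 2 + β * w ^ 3) : InMax c u := by
  have hw' := hw.mem
  have hu : u ∈ (place c).ring := by
    by_contra hu
    have hu0 : u ≠ 0 := by
      rintro rfl
      exact hu (zero_mem _)
    have h1 := (inMax_inv hu).mem
    have e : w * (u⁻¹ ^ 3 * (1 - α * u * w - β * w ^ 2)) = 1 := by
      field_simp
      linear_combination h
    have e' : u⁻¹ ^ 3 * (1 - α * u * w - β * w ^ 2) =
        u⁻¹ ^ 3 - α * u⁻¹ ^ 2 * w - β * u⁻¹ ^ 3 * w ^ 2 := by field_simp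
    have h2 := hw.mul_right (s := u⁻¹ ^ 3 - α * u⁻¹ ^ 2 * w - β * u⁻¹ ^ 3 * w ^ 2)
      (sub_mem (sub_mem (pow_mem h1 3) (mul_mem (mul_mem hα (pow_mem h1 2)) hw'))
        (mul_mem (mul_mem hβ (pow_mem h1 3)) (pow_mem hw' 2)))
    rw [← e', e] at h2
    exact not_inMax_one h2
  have h3 : InMax c (u * (u * u)) := by
    have e : u * (u * u) = w * (1 - α * u * w - β * w ^ 2) := by linear_combination -h
    rw [e]
    exact hw.mul_right (sub_mem (sub_mem (one_mem _) (mul_mem (mul_mem hα hu) hw'))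
      (mul_mem hβ (pow_mem hw' 2)))
  rcases h3.of_mul hu (mul_mem hu hu) with h | h
  · exact h
  · exact (h.of_mul hu hu).elim id id

/-- There are no sections of order two. -/
theorem ne_zero_of_equation [IsAlgClosed k] (hJ : JacobianCriterion a b)
    (ha : a.natDegree ≤ 12) (hb : b.natDegree ≤ 18) {x y : RatFunc k}
    (h : y ^ 2 = x ^ 3 + algebraMap k[X] (RatFunc k) a * x + algebraMap k[X] (RatFunc k) b) :
    y ≠ 0 := by
  rintro rfl
  set r := 3 * x ^ 2 + algebraMap k[X] (RatFunc k) a with hr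
  -- If `y = 0`, then `not_inMax_or` makes `3 x ^ 2 + α` invertible at every place. For `r` this
  -- means valuation `0` at the finite places and `-12` at infinity, against the sum formula.
  have key : ∀ c : Option k, r ≠ 0 ∧ (place c).v r = -4 * (place c).v (scale (chartAt c)) := by
    intro c
    set s : RatFunc k := scale (chartAt c) with hs
    have hs0 : s ≠ 0 := scale_ne_zero _
    have e : (0 : RatFunc k) ^ 2 = (s ^ 2 * x) ^ 3 + alpha a (chartAt c) * (s ^ 2 * x) +
        beta b (chartAt c) := by
      rw [alpha, beta, ← hs]
      linear_combination s ^ 6 * h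
    have hx := mem_of_sq_mem (alpha_mem ha c) (beta_mem hb c) (zero_mem _) e
    have h1 := (not_inMax_or hJ ha hb c hx (zero_mem _) e).resolve_left
      (by rw [mul_zero, not_not]; exact inMax_zero)
    have h2 := place_eq_zero (add_mem (mul_mem (natCast_mem _ 3) (pow_mem hx 2))
      (alpha_mem ha c)) h1
    have e2 : 3 * (s ^ 2 * x) ^ 2 + alpha a (chartAt c) = s ^ 4 * r := by
      rw [alpha, ← hs, hr]; ring
    have h3 : s ^ 4 * r ≠ 0 ∧ (place c).v (s ^ 4 * r) = 0 := e2 ▸ h2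
    have hr0 := right_ne_zero_of_mul h3.1
    refine ⟨hr0, ?_⟩
    have h4 := h3.2
    rw [DiscPlace.map_mul _ (pow_ne_zero 4 hs0) hr0, DiscPlace.map_pow _ hs0] at h4
    push_cast at h4
    lia
  have h1 := placeSystem.sum_eq_zero r (key none).1
  have h2 : ∀ c, (placeSystem.place c).v r = -4 * (place c).v (scale (chartAt c)) :=
    fun c => (key c).2
  simp only [h2] at h1
  rw [finsum_eq_single _ (none : Option k), place_scale] at h1
  · simp at h1
  · rintro (_ | c) hc
    · exact absurd rfl hc
    · rw [place_scale]; simp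

end
end EllipticSurface

/-! ### Weierstrass models and their projection to the base -/

namespace EllipticSurface
open AlgebraicGeometry CategoryTheory Polynomial Glue DivisorTheory RatFunc

section
variable {k K : Type} [Field k] [Field K] [Algebra k K]

/-- Elements `t`, `x`, `y` of the field `K` that satisfy the equation `y² = x³ + a x + b`, and the
affine charts of the corresponding Weierstrass fibration. -/
structure WeierstrassModel (R : Bool × Bool → Subalgebra k K) (a b : k[X]) where
  /-- the inclusion of the function field of the base -/
  base : RatFunc k →+* K
  /-- the coordinate `x` -/
  x : K
  /-- the coordinate `y` -/
  y : K
  base_C : ∀ u, base (RatFunc.C u) = algebraMap k K u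
  y_sq : y ^ 2 = x ^ 3 + base (algebraMap k[X] (RatFunc k) a) * x +
    base (algebraMap k[X] (RatFunc k) b)
  indep : ∀ p q : (RatFunc k)[X], p.eval₂ base x + q.eval₂ base x * y = 0 → p = 0 ∧ q = 0
  chart_false : ∀ ε, R (ε, false) = Algebra.adjoin k (Set.range
    ![base (baseCoord ε), base (scale ε) ^ 2 * x, base (scale ε) ^ 3 * y])
  chart_true : ∀ ε, R (ε, true) = Algebra.adjoin k (Set.range
    ![base (baseCoord ε), base (scale ε) ^ 2 * x / (base (scale ε) ^ 3 * y),
      (base (scale ε) ^ 3 * y)⁻¹])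

variable {R : Bool × Bool → Subalgebra k K} {a b : k[X]} (W : WeierstrassModel R a b)

namespace WeierstrassModel

/-- The coordinate `X / Z` over a chart of the base. -/
noncomputable def xc (ε : Bool) : K := W.base (scale ε) ^ 2 * W.x

/-- The coordinate `Y / Z` over a chart of the base. -/
noncomputable def yc (ε : Bool) : K := W.base (scale ε) ^ 3 * W.y

/-- The coordinate `X / Y` over a chart of the base. -/
noncomputable def uc (ε : Bool) : K := W.xc ε / W.yc ε

/-- The coordinate `Z / Y` over a chart of the base. -/
noncomputable def wc (ε : Bool) : K := (W.yc ε)⁻¹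

/-- The coordinates on the affine charts. -/
noncomputable def coord (ε : Bool) : Bool → Fin 3 → K
  | false => ![W.base (baseCoord ε), W.xc ε, W.yc ε]
  | true => ![W.base (baseCoord ε), W.uc ε, W.wc ε]

theorem chart_eq (ε δ : Bool) : R (ε, δ) = Algebra.adjoin k (Set.range (W.coord ε δ)) := by
  cases δ
  · exact W.chart_false ε
  · exact W.chart_true ε

theorem coord_mem (ε δ : Bool) (j : Fin 3) : W.coord ε δ j ∈ R (ε, δ) := by
  rw [W.chart_eq]
  exact Algebra.subset_adjoin ⟨j, rfl⟩

theorem y_ne_zero : W.y ≠ 0 := by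
  intro h
  have h1 := (W.indep 0 1 (by simp [h])).2
  exact one_ne_zero h1

theorem base_scale_ne_zero (ε : Bool) : W.base (scale ε) ≠ 0 :=
  (_root_.map_ne_zero _).mpr (scale_ne_zero ε)

theorem yc_ne_zero (ε : Bool) : W.yc ε ≠ 0 :=
  mul_ne_zero (pow_ne_zero 3 (W.base_scale_ne_zero ε)) (W.y_ne_zero)

theorem wc_ne_zero (ε : Bool) : W.wc ε ≠ 0 := inv_ne_zero (W.yc_ne_zero ε)

theorem yc_sq (ε : Bool) : W.yc ε ^ 2 = W.xc ε ^ 3 + W.base (alpha a ε) * W.xc ε +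
    W.base (beta b ε) := by
  simp only [yc, xc, alpha, beta, map_mul, map_pow]
  linear_combination W.base (scale ε) ^ 6 * W.y_sq

theorem xc_eq (ε : Bool) : W.xc ε = W.uc ε / W.wc ε := by
  rw [uc, wc, div_inv_eq_mul, div_mul_cancel₀ _ (W.yc_ne_zero ε)]

theorem yc_eq (ε : Bool) : W.yc ε = (W.wc ε)⁻¹ := by rw [wc, inv_inv]

theorem wc_eq (ε : Bool) : W.wc ε = W.uc ε ^ 3 +
    W.base (alpha a ε) * W.uc ε * W.wc ε ^ 2 + W.base (beta b ε) * W.wc ε ^ 3 := by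
  have h := W.yc_sq ε
  have h0 := W.yc_ne_zero ε
  rw [uc, wc]
  field_simp
  linear_combination h

theorem uc_false (ε : Bool) : W.uc false = W.base (scale ε) * W.uc ε := by
  have h0 := W.y_ne_zero
  have h1 := W.base_scale_ne_zero ε
  have h2 : (scale false : RatFunc k) = 1 := rfl
  simp only [uc, xc, yc, h2, map_one]
  field_simp

theorem wc_false (ε : Bool) : W.wc false = W.base (scale ε) ^ 3 * W.wc ε := by
  have h0 := W.y_ne_zero
  have h1 := W.base_scale_ne_zero ε
  have h2 : (scale false : RatFunc k) = 1 := rfl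
  simp only [wc, yc, h2, map_one]
  field_simp

variable [IsGluable R] [IsFractionRing (R (false, false)) K]

/-- The local ring of the surface at a point. -/
noncomputable abbrev stalkAt (_ : WeierstrassModel R a b) (p : glued R) : Subring K :=
  stk (fieldEquiv R (false, false)) p

/-- The function `f` vanishes at the point `p`. -/
abbrev VanAt (_ : WeierstrassModel R a b) (p : glued R) (f : K) : Prop :=
  Van (fieldEquiv R (false, false)) p f

/-- The point `p` lies in the chart with index `i`. -/
abbrev InChartAt (_ : WeierstrassModel R a b) (p : glued R) (i : Bool × Bool) : Prop :=
  InChart R (false, false) p i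

theorem base_C_mem (p : glued R) (u : k) : W.base (RatFunc.C u) ∈ W.stalkAt p := by
  obtain ⟨i, hi⟩ := exists_inChart (R) (false, false) p
  rw [W.base_C]
  exact hi _ ((R i).algebraMap_mem u)

theorem not_van_base_C (p : glued R) {u : k} (hu : u ≠ 0) :
    ¬ W.VanAt p (W.base (RatFunc.C u)) := by
  refine not_van_of_inv_mem ((_root_.map_ne_zero _).mpr (C_ne_zero hu)) ?_
  rw [← map_inv₀, ← map_inv₀]
  exact W.base_C_mem p _

theorem inChartAt_iff {p : glued R} {ε δ : Bool} :
    W.InChartAt p (ε, δ) ↔ ∀ j, W.coord ε δ j ∈ W.stalkAt p := by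
  constructor
  · exact fun h j => h _ (W.coord_mem ε δ j)
  · intro h
    let S : Subalgebra k K :=
      { (W.stalkAt p) with
        algebraMap_mem' := fun u => (W.base_C u) ▸ W.base_C_mem p u }
    have h1 : R (ε, δ) ≤ S := by
      rw [W.chart_eq]
      refine Algebra.adjoin_le ?_
      rintro _ ⟨j, rfl⟩
      exact h j
    exact fun f hf => h1 hf

theorem inChartAt_false_iff {p : glued R} {ε : Bool} : W.InChartAt p (ε, false) ↔
    W.base (baseCoord ε) ∈ W.stalkAt p ∧ W.xc ε ∈ W.stalkAt p ∧ W.yc ε ∈ W.stalkAt p := by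
  rw [W.inChartAt_iff, Fin.forall_fin_succ, Fin.forall_fin_two]
  rfl

theorem inChartAt_true_iff {p : glued R} {ε : Bool} : W.InChartAt p (ε, true) ↔
    W.base (baseCoord ε) ∈ W.stalkAt p ∧ W.uc ε ∈ W.stalkAt p ∧ W.wc ε ∈ W.stalkAt p := by
  rw [W.inChartAt_iff, Fin.forall_fin_succ, Fin.forall_fin_two]
  rfl

variable {W} in
theorem InChartAt.baseCoord_mem {p : glued R} {ε δ : Bool} (h : W.InChartAt p (ε, δ)) :
    W.base (baseCoord ε) ∈ W.stalkAt p := by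
  cases δ
  · exact (W.inChartAt_false_iff.mp h).1
  · exact (W.inChartAt_true_iff.mp h).1

variable {W} in
theorem InChartAt.to_false {p : glued R} {ε : Bool} (h : W.InChartAt p (ε, true))
    (hw : ¬ W.VanAt p (W.wc ε)) : W.InChartAt p (ε, false) := by
  rw [W.inChartAt_true_iff] at h
  have h1 := inv_mem_of_not_van h.2.2 hw
  exact W.inChartAt_false_iff.mpr ⟨h.1, by rw [W.xc_eq, div_eq_mul_inv]; exact mul_mem h.2.1 h1,
    by rwa [W.yc_eq]⟩

/-- If both `t` and `1 / t` are regular at `p`, the two values of `scale` differ by the unit `t ^ 3`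
or its inverse, and the coordinates of the fibre change by powers of this unit. -/
theorem inChartAt_of_baseCoord_mem {p : glued R} {ε ε' δ : Bool} (h : W.InChartAt p (ε, δ))
    (h' : W.base (baseCoord ε') ∈ W.stalkAt p) : W.InChartAt p (ε', δ) := by
  have key : ∃ r, W.base r ∈ W.stalkAt p ∧ (W.base r)⁻¹ ∈ W.stalkAt p ∧ r ≠ 0 ∧
      scale ε' = r * scale ε := by
    have hX := RatFunc.X_ne_zero (K := k)
    have h1 := h.baseCoord_mem
    cases ε <;> cases ε'
    · exact ⟨1, by simp, by simp, one_ne_zero, by simp⟩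
    · refine ⟨RatFunc.X⁻¹ ^ 3, ?_, ?_, pow_ne_zero 3 (inv_ne_zero hX), by simp [scale]⟩
      · rw [map_pow]; exact pow_mem h' 3
      · rw [← map_inv₀, inv_pow, inv_inv, map_pow]; exact pow_mem h1 3
    · refine ⟨RatFunc.X ^ 3, ?_, ?_, pow_ne_zero 3 hX, by simp [scale, hX]⟩
      · rw [map_pow]; exact pow_mem h' 3
      · rw [← map_inv₀, ← inv_pow, map_pow]; exact pow_mem h1 3
    · exact ⟨1, by simp, by simp, one_ne_zero, by simp⟩
  obtain ⟨r, hr, hr', hr0, e⟩ := key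
  have hr1 : W.base r ≠ 0 := (_root_.map_ne_zero _).mpr hr0
  have hs := W.base_scale_ne_zero ε
  cases δ
  · rw [W.inChartAt_false_iff] at h
    refine W.inChartAt_false_iff.mpr ⟨h', ?_, ?_⟩
    · convert mul_mem (pow_mem hr 2) h.2.1 using 1
      rw [xc, xc, e, map_mul]; ring
    · convert mul_mem (pow_mem hr 3) h.2.2 using 1
      rw [yc, yc, e, map_mul]; ring
  · rw [W.inChartAt_true_iff] at h
    refine W.inChartAt_true_iff.mpr ⟨h', ?_, ?_⟩
    · convert mul_mem hr' h.2.1 using 1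
      have e1 := (W.uc_false ε').symm.trans (W.uc_false ε)
      rw [e, map_mul] at e1
      field_simp
      refine mul_left_cancel₀ hs ?_
      linear_combination e1
    · convert mul_mem (pow_mem hr' 3) h.2.2 using 1
      have e1 := (W.wc_false ε').symm.trans (W.wc_false ε)
      rw [e, map_mul] at e1
      field_simp
      refine mul_left_cancel₀ (pow_ne_zero 3 hs) ?_
      linear_combination e1

theorem exists_inChartAt (p : glued R) : ∃ ε δ, W.InChartAt p (ε, δ) := by
  obtain ⟨⟨ε, δ⟩, h⟩ := exists_inChart (R) (false, false) p
  exact ⟨ε, δ, h⟩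

/-- The point `p` dominates the base. -/
def Horizontal (p : glued R) : Prop :=
  ∀ r : RatFunc k, r ≠ 0 → W.base r ∈ W.stalkAt p ∧ ¬ W.VanAt p (W.base r)

/-- The point `p` lies over the point `c` of the base. -/
def LiesOver (p : glued R) (c : Option k) : Prop := W.VanAt p (W.base (unif c))

variable {W} in
theorem Horizontal.mem {p : glued R} (h : W.Horizontal p) (r : RatFunc k) :
    W.base r ∈ W.stalkAt p := by
  by_cases hr : r = 0
  · rw [hr, map_zero]; exact zero_mem _
  · exact (h r hr).1

variable {W} in
theorem Horizontal.van_iff {p : glued R} (h : W.Horizontal p) {r : RatFunc k} :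
    W.VanAt p (W.base r) ↔ r = 0 := by
  refine ⟨fun h1 => ?_, ?_⟩
  · by_contra hr
    exact (h r hr).2 h1
  · rintro rfl
    rw [map_zero]
    exact van_zero

/-- If no uniformizer of the base vanishes at `p`, then `t` is regular and every `t - c` is
invertible at `p`. Over an algebraically closed field these elements and the constants generate the
multiplicative group of `k(t)`. -/
theorem horizontal_or_liesOver [IsAlgClosed k] (p : glued R) :
    W.Horizontal p ∨ ∃ c, W.LiesOver p c := by
  by_cases hc : ∃ c, W.LiesOver p c
  · exact .inr hc
  left
  rw [not_exists] at hc
  obtain ⟨ε, δ, h⟩ := W.exists_inChartAt p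
  have hX : W.base RatFunc.X ∈ W.stalkAt p := by
    have h1 := h.baseCoord_mem
    cases ε
    · exact h1
    · have h2 := inv_mem_of_not_van h1 (hc none)
      rwa [← map_inv₀, baseCoord, inv_inv] at h2
  intro r hr
  refine induction_on_factors (M := fun r => W.base r ∈ W.stalkAt p ∧
    ¬ W.VanAt p (W.base r)) (fun u hu => ?_) (fun c => ?_) (fun r s hr hs h h' => ?_)
    (fun r hr h => ?_) hr
  · exact ⟨W.base_C_mem p u, W.not_van_base_C p hu⟩
  · exact ⟨by rw [map_sub]; exact sub_mem hX (W.base_C_mem p c), hc (some c)⟩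
  · rw [map_mul]
    refine ⟨mul_mem h.1 h'.1, ?_⟩
    rw [VanAt, van_mul_iff h.1 h'.1, not_or]
    exact ⟨h.2, h'.2⟩
  · rw [map_inv₀]
    exact ⟨inv_mem_of_not_van h.1 h.2, not_van_inv h.1 ((_root_.map_ne_zero _).mpr hr)⟩

namespace LiesOver
variable {W}
variable [IsAlgClosed k] {p : glued R} {c : Option k} (h : W.LiesOver p c)
include h

/-- The functions on the base that are regular at `p` form a subring containing the constants and
the uniformizer `π`. As `π` vanishes at `p`, the elements `u + w π` with `u ≠ 0` are invertible
there, and `ring_place_le` applies. -/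
theorem base_mem {r : RatFunc k} (hr : r ∈ (place c).ring) : W.base r ∈ W.stalkAt p := by
  refine ring_place_le c ((W.stalkAt p).comap (W.base)) (W.base_C_mem p) h.mem
    (fun u w hu => ?_) hr
  change W.base _ ∈ W.stalkAt p
  rw [map_inv₀]
  have h1 : W.VanAt p (W.base (RatFunc.C w * unif c)) := by
    rw [map_mul]
    exact h.mul_left (W.base_C_mem p w)
  refine inv_mem_of_not_van ?_ ?_
  · rw [map_add]; exact add_mem (W.base_C_mem p u) h1.mem
  · intro h2
    refine W.not_van_base_C p hu ?_
    rw [map_add] at h2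
    simpa using h2.sub h1

theorem van_base_iff {r : RatFunc k} (hr : r ∈ (place c).ring) :
    W.VanAt p (W.base r) ↔ InMax c r := by
  constructor
  · intro h1
    by_contra h2
    have h3 := h.base_mem (inv_mem_of_not_inMax hr h2)
    rw [map_inv₀] at h3
    exact not_van_of_inv_mem ((_root_.map_ne_zero _).mpr (place_eq_zero hr h2).1) h3 h1
  · rintro ⟨s, hs, rfl⟩
    rw [map_mul]
    exact Van.mul_right h (h.base_mem hs)

theorem mem_ring {r : RatFunc k} (hr : W.base r ∈ W.stalkAt p) : r ∈ (place c).ring := by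
  by_contra h1
  have h2 := inMax_inv h1
  have h3 := (h.van_base_iff h2.mem).mpr h2
  have h4 := h3.mul_left hr
  rw [← map_mul, mul_inv_cancel₀ (by rintro rfl; exact h1 (zero_mem _)), map_one] at h4
  exact not_van_one h4

theorem unique {c' : Option k} (h' : W.LiesOver p c') : c = c' := by
  by_contra hne
  obtain ⟨r, hr, hr'⟩ := placeSystem.exists_separating c c' hne
  exact hr' (h.mem_ring (h'.base_mem hr))

theorem exists_inChartAt : ∃ δ, W.InChartAt p (chartAt c, δ) := by
  obtain ⟨ε, δ, h1⟩ := W.exists_inChartAt p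
  exact ⟨δ, W.inChartAt_of_baseCoord_mem h1 (h.base_mem (baseCoord_mem c))⟩

end LiesOver

variable {W} in
theorem Horizontal.exists_inChartAt {p : glued R} (h : W.Horizontal p) (ε : Bool) :
    ∃ δ, W.InChartAt p (ε, δ) := by
  obtain ⟨ε', δ, h1⟩ := W.exists_inChartAt p
  exact ⟨δ, W.inChartAt_of_baseCoord_mem h1 (h.mem _)⟩

/-- If `1 / y` vanishes at a point, so does `x / y`. -/
theorem van_uc {p : glued R} {ε : Bool} (h : W.InChartAt p (ε, true))
    (hα : W.base (alpha a ε) ∈ W.stalkAt p) (hβ : W.base (beta b ε) ∈ W.stalkAt p)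
    (hw : W.VanAt p (W.wc ε)) : W.VanAt p (W.uc ε) := by
  rw [W.inChartAt_true_iff] at h
  have e : W.uc ε ^ 3 = W.wc ε * (1 - W.base (alpha a ε) * W.uc ε * W.wc ε -
      W.base (beta b ε) * W.wc ε ^ 2) := by
    linear_combination - W.wc_eq ε
  refine (van_pow_iff h.2.1 (n := 3) (by norm_num)).mp ?_
  rw [e]
  exact hw.mul_right (sub_mem (sub_mem (one_mem _) (mul_mem (mul_mem hα h.2.1) h.2.2))
    (mul_mem hβ (pow_mem h.2.2 2)))

end WeierstrassModel
end
end EllipticSurface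

/-! ### Section curves and their points -/

namespace EllipticSurface
open AlgebraicGeometry CategoryTheory Polynomial Glue DivisorTheory RatFunc

section
variable {k K : Type} [Field k] [Field K] [Algebra k K] {R : Bool × Bool → Subalgebra k K}
  {a b : k[X]} (W : WeierstrassModel R a b)

namespace WeierstrassModel

theorem uc_sub_ne_zero (ε : Bool) (r : RatFunc k) : W.uc ε - W.base r ≠ 0 := by
  intro h
  have h1 := sub_eq_zero.mp h
  rw [uc, div_eq_iff (W.yc_ne_zero ε), xc, yc] at h1
  have h2 := (W.indep (Polynomial.C (scale ε ^ 2) * Polynomial.X)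
    (- Polynomial.C (r * scale ε ^ 3)) (by
      rw [eval₂_mul, eval₂_neg, eval₂_C, eval₂_C, eval₂_X, map_mul, map_pow, map_pow, h1]
      ring)).1
  have h3 := congrArg (fun p => p.coeff 1) h2
  simp only [coeff_C_mul, coeff_X_one, coeff_zero, mul_one] at h3
  exact pow_ne_zero 2 (scale_ne_zero ε) h3

theorem xc_sub_ne_zero (ε : Bool) (r : RatFunc k) : W.xc ε - W.base r ≠ 0 := by
  intro h
  have h2 := (W.indep (Polynomial.C (scale ε ^ 2) * Polynomial.X - Polynomial.C r) 0 (by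
      rw [eval₂_sub, eval₂_mul, eval₂_zero, eval₂_C, eval₂_C, eval₂_X, map_pow, zero_mul, add_zero]
      exact h)).1
  have h3 := congrArg (fun p => p.coeff 1) h2
  simp only [coeff_sub, coeff_C_mul, coeff_X_one, coeff_zero, mul_one, coeff_C_succ,
    sub_zero] at h3
  exact pow_ne_zero 2 (scale_ne_zero ε) h3

theorem yc_sub_ne_zero (ε : Bool) (r : RatFunc k) : W.yc ε - W.base r ≠ 0 := by
  intro h
  have h2 := (W.indep (- Polynomial.C r) (Polynomial.C (scale ε ^ 3)) (by
      rw [eval₂_neg, eval₂_C, eval₂_C, map_pow]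
      rw [yc] at h
      linear_combination h)).2
  exact pow_ne_zero 3 (scale_ne_zero ε) (Polynomial.C_eq_zero.mp h2)

variable [IsGluable R] [IsFractionRing (R (false, false)) K]

theorem van_coord_zero (p : glued R) (ε δ : Bool) :
    W.VanAt p (W.coord ε δ 0 - W.base (baseCoord ε)) := by
  have h : W.coord ε δ 0 = W.base (baseCoord ε) := by cases δ <;> rfl
  rw [h, sub_self]
  exact van_zero

/-- A curve that is a section of the fibration: on it, `X / Y = u` and `Z / Y = w`. -/
structure SectionData (σ : PrimeDivisor (glued R)) where
  /-- the restriction of `X / Y` -/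
  u : RatFunc k
  /-- the restriction of `Z / Y` -/
  w : RatFunc k
  horizontal : W.Horizontal σ.1
  van_u : W.VanAt σ.1 (W.uc false - W.base u)
  van_w : W.VanAt σ.1 (W.wc false - W.base w)

namespace SectionData
variable {W} {σ : PrimeDivisor (glued R)} (S : W.SectionData σ)
include S

theorem inChartAt_true (ε : Bool) : W.InChartAt σ.1 (ε, true) := by
  refine W.inChartAt_of_baseCoord_mem (ε := false) (W.inChartAt_true_iff.mpr
    ⟨S.horizontal.mem _, ?_, ?_⟩) (S.horizontal.mem _)
  · simpa using add_mem S.van_u.mem (S.horizontal.mem S.u)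
  · simpa using add_mem S.van_w.mem (S.horizontal.mem S.w)

/-- The coordinates on the chart `Y ≠ 0` take values in `k(t)` along `σ`. The same follows for
polynomials in them and for quotients whose denominator does not vanish along `σ`, so the residue
field of `σ` is `k(t)`. -/
theorem exists_val (f : W.stalkAt σ.1) : ∃ r, W.VanAt σ.1 (f - W.base r) := by
  have hb := S.horizontal.mem
  let T : Subalgebra k (K) :=
    { carrier := {f | ∃ r, W.VanAt σ.1 (f - W.base r)}
      algebraMap_mem' := fun c => ⟨RatFunc.C c, by
        rw [← W.base_C, sub_self]
        exact van_zero⟩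
      add_mem' := by
        rintro f g ⟨r, hr⟩ ⟨s, hs⟩
        refine ⟨r + s, ?_⟩
        rw [map_add, add_sub_add_comm]
        exact hr.add hs
      mul_mem' := by
        rintro f g ⟨r, hr⟩ ⟨s, hs⟩
        refine ⟨r * s, ?_⟩
        rw [map_mul, show f * g - W.base r * W.base s =
          (f - W.base r) * (g - W.base s + W.base s) + W.base r * (g - W.base s) by ring]
        exact (hr.mul_right (add_mem hs.mem (hb s))).add (hs.mul_left (hb r)) }
  have hT : R (false, true) ≤ T := by
    rw [W.chart_eq]
    refine Algebra.adjoin_le ?_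
    rintro _ ⟨j, rfl⟩
    fin_cases j
    · exact ⟨baseCoord false, W.van_coord_zero _ false true⟩
    · exact ⟨S.u, S.van_u⟩
    · exact ⟨S.w, S.van_w⟩
  obtain ⟨f, hf⟩ := f
  obtain ⟨p, hp, q, hq, hqv, rfl⟩ := (S.inChartAt_true false).exists_div hf
  obtain ⟨r, hr⟩ := hT hp
  obtain ⟨s, hs⟩ := hT hq
  have hs1 : ¬ W.VanAt σ.1 (W.base s) := fun h => hqv ((van_sub_congr hs).mpr h)
  have hs0 := ne_zero_of_not_van hs1
  have hq0 := ne_zero_of_not_van hqv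
  refine ⟨r / s, ?_⟩
  have e : p / q - W.base (r / s) = ((p - W.base r) * W.base s -
      W.base r * (q - W.base s)) * (W.base s)⁻¹ * q⁻¹ := by
    rw [map_div₀]
    field_simp
    ring
  change W.VanAt σ.1 (p / q - W.base (r / s))
  rw [e]
  exact (((hr.mul_right (hb s)).sub (hs.mul_left (hb r))).mul_right
    (inv_mem_of_not_van (hb s) hs1)).mul_right
    (inv_mem_of_not_van (S.inChartAt_true false q hq) hqv)

theorem val_unique {f : K} {r s : RatFunc k} (hr : W.VanAt σ.1 (f - W.base r))
    (hs : W.VanAt σ.1 (f - W.base s)) : r = s := by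
  refine sub_eq_zero.mp (S.horizontal.van_iff.mp ?_)
  rw [map_sub]
  simpa using hs.sub hr

/-- The restriction of rational functions to a section. -/
noncomputable def ev : W.stalkAt σ.1 →+* RatFunc k :=
  RingHom.mk'
    { toFun f := (S.exists_val f).choose
      map_one' := S.val_unique (S.exists_val 1).choose_spec (by simpa using van_zero)
      map_mul' f g := by
        refine S.val_unique (S.exists_val (f * g)).choose_spec ?_
        have hr := (S.exists_val f).choose_spec
        have hs := (S.exists_val g).choose_spec
        set r := (S.exists_val f).choose
        set s := (S.exists_val g).choose
        rw [map_mul, Subring.coe_mul, show (f : K) * g - W.base r * W.base s =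
          (f - W.base r) * g + W.base r * (g - W.base s) by ring]
        exact (hr.mul_right g.2).add (hs.mul_left (S.horizontal.mem r)) }
    fun f g => by
      refine S.val_unique (S.exists_val (f + g)).choose_spec ?_
      rw [map_add, Subring.coe_add, add_sub_add_comm]
      exact (S.exists_val f).choose_spec.add (S.exists_val g).choose_spec

theorem van_sub_ev (f : W.stalkAt σ.1) : W.VanAt σ.1 (f - W.base (S.ev f)) :=
  (S.exists_val f).choose_spec

theorem ev_eq {f : K} (hf : f ∈ W.stalkAt σ.1) {r : RatFunc k}
    (h : W.VanAt σ.1 (f - W.base r)) : S.ev ⟨f, hf⟩ = r :=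
  S.val_unique (S.van_sub_ev ⟨f, hf⟩) h

theorem ev_base (r : RatFunc k) : S.ev ⟨W.base r, S.horizontal.mem r⟩ = r :=
  S.ev_eq _ (by rw [sub_self]; exact van_zero)

theorem ev_eq_zero_iff (f : W.stalkAt σ.1) : S.ev f = 0 ↔ W.VanAt σ.1 f := by
  exact (S.horizontal.van_iff.symm.trans (van_sub_congr (S.van_sub_ev f)).symm)

/-- The restriction of `X / Y` in a chart of the base. -/
noncomputable def uAt (ε : Bool) : RatFunc k := S.u / scale ε

/-- The restriction of `Z / Y` in a chart of the base. -/
noncomputable def wAt (ε : Bool) : RatFunc k := S.w / scale ε ^ 3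

theorem van_uc_sub (ε : Bool) : W.VanAt σ.1 (W.uc ε - W.base (S.uAt ε)) := by
  have hs := W.base_scale_ne_zero ε
  have e : W.uc ε - W.base (S.uAt ε) =
      W.base (scale ε)⁻¹ * (W.uc false - W.base S.u) := by
    rw [uAt, map_div₀, W.uc_false ε, map_inv₀]
    field_simp
  rw [e]
  exact S.van_u.mul_left (S.horizontal.mem _)

theorem van_wc_sub (ε : Bool) : W.VanAt σ.1 (W.wc ε - W.base (S.wAt ε)) := by
  have hs := W.base_scale_ne_zero ε
  have e : W.wc ε - W.base (S.wAt ε) =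
      W.base ((scale ε)⁻¹ ^ 3) * (W.wc false - W.base S.w) := by
    rw [wAt, map_div₀, W.wc_false ε, map_pow, map_pow, map_inv₀]
    field_simp
  rw [e]
  exact S.van_w.mul_left (S.horizontal.mem _)

theorem uc_mem (ε : Bool) : W.uc ε ∈ W.stalkAt σ.1 :=
  (W.inChartAt_true_iff.mp (S.inChartAt_true ε)).2.1

theorem wc_mem (ε : Bool) : W.wc ε ∈ W.stalkAt σ.1 :=
  (W.inChartAt_true_iff.mp (S.inChartAt_true ε)).2.2

theorem wAt_eq (ε : Bool) : S.wAt ε = S.uAt ε ^ 3 + alpha a ε * S.uAt ε * S.wAt ε ^ 2 +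
    beta b ε * S.wAt ε ^ 3 := by
  have h1 := S.ev_eq (S.uc_mem ε) (S.van_uc_sub ε)
  have h2 := S.ev_eq (S.wc_mem ε) (S.van_wc_sub ε)
  have e : (⟨W.wc ε, S.wc_mem ε⟩ : W.stalkAt σ.1) = ⟨W.uc ε, S.uc_mem ε⟩ ^ 3 +
      ⟨W.base (alpha a ε), S.horizontal.mem _⟩ * ⟨W.uc ε, S.uc_mem ε⟩ *
        ⟨W.wc ε, S.wc_mem ε⟩ ^ 2 +
      ⟨W.base (beta b ε), S.horizontal.mem _⟩ * ⟨W.wc ε, S.wc_mem ε⟩ ^ 3 :=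
    Subtype.ext (W.wc_eq ε)
  have h3 := congrArg S.ev e
  rwa [map_add, map_add, map_mul, map_mul, map_mul, map_pow, map_pow, map_pow, h1, h2, S.ev_base,
    S.ev_base] at h3

/-- The restriction of `X / Z` in a chart of the base. -/
noncomputable def xAt (ε : Bool) : RatFunc k := S.uAt ε / S.wAt ε

/-- The restriction of `Y / Z` in a chart of the base. -/
noncomputable def yAt (ε : Bool) : RatFunc k := (S.wAt ε)⁻¹

theorem yAt_sq {ε : Bool} (h : S.wAt ε ≠ 0) :
    S.yAt ε ^ 2 = S.xAt ε ^ 3 + alpha a ε * S.xAt ε + beta b ε := by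
  have h1 := S.wAt_eq ε
  rw [yAt, xAt]
  field_simp
  linear_combination h1

theorem not_van_wc {ε : Bool} (h : S.wAt ε ≠ 0) : ¬ W.VanAt σ.1 (W.wc ε) := by
  exact fun h1 => h (S.horizontal.van_iff.mp ((van_sub_congr (S.van_wc_sub ε)).mp h1))

theorem van_yc_sub {ε : Bool} (h : S.wAt ε ≠ 0) :
    W.VanAt σ.1 (W.yc ε - W.base (S.yAt ε)) := by
  have hw0 := W.wc_ne_zero ε
  have hb : W.base (S.wAt ε) ≠ 0 := (_root_.map_ne_zero _).mpr h
  have e : W.yc ε - W.base (S.yAt ε) =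
      (W.wc ε - W.base (S.wAt ε)) * (-(W.base (S.wAt ε)⁻¹ * (W.wc ε)⁻¹)) := by
    rw [yAt, W.yc_eq, map_inv₀]
    field_simp
    ring
  rw [e]
  exact (S.van_wc_sub ε).mul_right (neg_mem (mul_mem (S.horizontal.mem _)
    (inv_mem_of_not_van (S.wc_mem ε) (S.not_van_wc h))))

theorem van_xc_sub {ε : Bool} (h : S.wAt ε ≠ 0) :
    W.VanAt σ.1 (W.xc ε - W.base (S.xAt ε)) := by
  have hw0 := W.wc_ne_zero ε
  have e : W.xc ε - W.base (S.xAt ε) =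
      (W.uc ε - W.base (S.uAt ε)) * (W.wc ε)⁻¹ +
        W.base (S.uAt ε) * (W.yc ε - W.base (S.yAt ε)) := by
    rw [xAt, yAt, W.xc_eq, W.yc_eq, div_eq_mul_inv (S.uAt ε), map_mul]
    field_simp
    ring
  rw [e]
  exact ((S.van_uc_sub ε).mul_right (inv_mem_of_not_van (S.wc_mem ε) (S.not_van_wc h))).add
    ((S.van_yc_sub h).mul_left (S.horizontal.mem _))

theorem inChartAt_false {ε : Bool} (h : S.wAt ε ≠ 0) : W.InChartAt σ.1 (ε, false) :=
  (S.inChartAt_true ε).to_false (S.not_van_wc h)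

open Classical in
/-- Whether the point of the section over `c` lies on the zero section. -/
noncomputable def delta (c : Option k) : Bool :=
  decide (InMax c (S.wAt (chartAt c)))

theorem delta_eq_true {c : Option k} : S.delta c = true ↔ InMax c (S.wAt (chartAt c)) := by
  simp [delta]

theorem delta_eq_false {c : Option k} : S.delta c = false ↔ ¬ InMax c (S.wAt (chartAt c)) := by
  simp [delta]

theorem wAt_ne_zero {c : Option k} (h : S.delta c = false) : S.wAt (chartAt c) ≠ 0 := by
  intro h0
  rw [delta_eq_false, h0] at h
  exact h inMax_zero

theorem inChartAt (c : Option k) : W.InChartAt σ.1 (chartAt c, S.delta c) := by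
  cases h : S.delta c
  · exact S.inChartAt_false (S.wAt_ne_zero h)
  · exact S.inChartAt_true _

/-- The restrictions of the coordinates to the section. -/
noncomputable def val (ε δ : Bool) : Fin 3 → RatFunc k :=
  match δ with
  | false => ![baseCoord ε, S.xAt ε, S.yAt ε]
  | true => ![baseCoord ε, S.uAt ε, S.wAt ε]

theorem van_coord_sub (c : Option k) (j : Fin 3) : W.VanAt σ.1
    (W.coord (chartAt c) (S.delta c) j - W.base (S.val (chartAt c) (S.delta c) j)) := by
  cases h : S.delta c
  · have h0 := S.wAt_ne_zero h
    fin_cases j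
    · exact W.van_coord_zero _ _ _
    · exact S.van_xc_sub h0
    · exact S.van_yc_sub h0
  · fin_cases j
    · exact W.van_coord_zero _ _ _
    · exact S.van_uc_sub _
    · exact S.van_wc_sub _

theorem yAt_mem {c : Option k} (h : S.delta c = false) :
    S.yAt (chartAt c) ∈ (place c).ring := by
  rw [delta_eq_false] at h
  by_contra h1
  have h2 := inMax_inv h1
  rw [yAt, inv_inv] at h2
  exact h h2

variable (ha : a.natDegree ≤ 12) (hb : b.natDegree ≤ 18)
include ha hb

/-- The chart selected by `delta` is the one in which the section is regular over `c`. If `w`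
vanishes at `c`, so does `u`; otherwise `y = 1 / w` is regular, and `x` is integral over the
valuation ring. -/
theorem val_mem (c : Option k) (j : Fin 3) :
    S.val (chartAt c) (S.delta c) j ∈ (place c).ring := by
  cases h : S.delta c
  · fin_cases j
    · exact baseCoord_mem c
    · exact mem_of_sq_mem (alpha_mem ha c) (beta_mem hb c) (S.yAt_mem h)
        (S.yAt_sq (S.wAt_ne_zero h))
    · exact S.yAt_mem h
  · have h1 := S.delta_eq_true.mp h
    fin_cases j
    · exact baseCoord_mem c
    · exact (inMax_of_eq (alpha_mem ha c) (beta_mem hb c) h1 (S.wAt_eq _)).mem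
    · exact h1.mem

theorem ev_mem_of_mem_chartRing (c : Option k) {f : K}
    (hf : f ∈ R (chartAt c, S.delta c)) :
    S.ev ⟨f, S.inChartAt c f hf⟩ ∈ (place c).ring := by
  let T : Subalgebra k (K) :=
    { carrier := {f | ∃ h : f ∈ W.stalkAt σ.1, S.ev ⟨f, h⟩ ∈ (place c).ring}
      algebraMap_mem' := fun u => by
        rw [← W.base_C]
        exact ⟨S.horizontal.mem _, by rw [S.ev_base]; exact C_mem c u⟩
      add_mem' := by
        rintro f g ⟨hf, hf'⟩ ⟨hg, hg'⟩
        refine ⟨add_mem hf hg, ?_⟩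
        have := add_mem hf' hg'
        rwa [← map_add] at this
      mul_mem' := by
        rintro f g ⟨hf, hf'⟩ ⟨hg, hg'⟩
        refine ⟨mul_mem hf hg, ?_⟩
        have := mul_mem hf' hg'
        rwa [← map_mul] at this }
  have hT : R (chartAt c, S.delta c) ≤ T := by
    rw [W.chart_eq]
    refine Algebra.adjoin_le ?_
    rintro _ ⟨j, rfl⟩
    refine ⟨S.inChartAt c _ (W.coord_mem _ _ j), ?_⟩
    rw [S.ev_eq _ (S.van_coord_sub c j)]
    exact S.val_mem ha hb c j
  exact (hT hf).2

/-- The functions on the chart whose restriction to `σ` vanishes at `c` form a prime ideal, because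
restrictions lie in the valuation ring of `c`. Its point is the point of the section over `c`. -/
theorem exists_pt (c : Option k) : ∃ p : glued R, W.InChartAt p (chartAt c, S.delta c) ∧
    ∀ f (hf : f ∈ R (chartAt c, S.delta c)),
      W.VanAt p f ↔ InMax c (S.ev ⟨f, S.inChartAt c f hf⟩) := by
  let q : Ideal (R (chartAt c, S.delta c)) :=
    { carrier := {f | InMax c (S.ev ⟨f, S.inChartAt c f f.2⟩)}
      zero_mem' := by
        change InMax c (S.ev 0)
        rw [map_zero]; exact inMax_zero
      add_mem' := by
        intro f g hf hg
        have := hf.add hg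
        rwa [← map_add] at this
      smul_mem' := by
        intro f g hg
        have := InMax.mul_left hg (S.ev_mem_of_mem_chartRing ha hb c f.2)
        rwa [← map_mul] at this }
  have hq : q.IsPrime := by
    refine ⟨fun h => ?_, fun {f g} h => ?_⟩
    · have h1 : InMax c (S.ev 1) := (Ideal.eq_top_iff_one q).mp h
      rw [map_one] at h1
      exact not_inMax_one h1
    · have h1 : InMax c (S.ev (⟨f, S.inChartAt c f f.2⟩ * ⟨g, S.inChartAt c g g.2⟩)) := h
      rw [map_mul] at h1
      exact h1.of_mul (S.ev_mem_of_mem_chartRing ha hb c f.2)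
        (S.ev_mem_of_mem_chartRing ha hb c g.2)
  obtain ⟨p, hp, h⟩ := exists_point R (false, false) _ q
  exact ⟨p, hp, fun f hf => h ⟨f, hf⟩⟩

/-- The point of the section over a point of the base. -/
noncomputable def pt (c : Option k) : glued R := (S.exists_pt ha hb c).choose

theorem inChartAt_pt (c : Option k) : W.InChartAt (S.pt ha hb c) (chartAt c, S.delta c) :=
  (S.exists_pt ha hb c).choose_spec.1

theorem van_pt_iff_of_mem (c : Option k) {f : K}
    (hf : f ∈ R (chartAt c, S.delta c)) :
    W.VanAt (S.pt ha hb c) f ↔ InMax c (S.ev ⟨f, S.inChartAt c f hf⟩) :=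
  (S.exists_pt ha hb c).choose_spec.2 f hf

theorem specializes_pt (c : Option k) : σ.1 ⤳ S.pt ha hb c := by
  refine (S.inChartAt_pt ha hb c).specializes (S.inChartAt c) fun f hf h => ?_
  refine (S.van_pt_iff_of_mem ha hb c hf).mpr ?_
  rw [(S.ev_eq_zero_iff ⟨f, S.inChartAt c f hf⟩).mpr h]
  exact inMax_zero

theorem liesOver_pt (c : Option k) : W.LiesOver (S.pt ha hb c) c := by
  have h : W.base (unif c) ∈ R (chartAt c, S.delta c) := by
    have h1 : W.base (unif c) = W.coord (chartAt c) (S.delta c) 0 -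
        algebraMap k (K) (coordAt c) := by
      have : W.coord (chartAt c) (S.delta c) 0 = W.base (baseCoord (chartAt c)) := by
        cases S.delta c
        · rfl
        · rfl
      rw [this, baseCoord_chartAt, map_add, W.base_C, add_sub_cancel_left]
    rw [h1]
    exact sub_mem (W.coord_mem _ _ 0) (Subalgebra.algebraMap_mem _ _)
  refine (S.van_pt_iff_of_mem ha hb c h).mpr ?_
  rw [S.ev_base]
  exact inMax_unif

omit ha hb
variable [IsAlgClosed k]

/-- If the restriction `r` of `f` had a pole at `c`, then `r⁻¹`, and hence `f * r⁻¹`, would vanish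
at `p`. But `f * r⁻¹ - 1` vanishes along `σ` and so at `p`. -/
theorem ev_mem {p : glued R} {c : Option k} (hp : W.LiesOver p c) (h : σ.1 ⤳ p)
    {f : K} (hf : f ∈ W.stalkAt p) : S.ev ⟨f, stk_le h hf⟩ ∈ (place c).ring := by
  by_contra hr
  set r := S.ev ⟨f, stk_le h hf⟩ with hr_def
  have hr0 : r ≠ 0 := by
    intro h0
    rw [h0] at hr
    exact hr (zero_mem _)
  have h1 := inMax_inv hr
  have h2 := (hp.van_base_iff h1.mem).mpr h1
  have h3 : W.VanAt σ.1 (f * W.base r⁻¹ - 1) := by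
    have h4 := (S.van_sub_ev ⟨f, stk_le h hf⟩).mul_right (S.horizontal.mem r⁻¹)
    rwa [← hr_def, sub_mul, ← map_mul, mul_inv_cancel₀ hr0, map_one] at h4
  have h5 := Van.of_specializes h (sub_mem (mul_mem hf h2.mem) (one_mem _)) h3
  have h6 := (h2.mul_left hf).sub h5
  rw [sub_sub_cancel] at h6
  exact not_van_one h6

theorem van_iff {p : glued R} {c : Option k} (hp : W.LiesOver p c) (h : σ.1 ⤳ p)
    {f : K} (hf : f ∈ W.stalkAt p) :
    W.VanAt p f ↔ InMax c (S.ev ⟨f, stk_le h hf⟩) := by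
  have h1 := S.ev_mem hp h hf
  rw [← hp.van_base_iff h1]
  refine van_sub_congr (Van.of_specializes h (sub_mem hf (hp.base_mem h1)) ?_)
  exact S.van_sub_ev ⟨f, stk_le h hf⟩

include ha hb in
-- The value of `w` at `c` decides which chart can contain `p`, and this is the chart selected by
-- `delta`. Within it the functions vanishing at a point of `σ` over `c` are read off from their
-- restrictions to `σ`, which leaves no choice for the point.
theorem eq_pt {p : glued R} {c : Option k} (hp : W.LiesOver p c) (h : σ.1 ⤳ p) :
    p = S.pt ha hb c := by
  have hc : W.InChartAt p (chartAt c, S.delta c) := by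
    obtain ⟨δ, hδ⟩ := hp.exists_inChartAt
    cases h1 : S.delta c <;> cases δ
    · exact hδ
    · refine hδ.to_false ?_
      rw [S.van_iff hp h (W.inChartAt_true_iff.mp hδ).2.2, S.ev_eq _ (S.van_wc_sub _)]
      exact S.delta_eq_false.mp h1
    · have hy := (W.inChartAt_false_iff.mp hδ).2.2
      have h2 := S.ev_mem hp h hy
      have h3 := (S.delta_eq_true.mp h1).mul_left h2
      rw [← S.ev_eq (S.wc_mem _) (S.van_wc_sub _), ← map_mul] at h3
      have e : (⟨W.yc (chartAt c), stk_le h hy⟩ * ⟨W.wc (chartAt c), S.wc_mem _⟩ :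
          W.stalkAt σ.1) = 1 := Subtype.ext (mul_inv_cancel₀ (W.yc_ne_zero _))
      rw [e, map_one] at h3
      exact absurd h3 not_inMax_one
    · exact hδ
  refine InChart.ext (S.inChartAt_pt ha hb c) hc fun f hf => ?_
  change W.VanAt p f ↔ W.VanAt _ f
  rw [S.van_iff hp h (hc f hf), S.van_pt_iff_of_mem ha hb c hf]

include ha hb in
-- A specialization of `σ` either lies over a point of the base or dominates the base. In the second
-- case a function vanishes there only if its restriction in `k(t)` is zero, so the point is `σ`
-- itself.
theorem exists_pt_eq {p : glued R} (h : σ.1 ⤳ p) (hne : p ≠ σ.1) :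
    ∃ c, S.pt ha hb c = p := by
  rcases W.horizontal_or_liesOver p with h1 | ⟨c, h1⟩
  · refine absurd ?_ hne
    refine Specializes.antisymm ?_ h |>.eq
    refine specializes_of_van_le (φ := fieldEquiv R (false, false)) (p := p) (specializes_refl p) h
      fun f hf hv => ?_
    have h2 := Van.of_specializes h (sub_mem hf (h1.mem _)) (S.van_sub_ev ⟨f, stk_le h hf⟩)
    have h3 : S.ev ⟨f, stk_le h hf⟩ = 0 := h1.van_iff.mp ((van_sub_congr h2).mp hv)
    exact (S.ev_eq_zero_iff ⟨f, stk_le h hf⟩).mp h3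
  · exact ⟨c, (S.eq_pt ha hb h1 h).symm⟩

end SectionData
end WeierstrassModel
end
end EllipticSurface

/-! ### Local equations of sections -/

namespace DivisorTheory
open AlgebraicGeometry CategoryTheory Limits
section
variable {X : Scheme.{0}} [AlgebraicGeometry.IsIntegral X] [AlgebraicGeometry.IsNoetherian X]
  {F : Type} [Field F] {φ : F ≃+* X.functionField}
  {L Pl : Type} [Field L] {V : PlaceSystem L Pl} {σ : PrimeDivisor X}

theorem CompleteCurve.ordAt_gen (S : CompleteCurve φ V σ) (c : Pl) : ordAt φ σ (S.gen c) = 1 :=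
  (S.localCurve c).ordAt_gen

/-- Every function regular at the point and vanishing along `σ` is a multiple of the local equation,
so a prime divisor through the point on which the equation vanishes is a specialization of `σ`. -/
theorem CompleteCurve.ordAt_gen_of_ne (S : CompleteCurve φ V σ) {c : Pl} {C : PrimeDivisor X}
    (hC : C.1 ⤳ S.pt c) (hne : C ≠ σ) : ordAt φ C (S.gen c) = 0 := by
  refine ordAt_eq_zero (stk_le hC (S.gen_mem c)) fun hv => hne ?_
  symm
  refine PrimeDivisor.eq_of_specializes (specializes_of_van_le (φ := φ) (S.specializes c) hC
    fun f hf hfv => ?_)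
  have h1 := hv.mul_right (stk_le hC (S.div_gen_mem c f hf hfv))
  rwa [mul_div_cancel₀ _ (S.gen_ne_zero c)] at h1

end
end DivisorTheory

namespace EllipticSurface
open AlgebraicGeometry CategoryTheory Polynomial Glue DivisorTheory RatFunc

section
variable {k K : Type} [Field k] [Field K] [Algebra k K] {R : Bool × Bool → Subalgebra k K}
  {a b : k[X]} {W : WeierstrassModel R a b} [IsGluable R] [IsFractionRing (R (false, false)) K]

namespace WeierstrassModel
namespace SectionData
variable {σ : PrimeDivisor (glued R)} (S : W.SectionData σ)

/-- Subtracting the equation of the section from that of the surface gives two factorizations to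
compare. At a point of the section the cofactors become `2 y` and `3 x ^ 2 + α`; where one of them
is a unit, one coordinate difference is a multiple of the other. -/
theorem sub_mul_add {ε : Bool} (h : S.wAt ε ≠ 0) :
    (W.yc ε - W.base (S.yAt ε)) * (W.yc ε + W.base (S.yAt ε)) =
      (W.xc ε - W.base (S.xAt ε)) * (W.xc ε ^ 2 + W.xc ε * W.base (S.xAt ε) +
        W.base (S.xAt ε) ^ 2 + W.base (alpha a ε)) := by
  have h1 := W.yc_sq ε
  have h2 := congrArg W.base (S.yAt_sq h)
  rw [map_add, map_add, map_mul, map_pow, map_pow] at h2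
  linear_combination h1 - h2

/-- This is the counterpart in the chart `Y ≠ 0`. Where `w` vanishes, the cofactor of `w - w₀` is a
unit, so `u - u₀` is a local equation. -/
theorem wc_sub_mul (ε : Bool) :
    (W.wc ε - W.base (S.wAt ε)) * (1 - (W.base (alpha a ε) * W.uc ε * (W.wc ε + W.base (S.wAt ε)) +
        W.base (beta b ε) * (W.wc ε * (W.wc ε + W.base (S.wAt ε)) + W.base (S.wAt ε) ^ 2))) =
      (W.uc ε - W.base (S.uAt ε)) * (W.uc ε ^ 2 + W.uc ε * W.base (S.uAt ε) +
        W.base (S.uAt ε) ^ 2 + W.base (alpha a ε) * W.base (S.wAt ε) ^ 2) := by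
  have h1 := W.wc_eq ε
  have h2 := congrArg W.base (S.wAt_eq ε)
  simp only [map_add, map_mul, map_pow] at h2
  linear_combination h1 - h2

theorem mem_of_van_sub {p : glued R} {f : K} {r : RatFunc k} (h : W.VanAt p (f - W.base r))
    (hr : W.base r ∈ W.stalkAt p) : f ∈ W.stalkAt p := by
  simpa using add_mem h.mem hr

open Classical in
/-- A local equation of a section. -/
noncomputable def gen (c : Option k) : K :=
  match S.delta c with
  | true => W.uc (chartAt c) - W.base (S.uAt (chartAt c))
  | false => if InMax c (2 * S.yAt (chartAt c)) then W.yc (chartAt c) - W.base (S.yAt (chartAt c))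
      else W.xc (chartAt c) - W.base (S.xAt (chartAt c))

theorem gen_of_true {c : Option k} (h : S.delta c = true) :
    S.gen c = W.uc (chartAt c) - W.base (S.uAt (chartAt c)) := by rw [gen, h]

theorem gen_of_inMax {c : Option k} (h : S.delta c = false)
    (h' : InMax c (2 * S.yAt (chartAt c))) :
    S.gen c = W.yc (chartAt c) - W.base (S.yAt (chartAt c)) := by
  rw [gen, h]
  exact if_pos h'

theorem gen_of_not_inMax {c : Option k} (h : S.delta c = false)
    (h' : ¬ InMax c (2 * S.yAt (chartAt c))) :
    S.gen c = W.xc (chartAt c) - W.base (S.xAt (chartAt c)) := by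
  rw [gen, h]
  exact if_neg h'

theorem gen_ne_zero (c : Option k) : S.gen c ≠ 0 := by
  cases h : S.delta c
  · by_cases h' : InMax c (2 * S.yAt (chartAt c))
    · rw [S.gen_of_inMax h h']; exact W.yc_sub_ne_zero _ _
    · rw [S.gen_of_not_inMax h h']; exact W.xc_sub_ne_zero _ _
  · rw [S.gen_of_true h]; exact W.uc_sub_ne_zero _ _

theorem van_gen (c : Option k) : W.VanAt σ.1 (S.gen c) := by
  cases h : S.delta c
  · by_cases h' : InMax c (2 * S.yAt (chartAt c))
    · rw [S.gen_of_inMax h h']; exact S.van_yc_sub (S.wAt_ne_zero h)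
    · rw [S.gen_of_not_inMax h h']; exact S.van_xc_sub (S.wAt_ne_zero h)
  · rw [S.gen_of_true h]; exact S.van_uc_sub _

variable [IsAlgClosed k] (hJ : JacobianCriterion a b) (ha : a.natDegree ≤ 12)
  (hb : b.natDegree ≤ 18)

theorem base_alpha_mem (ha : a.natDegree ≤ 12) {p : glued R} {c : Option k}
    (hp : W.LiesOver p c) : W.base (alpha a (chartAt c)) ∈ W.stalkAt p :=
  hp.base_mem (alpha_mem ha c)

theorem base_beta_mem (hb : b.natDegree ≤ 18) {p : glued R} {c : Option k}
    (hp : W.LiesOver p c) : W.base (beta b (chartAt c)) ∈ W.stalkAt p :=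
  hp.base_mem (beta_mem hb c)

include hJ ha hb in
-- Each case of the definition of `gen` has a factorization with an invertible cofactor: `3 x ^ 2 +
-- α` where `2 y` vanishes, by smoothness; `2 y` where it does not; and `1 - E` on the zero section,
-- where `E` vanishes.
theorem coord_sub_div_gen_mem (c : Option k) (j : Fin 3) :
    (W.coord (chartAt c) (S.delta c) j - W.base (S.val (chartAt c) (S.delta c) j)) / S.gen c ∈
      W.stalkAt (S.pt ha hb c) := by
  have hp := S.liesOver_pt ha hb c
  have hc := S.inChartAt_pt ha hb c
  have hs := S.specializes_pt ha hb c
  have hg0 := S.gen_ne_zero c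
  have hval := S.val_mem ha hb c
  have hα := base_alpha_mem ha hp
  have hβ := base_beta_mem hb hp
  cases h : S.delta c
  · have hw := S.wAt_ne_zero h
    rw [h] at hval hc
    have hx : S.xAt (chartAt c) ∈ (place c).ring := hval 1
    have hy : S.yAt (chartAt c) ∈ (place c).ring := hval 2
    obtain ⟨-, hX, hY⟩ := W.inChartAt_false_iff.mp hc
    have hbx := hp.base_mem hx
    have hby := hp.base_mem hy
    have e := S.sub_mul_add hw
    have vx := Van.of_specializes hs (sub_mem hX hbx) (S.van_xc_sub hw)
    have vy := Van.of_specializes hs (sub_mem hY hby) (S.van_yc_sub hw)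
    by_cases h' : InMax c (2 * S.yAt (chartAt c))
    · rw [S.gen_of_inMax h h'] at hg0 ⊢
      have h3 := (not_inMax_or hJ ha hb c hx hy (S.yAt_sq hw)).resolve_left (not_not.mpr h')
      set D := W.xc (chartAt c) ^ 2 + W.xc (chartAt c) * W.base (S.xAt (chartAt c)) +
        W.base (S.xAt (chartAt c)) ^ 2 + W.base (alpha a (chartAt c)) with hD
      have hDm : D ∈ W.stalkAt (S.pt ha hb c) :=
        add_mem (add_mem (add_mem (pow_mem hX 2) (mul_mem hX hbx)) (pow_mem hbx 2)) hα
      have hDv : ¬ W.VanAt (S.pt ha hb c) D := by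
        have h4 : W.VanAt (S.pt ha hb c)
            (D - W.base (3 * S.xAt (chartAt c) ^ 2 + alpha a (chartAt c))) := by
          have e2 : D - W.base (3 * S.xAt (chartAt c) ^ 2 + alpha a (chartAt c)) =
              (W.xc (chartAt c) - W.base (S.xAt (chartAt c))) *
                (W.xc (chartAt c) + 2 * W.base (S.xAt (chartAt c))) := by
            rw [hD, map_add, map_mul, map_pow, map_ofNat]
            ring
          rw [e2]
          exact vx.mul_right (add_mem hX (mul_mem (natCast_mem _ 2) hbx))
        intro h5
        exact h3 ((hp.van_base_iff (add_mem (mul_mem (natCast_mem _ 3) (pow_mem hx 2))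
          (alpha_mem ha c))).mp ((van_sub_congr h4).mp h5))
      fin_cases j
      · change (W.base (baseCoord (chartAt c)) - W.base (baseCoord (chartAt c))) / _ ∈ _
        rw [sub_self, zero_div]
        exact zero_mem _
      · change (W.xc (chartAt c) - W.base (S.xAt (chartAt c))) / _ ∈ _
        have hD0 := ne_zero_of_not_van hDv
        have e3 : (W.xc (chartAt c) - W.base (S.xAt (chartAt c))) /
            (W.yc (chartAt c) - W.base (S.yAt (chartAt c))) =
            (W.yc (chartAt c) + W.base (S.yAt (chartAt c))) * D⁻¹ := by
          rw [div_eq_iff hg0, ← div_eq_mul_inv, div_mul_eq_mul_div, eq_div_iff hD0, ← e]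
          ring
        rw [e3]
        exact mul_mem (add_mem hY hby) (inv_mem_of_not_van hDm hDv)
      · change (W.yc (chartAt c) - W.base (S.yAt (chartAt c))) / _ ∈ _
        rw [div_self hg0]
        exact one_mem _
    · rw [S.gen_of_not_inMax h h'] at hg0 ⊢
      set D := W.yc (chartAt c) + W.base (S.yAt (chartAt c)) with hD
      have hDm : D ∈ W.stalkAt (S.pt ha hb c) := add_mem hY hby
      have hDv : ¬ W.VanAt (S.pt ha hb c) D := by
        have h4 : W.VanAt (S.pt ha hb c) (D - W.base (2 * S.yAt (chartAt c))) := by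
          have e2 : D - W.base (2 * S.yAt (chartAt c)) =
              W.yc (chartAt c) - W.base (S.yAt (chartAt c)) := by
            rw [hD, map_mul, map_ofNat]
            ring
          rw [e2]
          exact vy
        intro h5
        exact h' ((hp.van_base_iff (mul_mem (natCast_mem _ 2) hy)).mp ((van_sub_congr h4).mp h5))
      fin_cases j
      · change (W.base (baseCoord (chartAt c)) - W.base (baseCoord (chartAt c))) / _ ∈ _
        rw [sub_self, zero_div]
        exact zero_mem _
      · change (W.xc (chartAt c) - W.base (S.xAt (chartAt c))) / _ ∈ _
        rw [div_self hg0]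
        exact one_mem _
      · change (W.yc (chartAt c) - W.base (S.yAt (chartAt c))) / _ ∈ _
        have hD0 := ne_zero_of_not_van hDv
        have e3 : (W.yc (chartAt c) - W.base (S.yAt (chartAt c))) /
            (W.xc (chartAt c) - W.base (S.xAt (chartAt c))) =
            (W.xc (chartAt c) ^ 2 + W.xc (chartAt c) * W.base (S.xAt (chartAt c)) +
              W.base (S.xAt (chartAt c)) ^ 2 + W.base (alpha a (chartAt c))) * D⁻¹ := by
          rw [div_eq_iff hg0, ← div_eq_mul_inv, div_mul_eq_mul_div, eq_div_iff hD0, e]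
          ring
        rw [e3]
        exact mul_mem (add_mem (add_mem (add_mem (pow_mem hX 2) (mul_mem hX hbx)) (pow_mem hbx 2))
          hα) (inv_mem_of_not_van hDm hDv)
  · rw [S.gen_of_true h] at hg0 ⊢
    have hw := S.delta_eq_true.mp h
    rw [h] at hval hc
    have hu : S.uAt (chartAt c) ∈ (place c).ring := hval 1
    have hbu := hp.base_mem hu
    have hbw := (hp.van_base_iff hw.mem).mpr hw
    obtain ⟨-, hU, hW⟩ := W.inChartAt_true_iff.mp hc
    have vw := Van.of_specializes hs (sub_mem hW hbw.mem) (S.van_wc_sub (chartAt c))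
    have vW : W.VanAt (S.pt ha hb c) (W.wc (chartAt c)) := (van_sub_congr vw).mpr hbw
    have e := S.wc_sub_mul (chartAt c)
    set E := W.base (alpha a (chartAt c)) * W.uc (chartAt c) *
        (W.wc (chartAt c) + W.base (S.wAt (chartAt c))) + W.base (beta b (chartAt c)) *
        (W.wc (chartAt c) * (W.wc (chartAt c) + W.base (S.wAt (chartAt c))) +
          W.base (S.wAt (chartAt c)) ^ 2) with hE
    have vE : W.VanAt (S.pt ha hb c) E :=
      ((vW.add hbw).mul_left (mul_mem hα hU)).add ((((vW.add hbw).mul_left hW).add (by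
        rw [pow_two]; exact hbw.mul_left hbw.mem)).mul_left hβ)
    have hDm : 1 - E ∈ W.stalkAt (S.pt ha hb c) := sub_mem (one_mem _) vE.mem
    have hDv : ¬ W.VanAt (S.pt ha hb c) (1 - E) := fun h5 => not_van_one (by
      simpa using h5.add vE)
    fin_cases j
    · change (W.base (baseCoord (chartAt c)) - W.base (baseCoord (chartAt c))) / _ ∈ _
      rw [sub_self, zero_div]
      exact zero_mem _
    · change (W.uc (chartAt c) - W.base (S.uAt (chartAt c))) / _ ∈ _
      rw [div_self hg0]
      exact one_mem _
    · change (W.wc (chartAt c) - W.base (S.wAt (chartAt c))) / _ ∈ _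
      have hD0 := ne_zero_of_not_van hDv
      have e3 : (W.wc (chartAt c) - W.base (S.wAt (chartAt c))) /
          (W.uc (chartAt c) - W.base (S.uAt (chartAt c))) =
          (W.uc (chartAt c) ^ 2 + W.uc (chartAt c) * W.base (S.uAt (chartAt c)) +
            W.base (S.uAt (chartAt c)) ^ 2 + W.base (alpha a (chartAt c)) *
              W.base (S.wAt (chartAt c)) ^ 2) * (1 - E)⁻¹ := by
        rw [div_eq_iff hg0, ← div_eq_mul_inv, div_mul_eq_mul_div, eq_div_iff hD0, e]
        ring
      rw [e3]
      exact mul_mem (add_mem (add_mem (add_mem (pow_mem hU 2) (mul_mem hU hbu)) (pow_mem hbu 2))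
        (mul_mem hα (pow_mem hbw.mem 2))) (inv_mem_of_not_van hDm hDv)

include hJ ha hb in
-- The functions that differ from a function of the base by a multiple of `gen` form a ring
-- containing the coordinates, hence the whole chart. For a function that vanishes along `σ` the
-- function of the base is zero. Denominators are harmless, being units at the point.
theorem div_gen_mem (c : Option k) {f : K} (hf : f ∈ W.stalkAt (S.pt ha hb c))
    (hv : W.VanAt σ.1 f) : f / S.gen c ∈ W.stalkAt (S.pt ha hb c) := by
  have hp := S.liesOver_pt ha hb c
  have hc := S.inChartAt_pt ha hb c
  have hs := S.specializes_pt ha hb c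
  have hg0 := S.gen_ne_zero c
  let T : Subalgebra k K :=
    { carrier := {f | f ∈ W.stalkAt (S.pt ha hb c) ∧ ∃ r ∈ (place c).ring,
        (f - W.base r) / S.gen c ∈ W.stalkAt (S.pt ha hb c)}
      algebraMap_mem' := fun u => by
        rw [← W.base_C]
        refine ⟨W.base_C_mem _ u, _, C_mem c u, ?_⟩
        rw [sub_self, zero_div]
        exact zero_mem _
      add_mem' := by
        rintro f g ⟨hf, r, hr, h⟩ ⟨hg, s, hs, h'⟩
        refine ⟨add_mem hf hg, r + s, add_mem hr hs, ?_⟩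
        rw [map_add, add_sub_add_comm, add_div]
        exact add_mem h h'
      mul_mem' := by
        rintro f g ⟨hf, r, hr, h⟩ ⟨hg, s, hs, h'⟩
        refine ⟨mul_mem hf hg, r * s, mul_mem hr hs, ?_⟩
        rw [map_mul, show (f * g - W.base r * W.base s) / S.gen c =
          (f - W.base r) / S.gen c * g + W.base r * ((g - W.base s) / S.gen c) by ring]
        exact add_mem (mul_mem h hg) (mul_mem (hp.base_mem hr) h') }
  have hT : R (chartAt c, S.delta c) ≤ T := by
    rw [W.chart_eq]
    refine Algebra.adjoin_le ?_
    rintro _ ⟨j, rfl⟩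
    exact ⟨hc _ (W.coord_mem _ _ j), _, S.val_mem ha hb c j,
      S.coord_sub_div_gen_mem hJ ha hb c j⟩
  obtain ⟨p, hp', q, hq, hqv, rfl⟩ := hc.exists_div hf
  have hq0 := ne_zero_of_not_van hqv
  have hpv : W.VanAt σ.1 p := by
    have h1 := hv.mul_right (stk_le hs (hc q hq))
    rwa [div_mul_cancel₀ _ hq0] at h1
  obtain ⟨-, r, hr, h⟩ := hT hp'
  have h1 : W.VanAt σ.1 (p - W.base r) := by
    have h2 := (S.van_gen c).mul_right (stk_le hs h)
    rwa [mul_div_cancel₀ _ hg0] at h2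
  have h2 : r = 0 := S.horizontal.van_iff.mp ((van_sub_congr h1).mp hpv)
  rw [h2, map_zero, sub_zero] at h
  rw [div_right_comm, div_eq_mul_inv]
  exact mul_mem h (inv_mem_of_not_van (hc q hq) hqv)

include hJ ha hb in
theorem gen_mem (c : Option k) : S.gen c ∈ W.stalkAt (S.pt ha hb c) := by
  have hp := S.liesOver_pt ha hb c
  have hc := S.inChartAt_pt ha hb c
  have key : ∀ j, W.coord (chartAt c) (S.delta c) j - W.base (S.val (chartAt c) (S.delta c) j) ∈
      W.stalkAt (S.pt ha hb c) := fun j =>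
    sub_mem (hc _ (W.coord_mem _ _ j)) (hp.base_mem (S.val_mem ha hb c j))
  cases h : S.delta c
  · rw [h] at key
    by_cases h' : InMax c (2 * S.yAt (chartAt c))
    · rw [S.gen_of_inMax h h']; exact key 2
    · rw [S.gen_of_not_inMax h h']; exact key 1
  · rw [h] at key
    rw [S.gen_of_true h]; exact key 1

/-- A section of a smooth Weierstrass fibration is a complete nonsingular curve, isomorphic to the
base. -/
noncomputable def completeCurve :
    CompleteCurve (fieldEquiv R (false, false)) (placeSystem (k := k)) σ where
  ev := S.ev
  ev_eq_zero_iff := S.ev_eq_zero_iff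
  pt := S.pt ha hb
  specializes := S.specializes_pt ha hb
  exists_pt_eq _ h hne := S.exists_pt_eq ha hb h hne
  ev_mem c _ hf := S.ev_mem (S.liesOver_pt ha hb c) (S.specializes_pt ha hb c) hf
  exists_ev_eq c r hr := ⟨W.base r, (S.liesOver_pt ha hb c).base_mem hr, S.ev_base r⟩
  gen := S.gen
  gen_ne_zero := S.gen_ne_zero
  gen_mem := S.gen_mem hJ ha hb
  van_gen := S.van_gen
  div_gen_mem c _ hf hv := S.div_gen_mem hJ ha hb c hf hv

end SectionData
end WeierstrassModel
end
end EllipticSurface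

/-! ### Self-intersection of a section and intersection with a fibre -/

namespace EllipticSurface
open AlgebraicGeometry CategoryTheory Polynomial Glue DivisorTheory RatFunc

section
variable {k K : Type} [Field k] [Field K] [Algebra k K] {R : Bool × Bool → Subalgebra k K}
  {a b : k[X]} {W : WeierstrassModel R a b} [IsGluable R] [IsFractionRing (R (false, false)) K]

namespace WeierstrassModel
namespace SectionData
variable {σ : PrimeDivisor (glued R)} (S : W.SectionData σ)

theorem two_mul_yAt_ne_zero [CharZero k] {ε : Bool} (h : S.wAt ε ≠ 0) : 2 * S.yAt ε ≠ 0 := by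
  have h2 := C_ne_zero (two_ne_zero (α := k))
  rw [map_ofNat] at h2
  exact mul_ne_zero h2 (inv_ne_zero h)

/-- The slope of the tangent to the generic fibre at the point given by a section. -/
theorem van_slope [CharZero k] {ε : Bool} (h : S.wAt ε ≠ 0) :
    W.VanAt σ.1 ((W.yc ε - W.base (S.yAt ε)) / (W.xc ε - W.base (S.xAt ε)) -
      W.base ((3 * S.xAt ε ^ 2 + alpha a ε) / (2 * S.yAt ε))) := by
  have hx0 := W.xc_sub_ne_zero ε (S.xAt ε)
  have hd := S.two_mul_yAt_ne_zero h
  have hd' : W.base (2 * S.yAt ε) ≠ 0 := (_root_.map_ne_zero _).mpr hd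
  have hc := W.inChartAt_false_iff.mp (S.inChartAt_false h)
  have hb := S.horizontal.mem
  have vx := S.van_xc_sub h
  have vy := S.van_yc_sub h
  have e1 : W.yc ε + W.base (S.yAt ε) - W.base (2 * S.yAt ε) = W.yc ε - W.base (S.yAt ε) := by
    rw [map_mul, map_ofNat]
    ring
  have hD : ¬ W.VanAt σ.1 (W.yc ε + W.base (S.yAt ε)) := fun h5 =>
    hd (S.horizontal.van_iff.mp ((van_sub_congr (e1 ▸ vy)).mp h5))
  have hDm : W.yc ε + W.base (S.yAt ε) ∈ W.stalkAt σ.1 := add_mem hc.2.2 (hb _)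
  have hD0 := ne_zero_of_not_van hD
  have e := S.sub_mul_add h
  have e2 : (W.yc ε - W.base (S.yAt ε)) / (W.xc ε - W.base (S.xAt ε)) -
      W.base ((3 * S.xAt ε ^ 2 + alpha a ε) / (2 * S.yAt ε)) =
      ((W.xc ε - W.base (S.xAt ε)) * (W.xc ε + 2 * W.base (S.xAt ε)) * W.base (2 * S.yAt ε) -
        W.base (3 * S.xAt ε ^ 2 + alpha a ε) * (W.yc ε - W.base (S.yAt ε))) *
        ((W.yc ε + W.base (S.yAt ε))⁻¹ * W.base (2 * S.yAt ε)⁻¹) := by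
    rw [map_div₀, map_inv₀, ← mul_inv, ← div_eq_mul_inv, div_sub_div _ _ hx0 hd',
      div_eq_div_iff (mul_ne_zero hx0 hd') (mul_ne_zero hD0 hd')]
    simp only [map_add, map_mul, map_pow, map_ofNat]
    linear_combination (2 * W.base (S.yAt ε)) ^ 2 * e
  rw [e2]
  exact (((vx.mul_right (add_mem hc.2.1 (mul_mem (natCast_mem _ 2) (hb _)))).mul_right
    (hb _)).sub (vy.mul_left (hb _))).mul_right
    (mul_mem (inv_mem_of_not_van hDm hD) (hb _))

open Classical in
/-- A rational function with a simple zero along a section. -/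
noncomputable def ell (ε : Bool) : K :=
  if S.w = 0 then W.uc ε else (W.xc ε - W.base (S.xAt ε)) / W.base (2 * S.yAt ε)

theorem wAt_ne_zero_iff {ε : Bool} : S.wAt ε ≠ 0 ↔ S.w ≠ 0 := by
  rw [wAt, ne_eq, div_eq_zero_iff, or_iff_left (pow_ne_zero 3 (scale_ne_zero ε))]

/-- Along the section `ell` represents, up to sign, the relative differential `dx / (2 y)`. As `x`
and `y` are multiplied by the second and third power of `scale`, one factor `scale` remains. Its
zero of order three at infinity is the source of the self-intersection number `-3`. -/
theorem ell_false (ε : Bool) : S.ell false = S.ell ε * W.base (scale ε) := by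
  by_cases h : S.w = 0
  · rw [ell, ell, if_pos h, if_pos h, W.uc_false ε, mul_comm]
  · rw [ell, ell, if_neg h, if_neg h]
    have hs := scale_ne_zero (k := k) ε
    have hs' := W.base_scale_ne_zero ε
    have h1 : (scale false : RatFunc k) = 1 := rfl
    have e1 : S.xAt ε = scale ε ^ 2 * S.xAt false := by
      rw [xAt, xAt, uAt, uAt, wAt, wAt, h1]
      field_simp
    have e2 : S.yAt ε = scale ε ^ 3 * S.yAt false := by
      rw [yAt, yAt, wAt, wAt, h1]
      field_simp
    have e3 : W.xc ε = W.base (scale ε) ^ 2 * W.xc false := by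
      rw [xc, xc, h1, map_one]
      ring
    rw [e1, e2, e3, mul_left_comm, map_mul _ (scale ε ^ 3), map_mul _ (scale ε ^ 2), map_pow,
      map_pow, ← mul_sub, div_mul_eq_mul_div, mul_right_comm, ← pow_succ]
    exact (mul_div_mul_left _ _ (pow_ne_zero 3 hs')).symm

theorem ell_ne_zero [CharZero k] (ε : Bool) : S.ell ε ≠ 0 := by
  by_cases h : S.w = 0
  · rw [ell, if_pos h]
    simpa using W.uc_sub_ne_zero ε 0
  · rw [ell, if_neg h]
    exact div_ne_zero (W.xc_sub_ne_zero _ _) ((_root_.map_ne_zero _).mpr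
      (S.two_mul_yAt_ne_zero (S.wAt_ne_zero_iff.mpr h)))

variable [∀ i, IsNoetherianRing (R i)] [CharZero k] [IsAlgClosed k] (hJ : JacobianCriterion a b) (ha : a.natDegree ≤ 12)
  (hb : b.natDegree ≤ 18)

include hJ ha hb in
-- The differential `dx / (2 y)` generates the relative differentials at every smooth point of a
-- fibre, so it compares with any local equation by a unit. This unit is `2 y`, or `3 x ^ 2 + α`, or
-- `-1` up to terms vanishing at `c`, according to the equation; for the zero section it is `1`.
theorem exists_van_gen_div_ell (c : Option k) : ∃ r ∈ (place c).ring, ¬ InMax c r ∧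
    W.VanAt σ.1 (S.gen c / S.ell (chartAt c) - W.base r) := by
  have hval := S.val_mem ha hb c
  by_cases h0 : S.w = 0
  · have hwz : S.wAt (chartAt c) = 0 := by rw [wAt, h0, zero_div]
    have huz : S.uAt (chartAt c) = 0 := by
      have h1 := S.wAt_eq (chartAt c)
      rw [hwz] at h1
      exact (pow_eq_zero_iff (n := 3) (by norm_num)).mp (by linear_combination -h1)
    have hδ : S.delta c = true := S.delta_eq_true.mpr (by rw [hwz]; exact inMax_zero)
    refine ⟨1, one_mem _, not_inMax_one, ?_⟩
    rw [ell, if_pos h0, S.gen_of_true hδ, huz, map_zero, sub_zero, div_self, map_one, sub_self]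
    · exact van_zero
    · simpa using W.uc_sub_ne_zero (chartAt c) 0
  have hw := S.wAt_ne_zero_iff (ε := chartAt c) |>.mpr h0
  have hd := S.two_mul_yAt_ne_zero hw
  have hd' : W.base (2 * S.yAt (chartAt c)) ≠ 0 := (_root_.map_ne_zero _).mpr hd
  have hx0 := W.xc_sub_ne_zero (chartAt c) (S.xAt (chartAt c))
  have hq := S.van_slope hw
  have hB := S.horizontal.mem
  have hy0 : S.yAt (chartAt c) ≠ 0 := inv_ne_zero hw
  rw [ell, if_neg h0]
  set ε := chartAt c with hε
  cases h : S.delta c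
  · rw [h] at hval
    have hx : S.xAt ε ∈ (place c).ring := hval 1
    have hy : S.yAt ε ∈ (place c).ring := hval 2
    by_cases h' : InMax c (2 * S.yAt ε)
    · have h3 := (not_inMax_or hJ ha hb c hx hy (S.yAt_sq hw)).resolve_left (not_not.mpr h')
      refine ⟨_, add_mem (mul_mem (natCast_mem _ 3) (pow_mem hx 2)) (alpha_mem ha c), h3, ?_⟩
      rw [S.gen_of_inMax h h']
      have e : (W.yc ε - W.base (S.yAt ε)) / ((W.xc ε - W.base (S.xAt ε)) /
          W.base (2 * S.yAt ε)) - W.base (3 * S.xAt ε ^ 2 + alpha a ε) =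
          ((W.yc ε - W.base (S.yAt ε)) / (W.xc ε - W.base (S.xAt ε)) -
          W.base ((3 * S.xAt ε ^ 2 + alpha a ε) / (2 * S.yAt ε))) * W.base (2 * S.yAt ε) := by
        rw [sub_mul, ← map_mul, div_mul_cancel₀ _ hd, div_div_eq_mul_div, div_mul_eq_mul_div]
      have h4 := hq.mul_right (hB (2 * S.yAt ε))
      rw [← e] at h4
      exact h4
    · refine ⟨_, mul_mem (natCast_mem _ 2) hy, h', ?_⟩
      have e : S.gen c / ((W.xc ε - W.base (S.xAt ε)) / W.base (2 * S.yAt ε)) =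
          W.base (2 * S.yAt ε) := by
        rw [S.gen_of_not_inMax h h', div_div_cancel₀ hx0]
      rw [show ((2 : ℕ) : RatFunc k) = 2 from rfl, e, sub_self]
      exact van_zero
  · rw [h] at hval
    have hu : S.uAt ε ∈ (place c).ring := hval 1
    have hwm := S.delta_eq_true.mp h
    set q := (3 * S.xAt ε ^ 2 + alpha a ε) / (2 * S.yAt ε) with hq_def
    set Q := (W.yc ε - W.base (S.yAt ε)) / (W.xc ε - W.base (S.xAt ε)) with hQ_def
    have hQm : Q ∈ W.stalkAt σ.1 := mem_of_van_sub hq (hB _)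
    -- The left side is the restriction of `(u - u₀) / ell`, with `q` the slope of the tangent. By
    -- the Weierstrass equation it is `-1` plus terms divisible by `w`, and `w` vanishes at `c`.
    have hr : 2 * (S.yAt ε - S.xAt ε * q) * S.wAt ε = -(1 - (2 * alpha a ε * S.uAt ε * S.wAt ε +
        3 * beta b ε * S.wAt ε ^ 2)) := by
      have e := S.yAt_sq hw
      have e1 : S.uAt ε = S.xAt ε / S.yAt ε := by rw [xAt, yAt]; field_simp
      have e2 : S.wAt ε = 1 / S.yAt ε := by rw [yAt]; field_simp
      have e3 : (2 : RatFunc k) ≠ 0 := left_ne_zero_of_mul hd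
      rw [e1, e2, hq_def]
      field_simp
      linear_combination 3 * e
    have hE : InMax c (2 * alpha a ε * S.uAt ε * S.wAt ε + 3 * beta b ε * S.wAt ε ^ 2) := by
      refine (hwm.mul_left (mul_mem (mul_mem (natCast_mem _ 2) (alpha_mem ha c)) hu)).add ?_
      rw [pow_two]
      exact (hwm.mul_left hwm.mem).mul_left (mul_mem (natCast_mem _ 3) (beta_mem hb c))
    refine ⟨2 * (S.yAt ε - S.xAt ε * q) * S.wAt ε, ?_, ?_, ?_⟩
    · rw [hr]
      exact neg_mem (sub_mem (one_mem _) hE.mem)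
    · rw [hr]
      intro h5
      refine not_inMax_one (c := c) ?_
      simpa using hE.add h5.neg
    · have hY0 := W.yc_ne_zero ε
      have hby0 : W.base (S.yAt ε) ≠ 0 := (_root_.map_ne_zero _).mpr hy0
      have e1 : S.uAt ε = S.xAt ε / S.yAt ε := by rw [xAt, yAt]; field_simp
      have e : S.gen c / ((W.xc ε - W.base (S.xAt ε)) / W.base (2 * S.yAt ε)) -
          W.base (2 * (S.yAt ε - S.xAt ε * q) * S.wAt ε) =
          2 * (W.base (S.yAt ε) - W.base (S.xAt ε) * Q) * (W.wc ε - W.base (S.wAt ε)) -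
          2 * W.base (S.xAt ε) * (Q - W.base q) * W.base (S.wAt ε) := by
        have e4 : S.gen c / ((W.xc ε - W.base (S.xAt ε)) / W.base (2 * S.yAt ε)) =
            2 * (W.base (S.yAt ε) - W.base (S.xAt ε) * Q) * W.wc ε := by
          have hg : S.gen c = W.uc ε - W.base (S.uAt ε) := S.gen_of_true h
          rw [hg, e1, hQ_def, uc, wc, map_div₀, map_mul, map_ofNat]
          field_simp
          ring
        rw [e4]
        simp only [map_mul, map_sub, map_ofNat]
        ring
      have h2 : (2 : K) ∈ W.stalkAt σ.1 := natCast_mem _ 2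
      have h4 := ((S.van_wc_sub ε).mul_left (mul_mem h2
        (sub_mem (hB (S.yAt ε)) (mul_mem (hB (S.xAt ε)) hQm)))).sub
        ((hq.mul_left (mul_mem h2 (hB (S.xAt ε)))).mul_right (hB (S.wAt ε)))
      rw [← e] at h4
      exact h4

include S hJ ha hb

/-- The self-intersection number of a section. -/
theorem interNumber_self : interNumber (Finsupp.single σ 1) σ = -3 := by
  set T := S.completeCurve hJ ha hb with hT
  -- The divisor `σ` is moved by the function `1 / ell` of the affine chart of the base. Near the
  -- point over `c` the moved divisor is the divisor of `gen / ell`, which restricts to a unit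
  -- divided by `scale`; the only contribution is `-3`, at infinity.
  have key : ∀ c, ∃ r : RatFunc k, r ≠ 0 ∧ (place c).v r = - (place c).v (scale (chartAt c)) ∧
      W.VanAt σ.1 (S.gen c / S.ell false - W.base r) := by
    intro c
    obtain ⟨r, hr, hr', hv⟩ := S.exists_van_gen_div_ell hJ ha hb c
    obtain ⟨hr0, hrv⟩ := place_eq_zero hr hr'
    have hs := scale_ne_zero (k := k) (chartAt c)
    refine ⟨r / scale (chartAt c), div_ne_zero hr0 hs, ?_, ?_⟩
    · rw [DiscPlace.map_div _ hr0 hs, hrv, zero_sub]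
    · have h1 := hv.mul_right (S.horizontal.mem (scale (chartAt c))⁻¹)
      rw [S.ell_false (chartAt c), ← div_div, div_eq_mul_inv r, map_mul,
        div_eq_mul_inv _ (W.base _), ← map_inv₀, ← sub_mul]
      exact h1
  choose r hr0 hrv hr using key
  have hm : ∀ c, S.gen c / S.ell false ∈ W.stalkAt σ.1 := fun c =>
    mem_of_van_sub (hr c) (S.horizontal.mem _)
  have hv : ∀ c, ¬ W.VanAt σ.1 (S.gen c / S.ell false) := fun c h =>
    hr0 c (S.horizontal.van_iff.mp ((van_sub_congr (hr c)).mp h))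
  have hℓ := S.ell_ne_zero false
  have hD : ∀ c (C : PrimeDivisor (glued R)), C.1 ⤳ T.pt c →
      (Finsupp.single σ 1 : WeilDivisor (glued R)) C +
        ordAt (fieldEquiv R (false, false)) C (S.ell false)⁻¹ =
      ordAt (fieldEquiv R (false, false)) C (S.gen c / S.ell false) := by
    intro c C hC
    rw [ordAt_inv, ordAt_div (S.gen_ne_zero c) hℓ, sub_eq_add_neg]
    congr 1
    by_cases h : C = σ
    · rw [h, Finsupp.single_eq_same]
      exact (T.ordAt_gen c).symm
    · rw [Finsupp.single_eq_of_ne h]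
      exact (T.ordAt_gen_of_ne hC h).symm
  rw [T.interNumber_eq_finsum (inv_ne_zero hℓ) ?_ _ hm hv hD]
  · have e : ∀ c, ((placeSystem (k := k)).place c).v (T.ev ⟨_, hm c⟩) =
        - (place c).v (scale (chartAt c)) := by
      intro c
      rw [← hrv c]
      exact congrArg (place c).v (S.ev_eq (hm c) (hr c))
    simp only [e]
    rw [finsum_eq_single _ (none : Option k), place_scale]
    rintro (_ | c) hc
    · exact absurd rfl hc
    · rw [place_scale]; simp
  · rw [hD none σ (S.specializes_pt ha hb none)]
    exact ordAt_eq_zero (hm none) (hv none)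

/-- The intersection number of a fibre and a section. -/
theorem interNumber_fiber :
    interNumber (zerosOf (fieldEquiv R (false, false) (W.base RatFunc.X))) σ = 1 := by
  classical
  set T := S.completeCurve hJ ha hb with hT
  -- These are local equations of the fibre over `t = 0`: `t` over the affine line, and `1` over
  -- infinity, where `t` has only poles and these are discarded by `zerosOf`.
  let r : Option k → RatFunc k := fun c => match c with
    | some _ => RatFunc.X
    | none => 1
  have hX := RatFunc.X_ne_zero (K := k)
  have hr0 : ∀ c, r c ≠ 0 := by
    rintro (_ | c)
    · exact one_ne_zero
    · exact hX
  have hz : ∀ C, zerosOf (fieldEquiv R (false, false) (W.base RatFunc.X)) C =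
      max (ordAt (fieldEquiv R (false, false)) C (W.base RatFunc.X)) 0 := fun C => rfl
  have hD : ∀ c (C : PrimeDivisor (glued R)), C.1 ⤳ T.pt c →
      zerosOf (fieldEquiv R (false, false) (W.base RatFunc.X)) C +
        ordAt (fieldEquiv R (false, false)) C 1 =
      ordAt (fieldEquiv R (false, false)) C (W.base (r c)) := by
    intro c C hC
    have hl := S.liesOver_pt ha hb c
    rw [ordAt_one, add_zero, hz]
    cases c with
    | none =>
      change _ = ordAt _ C (W.base 1)
      rw [map_one, ordAt_one]
      refine max_eq_right ?_
      have h1 := stk_le hC hl.mem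
      have h2 := ordAt_nonneg h1
      rw [show (unif none : RatFunc k) = RatFunc.X⁻¹ from rfl, map_inv₀, ordAt_inv] at h2
      lia
    | some c =>
      refine max_eq_left (ordAt_nonneg (stk_le hC (hl.base_mem ?_)))
      exact baseCoord_mem (some c)
  rw [T.interNumber_eq_finsum one_ne_zero ?_ (fun c => W.base (r c))
    (fun c => S.horizontal.mem (r c)) (fun c => (S.horizontal _ (hr0 c)).2) hD]
  · have e : ∀ c, ((placeSystem (k := k)).place c).v (T.ev ⟨_, S.horizontal.mem (r c)⟩) =
        (place c).v (r c) := fun c => congrArg (place c).v (S.ev_base (r c))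
    simp only [e]
    rw [finsum_eq_single _ (some 0 : Option k)]
    · have := orderAt_X_sub_C (0 : k) 0
      rw [map_zero, sub_zero, if_pos rfl] at this
      exact this
    · rintro (_ | c) hc
      · exact DiscPlace.map_one _
      · have := orderAt_X_sub_C c (0 : k)
        rw [map_zero, sub_zero, if_neg (by rintro rfl; exact hc rfl)] at this
        exact this
  · rw [ordAt_one, add_zero, hz, ordAt_eq_zero (S.horizontal _ hX).1 (S.horizontal _ hX).2]
    rfl

end SectionData
end WeierstrassModel
end
end EllipticSurface

/-! ### The jacobian criterion from smoothness -/

namespace EllipticSurface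
open AlgebraicGeometry CategoryTheory Polynomial Glue DivisorTheory
open RatFunc hiding C X eval_C eval_X

section
variable {S T : Type} [CommRing S] [CommRing T]

/-- The affine Weierstrass curve `y² = x³ + A x + B`. -/
def shortCurve (A B : S) : WeierstrassCurve.Affine S := ⟨0, 0, 0, A, B⟩

namespace shortCurve
open WeierstrassCurve.Affine
variable {A B : S}

/-- The ring homomorphism given by a point of the curve with values in a ring. -/
noncomputable def lift (f : S →+* T) (x y : T) (h : y ^ 2 = x ^ 3 + f A * x + f B) :
    (shortCurve A B).CoordinateRing →+* T :=
  AdjoinRoot.lift (eval₂RingHom f x) y (by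
    simp [shortCurve, polynomial, eval₂_add, eval₂_sub, eval₂_mul, eval₂_pow]
    linear_combination h)

variable (f : S →+* T) {x y : T} (h : y ^ 2 = x ^ 3 + f A * x + f B)

theorem lift_mk_C (p : S[X]) : lift f x y h (CoordinateRing.mk _ (C p)) = p.eval₂ f x := by
  simp [lift]

theorem lift_mk_X : lift f x y h (CoordinateRing.mk _ X) = y := by
  simp [lift]

theorem lift_smul_add (p q : S[X]) :
    lift f x y h (p • 1 + q • CoordinateRing.mk _ X) = p.eval₂ f x + q.eval₂ f x * y := by
  rw [map_add, CoordinateRing.smul, CoordinateRing.smul, map_mul, map_mul, lift_mk_C, lift_mk_C,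
    lift_mk_X, map_one, mul_one]

theorem lift_injective (h0 : ∀ p q : S[X], p.eval₂ f x + q.eval₂ f x * y = 0 → p = 0 ∧ q = 0) :
    Function.Injective (lift f x y h) := by
  refine (injective_iff_map_eq_zero _).mpr fun r hr => ?_
  obtain ⟨p, q, rfl⟩ := CoordinateRing.exists_smul_basis_eq r
  rw [lift_smul_add] at hr
  obtain ⟨rfl, rfl⟩ := h0 p q hr
  simp

end shortCurve
end

section
variable {k K : Type} [Field k] [Field K] [Algebra k K] {R : Bool × Bool → Subalgebra k K}
  {a b : k[X]} (W : WeierstrassModel R a b)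

namespace WeierstrassModel
open WeierstrassCurve.Affine

/-- The inclusion of the polynomials in the coordinate of a chart of the base. -/
noncomputable def basePoly (ε : Bool) : k[X] →+* K :=
  W.base.comp (aeval (R := k) (baseCoord (k := k) ε)).toRingHom

theorem basePoly_C (ε : Bool) (u : k) : W.basePoly ε (C u) = algebraMap k K u := by
  rw [← W.base_C]
  exact congrArg W.base (aeval_C _ _)

theorem basePoly_X (ε : Bool) : W.basePoly ε X = W.base (baseCoord ε) :=
  congrArg W.base (aeval_X _)

theorem aeval_baseCoord_injective (ε : Bool) :
    Function.Injective (aeval (R := k) (baseCoord (k := k) ε)) := by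
  have h : Function.Injective (aeval (R := k) (RatFunc.X : RatFunc k)) := by
    intro p q hpq
    rw [← RatFunc.algebraMap_X, aeval_algebraMap_apply, aeval_algebraMap_apply,
      aeval_X_left_apply, aeval_X_left_apply] at hpq
    exact RatFunc.algebraMap_injective k hpq
  cases ε
  · exact h
  · exact (transcendental_iff_injective).mp
      (fun h1 => transcendental_iff_injective.mpr h (IsAlgebraic.inv_iff.mp h1))

/-- Rescaling `x` and `y` by powers of `scale` reduces the claim to the independence over `k(t)`. It
says that the chart `Z ≠ 0` satisfies no relation besides the Weierstrass equation, so that its ring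
is the coordinate ring of a Weierstrass curve over `k[t]`. -/
theorem indep_chart (ε : Bool) (p q : k[X][X])
    (h : p.eval₂ (W.basePoly ε) (W.xc ε) + q.eval₂ (W.basePoly ε) (W.xc ε) * W.yc ε = 0) :
    p = 0 ∧ q = 0 := by
  set s : RatFunc k := scale ε with hs
  have hs0 : s ≠ 0 := scale_ne_zero ε
  set f := (aeval (R := k) (baseCoord (k := k) ε)).toRingHom with hf
  have hfi : Function.Injective f := aeval_baseCoord_injective ε
  have e : ∀ p : k[X][X], p.eval₂ (W.basePoly ε) (W.xc ε) =
      ((p.map f).comp (C (s ^ 2) * X)).eval₂ W.base W.x := by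
    intro p
    rw [eval₂_comp, eval₂_mul, eval₂_C, eval₂_X, map_pow, eval₂_map]
    rfl
  have h0 : ∀ p : k[X][X], (p.map f).comp (C (s ^ 2) * X) = 0 → p = 0 := by
    intro p hp
    refine (Polynomial.map_eq_zero_iff hfi).mp ?_
    rcases comp_eq_zero_iff.mp hp with h | ⟨-, h⟩
    · exact h
    · exfalso
      have h1 := congrArg (fun q => q.coeff 1) h
      rw [coeff_C_mul_X, coeff_C, if_pos rfl, if_neg one_ne_zero] at h1
      exact pow_ne_zero 2 hs0 h1
  rw [e, e] at h
  obtain ⟨h1, h2⟩ := W.indep ((p.map f).comp (C (s ^ 2) * X))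
    (C (s ^ 3) * (q.map f).comp (C (s ^ 2) * X)) (by
      rw [← h, eval₂_mul, eval₂_C, map_pow W.base s 3, yc]; ring)
  exact ⟨h0 p h1, h0 q ((mul_eq_zero.mp h2).resolve_left (by simpa using hs0))⟩

variable (ha : a.natDegree ≤ 12) (hb : b.natDegree ≤ 18)

/-- The generic fibre, over a chart of the base. -/
noncomputable abbrev chartCurve (a b : k[X]) (ε : Bool) : WeierstrassCurve.Affine k[X] :=
  shortCurve (chartPoly 12 a ε) (chartPoly 18 b ε)

include ha hb in
theorem yc_sq_basePoly (ε : Bool) : W.yc ε ^ 2 = W.xc ε ^ 3 +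
    W.basePoly ε (chartPoly 12 a ε) * W.xc ε + W.basePoly ε (chartPoly 18 b ε) := by
  rw [W.yc_sq, ← aeval_alpha ha, ← aeval_beta hb]
  rfl

/-- The coordinate ring of a chart in terms of the Weierstrass equation. -/
noncomputable def chartHom (ε : Bool) : (chartCurve a b ε).CoordinateRing →+* K :=
  shortCurve.lift (W.basePoly ε) (W.xc ε) (W.yc ε) (W.yc_sq_basePoly ha hb ε)

theorem chartHom_injective (ε : Bool) : Function.Injective (W.chartHom ha hb ε) :=
  shortCurve.lift_injective _ _ (W.indep_chart ε)

theorem range_chartHom (ε : Bool) : (W.chartHom ha hb ε).range = (R (ε, false)).toSubring := by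
  apply le_antisymm
  · rintro _ ⟨r, rfl⟩
    obtain ⟨p, q, rfl⟩ := CoordinateRing.exists_smul_basis_eq r
    have h0 := W.coord_mem ε false
    have hp : ∀ p : k[X], W.basePoly ε p ∈ R (ε, false) := by
      intro p
      induction p using Polynomial.induction_on' with
      | add p q hp hq => rw [map_add]; exact add_mem hp hq
      | monomial n u =>
        rw [← C_mul_X_pow_eq_monomial, map_mul, map_pow, W.basePoly_C, W.basePoly_X]
        exact mul_mem ((R (ε, false)).algebraMap_mem u) (pow_mem (h0 0) n)
    have hq : ∀ p : k[X][X], p.eval₂ (W.basePoly ε) (W.xc ε) ∈ R (ε, false) := by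
      intro p
      rw [eval₂_eq_sum_range]
      exact sum_mem fun n _ => mul_mem (hp _) (pow_mem (h0 1) n)
    rw [chartHom, shortCurve.lift_smul_add]
    exact add_mem (hq p) (mul_mem (hq q) (h0 2))
  · let A : Subalgebra k K :=
      { (W.chartHom ha hb ε).range with
        algebraMap_mem' := fun u => ⟨CoordinateRing.mk _ (C (C (C u))), by
          rw [chartHom, shortCurve.lift_mk_C, eval₂_C, W.basePoly_C]⟩ }
    have h1 : R (ε, false) ≤ A := by
      rw [W.chart_eq]
      refine Algebra.adjoin_le ?_
      rintro _ ⟨j, rfl⟩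
      fin_cases j
      · exact ⟨CoordinateRing.mk _ (C (C X)), by
          rw [chartHom, shortCurve.lift_mk_C, eval₂_C, W.basePoly_X]; rfl⟩
      · exact ⟨CoordinateRing.mk _ (C X), by
          rw [chartHom, shortCurve.lift_mk_C, eval₂_X]; rfl⟩
      · exact ⟨CoordinateRing.mk _ X, shortCurve.lift_mk_X _ _⟩
    exact h1

/-- The isomorphism of a chart with the coordinate ring of a Weierstrass curve. -/
noncomputable def chartEquiv (ε : Bool) : (chartCurve a b ε).CoordinateRing ≃+* R (ε, false) :=
  (RingEquiv.ofBijective (W.chartHom ha hb ε).rangeRestrict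
    ⟨fun _ _ h => W.chartHom_injective ha hb ε (congrArg Subtype.val h),
      RingHom.rangeRestrict_surjective _⟩).trans
    (RingEquiv.subringCongr (W.range_chartHom ha hb ε))

variable [IsGluable R]

theorem _root_.Glue.chartMap_gluedToSpec (i : Bool × Bool) :
    chartMap R i ≫ gluedToSpec R =
      Spec.map (CommRingCat.ofHom (algebraMap k (R i))) := by
  rw [chartMap, Category.assoc]
  have h : interMap R {i} (Finset.singleton_nonempty i) ≫ gluedToSpec R =
      Spec.map (CommRingCat.ofHom (algebraMap k (interRing R {i}))) :=
    Limits.colimit.ι_desc _ _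
  rw [h, specIncl, ← Spec.map_comp, ← CommRingCat.ofHom_comp]
  rfl

theorem _root_.Glue.smooth_chart (h : AlgebraicGeometry.Smooth (gluedToSpec R))
    (i : Bool × Bool) : Algebra.Smooth k (R i) := by
  have h1 : AlgebraicGeometry.Smooth (chartMap R i ≫ gluedToSpec R) := inferInstance
  rw [chartMap_gluedToSpec, HasRingHomProperty.Spec_iff (P := @AlgebraicGeometry.Smooth)] at h1
  exact RingHom.smooth_algebraMap.mp h1

include W ha hb in
/-- A smooth Weierstrass fibration satisfies the jacobian criterion. -/
theorem jacobianCriterion_of_smooth (h : AlgebraicGeometry.Smooth (gluedToSpec R)) :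
    JacobianCriterion a b := by
  intro ε c ξ η h1 h2 h3 h4
  have := smooth_chart h (ε, false)
  set α := chartPoly 12 a ε with hα
  set β := chartPoly 18 b ε with hβ
  -- Suppose that all partial derivatives vanish at `(c, ξ, η)`. Then `(c, ξ, η + e)` satisfies the
  -- equation modulo `e ^ 2`, and formal smoothness lifts it modulo `e ^ 3`. The corrections are
  -- multiples of `e ^ 2` and enter the equation only through vanishing derivatives, so what
  -- survives is the square `e ^ 2` of the increment of `y`, which is not zero.
  let B := k[X] ⧸ Ideal.span {(X : k[X]) ^ 3}
  let e : B := Ideal.Quotient.mk _ X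
  have he3 : e ^ 3 = 0 := Ideal.Quotient.eq_zero_iff_mem.mpr (Ideal.mem_span_singleton_self _)
  have he2 : e ^ 2 ≠ 0 := by
    intro h5
    have h6 : (X : k[X]) ^ 2 ∈ Ideal.span {(X : k[X]) ^ 3} := Ideal.Quotient.eq_zero_iff_mem.mp h5
    rw [Ideal.mem_span_singleton, X_pow_dvd_iff] at h6
    simpa using h6 2 (by norm_num)
  let I : Ideal B := Ideal.span {e ^ 2}
  have hI : ∀ i ∈ I, ∃ j, i = e ^ 2 * j := fun i hi => by
    obtain ⟨j, hj⟩ := Ideal.mem_span_singleton.mp hi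
    exact ⟨j, hj⟩
  have hIn : IsNilpotent I := ⟨2, by
    refine (Ideal.span_singleton_pow _ _).trans (Ideal.span_singleton_eq_bot.mpr ?_)
    linear_combination e * he3⟩
  let q : B →+* B ⧸ I := Ideal.Quotient.mk I
  have hqe : q e ^ 2 = 0 := by
    rw [← map_pow]
    exact Ideal.Quotient.eq_zero_iff_mem.mpr (Ideal.mem_span_singleton_self _)
  let m : k →+* B ⧸ I := algebraMap k (B ⧸ I)
  have h1' := congrArg m h1
  have h4' := congrArg m h4
  simp only [map_add, map_mul, map_pow, map_ofNat, map_zero] at h1' h4'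
  let φ := shortCurve.lift (A := α) (B := β) (m.comp (evalRingHom c)) (m ξ) (m η + q e) (by
    change _ = _ + m (α.eval c) * _ + m (β.eval c)
    linear_combination h1' + hqe + q e * h4')
  let E := W.chartEquiv ha hb ε
  have hE : ∀ r, ((E r : R (ε, false)) : K) = W.chartHom ha hb ε r := fun r => rfl
  have hEC : ∀ u : k, E.symm (algebraMap k _ u) = CoordinateRing.mk _ (C (C (C u))) := by
    intro u
    rw [RingEquiv.symm_apply_eq]
    refine Subtype.ext ?_
    rw [hE, chartHom, shortCurve.lift_mk_C, eval₂_C, W.basePoly_C]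
    rfl
  let g : R (ε, false) →ₐ[k] B ⧸ I :=
    { φ.comp E.symm.toRingHom with
      commutes' := fun u => by
        change φ (E.symm (algebraMap k _ u)) = _
        rw [hEC]
        simp only [φ]
        rw [shortCurve.lift_mk_C, eval₂_C]
        change m ((C u).eval c) = _
        rw [eval_C] }
  let G := Algebra.FormallySmooth.lift I hIn g
  have hG : ∀ r, q (G (E r)) = φ r := by
    intro r
    have h5 := Algebra.FormallySmooth.mk_lift I hIn g (E r)
    refine h5.trans ?_
    change φ (E.symm (E r)) = _
    rw [E.symm_apply_apply]
  have hlift : ∀ r v, φ r = q v → ∃ j, G (E r) = v + e ^ 2 * j := by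
    intro r v hr
    have h5 : G (E r) - v ∈ I := Ideal.Quotient.eq.mp ((hG r).trans hr)
    obtain ⟨j, hj⟩ := hI _ h5
    exact ⟨j, by rw [← hj]; ring⟩
  let n : k →+* B := algebraMap k B
  have hqn : ∀ u, q (n u) = m u := fun u => rfl
  obtain ⟨t, ht⟩ := hlift (CoordinateRing.mk _ (C (C X))) (n c) (by
    simp only [φ]
    rw [shortCurve.lift_mk_C, eval₂_C]
    change m (X.eval c) = _
    rw [eval_X, hqn])
  obtain ⟨x, hx⟩ := hlift (CoordinateRing.mk _ (C X)) (n ξ) (by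
    simp only [φ]
    rw [shortCurve.lift_mk_C, eval₂_X, hqn])
  obtain ⟨y, hy⟩ := hlift (CoordinateRing.mk _ X) (n η + e) (by
    simp only [φ]
    rw [shortCurve.lift_mk_X, map_add, hqn])
  let Φ : (chartCurve a b ε).CoordinateRing →+* B := G.toRingHom.comp E.toRingHom
  have hΦ : ∀ p : k[X], Φ (CoordinateRing.mk _ (C (C p))) = aeval (n c + e ^ 2 * t) p := by
    intro p
    induction p using Polynomial.induction_on' with
    | add p q hp hq => simp only [map_add, hp, hq]
    | monomial i u =>
      have h5 : Φ (CoordinateRing.mk _ (C (C (C u)))) = n u := by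
        change G (E _) = _
        rw [← hEC, E.apply_symm_apply]
        exact G.commutes u
      rw [← C_mul_X_pow_eq_monomial]
      simp only [map_mul, map_pow]
      rw [h5, show Φ (CoordinateRing.mk _ (C (C X))) = n c + e ^ 2 * t from ht, aeval_X, aeval_C]
  have hsq : (e ^ 2 * t) ^ 2 = 0 := by linear_combination e * t ^ 2 * he3
  have hev : ∀ p : k[X], aeval (n c + e ^ 2 * t) p =
      n (p.eval c) + n (p.derivative.eval c) * (e ^ 2 * t) := by
    intro p
    rw [aeval_add_of_sq_eq_zero _ _ _ hsq]
    simp only [n, aeval_algebraMap_apply, coe_aeval_eq_eval]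
  have hrel : Φ (CoordinateRing.mk _ X) ^ 2 = Φ (CoordinateRing.mk _ (C X)) ^ 3 +
      Φ (CoordinateRing.mk _ (C (C α))) * Φ (CoordinateRing.mk _ (C X)) +
      Φ (CoordinateRing.mk _ (C (C β))) := by
    simp only [← map_pow, ← map_mul, ← map_add]
    congr 1
    refine AdjoinRoot.mk_eq_mk.mpr ⟨1, ?_⟩
    simp only [shortCurve, WeierstrassCurve.Affine.polynomial]
    simp
    ring
  have hX : Φ (CoordinateRing.mk _ (C X)) = n ξ + e ^ 2 * x := hx
  have hY : Φ (CoordinateRing.mk _ X) = n η + e + e ^ 2 * y := hy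
  rw [hΦ, hΦ, hev, hev, hX, hY] at hrel
  have h1n := congrArg n h1
  have h2n := congrArg n h2
  have h3n := congrArg n h3
  have h4n := congrArg n h4
  simp only [map_add, map_mul, map_pow, map_ofNat, map_zero] at h1n h2n h3n h4n
  refine he2 ?_
  linear_combination hrel - h1n - h4n * (e + e ^ 2 * y) + h3n * e ^ 2 * x + h2n * e ^ 2 * t +
    he3 * (-2 * y - e * y ^ 2 + 3 * n ξ * e * x ^ 2 + e ^ 3 * x ^ 3 +
      n (α.derivative.eval c) * e * t * x)

end WeierstrassModel
end
end EllipticSurface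

/-! ### Curves attached to the points of the generic fibre -/

namespace EllipticSurface
open AlgebraicGeometry CategoryTheory Polynomial Glue DivisorTheory
open RatFunc hiding C X eval_C eval_X

section
variable {k K : Type} [Field k] [Field K] [Algebra k K] {R : Bool × Bool → Subalgebra k K}
  {a b : k[X]} (W : WeierstrassModel R a b)

namespace WeierstrassModel

theorem scale_false : (scale false : RatFunc k) = 1 := rfl

theorem xc_false : W.xc false = W.x := by rw [xc, scale_false, map_one, one_pow, one_mul]

theorem yc_false : W.yc false = W.y := by rw [yc, scale_false, map_one, one_pow, one_mul]

theorem uc_ne_zero (ε : Bool) : W.uc ε ≠ 0 := by simpa using W.uc_sub_ne_zero ε 0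

theorem sq_of_equation {x y : RatFunc k} (h : (genericFiber a b).Equation x y) :
    y ^ 2 = x ^ 3 + algebraMap k[X] (RatFunc k) a * x + algebraMap k[X] (RatFunc k) b := by
  have h1 := (WeierstrassCurve.Affine.equation_iff _ _).mp h
  simpa [genericFiber] using h1

variable [IsGluable R] [IsFractionRing (R (false, false)) K]

/-- The curve `C` is the closure in the surface of the point `P` of the generic fibre. -/
def IsCurveOf (P : (genericFiber a b).Point) (C : PrimeDivisor (glued R)) : Prop :=
  W.Horizontal C.1 ∧
  match P with
  | .zero => W.VanAt C.1 (W.uc false) ∧ W.VanAt C.1 (W.wc false)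
  | .some x₀ y₀ _ => W.VanAt C.1 (W.xc false - W.base x₀) ∧ W.VanAt C.1 (W.yc false - W.base y₀)

variable {W} {P : (genericFiber a b).Point} {C C' : PrimeDivisor (glued R)}

/-- The section with values `0`, the zero section. -/
noncomputable def IsCurveOf.zeroSection (h : W.IsCurveOf 0 C) : W.SectionData C where
  u := 0
  w := 0
  horizontal := h.1
  van_u := by rw [map_zero, sub_zero]; exact h.2.1
  van_w := by rw [map_zero, sub_zero]; exact h.2.2

theorem IsCurveOf.inChartAt {x y : RatFunc k} {hP} (h : W.IsCurveOf (.some x y hP) C) :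
    W.InChartAt C.1 (false, false) := by
  refine W.inChartAt_false_iff.mpr ⟨h.1.mem _, ?_, ?_⟩
  · simpa using add_mem h.2.1.mem (h.1.mem x)
  · simpa using add_mem h.2.2.mem (h.1.mem y)

variable [IsAlgClosed k] (hJ : JacobianCriterion a b) (ha : a.natDegree ≤ 12)
  (hb : b.natDegree ≤ 18)

include hJ ha hb in
theorem y_ne_zero_of_nonsingular {x y : RatFunc k} (h : (genericFiber a b).Nonsingular x y) :
    y ≠ 0 := ne_zero_of_equation hJ ha hb (sq_of_equation h.1)

include hJ ha hb in
theorem IsCurveOf.not_van_yc {x y : RatFunc k} {hP} (h : W.IsCurveOf (.some x y hP) C) :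
    ¬ W.VanAt C.1 (W.yc false) := fun hv =>
  y_ne_zero_of_nonsingular hJ ha hb hP (h.1.van_iff.mp ((van_sub_congr h.2.2).mp hv))

include hJ ha hb in
/-- A section different from the zero section. -/
noncomputable def IsCurveOf.affineSection {x y : RatFunc k} {hP}
    (h : W.IsCurveOf (.some x y hP) C) : W.SectionData C where
  u := x / y
  w := y⁻¹
  horizontal := h.1
  van_u := by
    have hy := y_ne_zero_of_nonsingular hJ ha hb hP
    have hy' : W.base y ≠ 0 := (_root_.map_ne_zero _).mpr hy
    have h0 := W.yc_ne_zero false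
    have e : W.uc false - W.base (x / y) = ((W.xc false - W.base x) * W.base y -
        W.base x * (W.yc false - W.base y)) * ((W.yc false)⁻¹ * W.base y⁻¹) := by
      rw [uc, map_div₀, map_inv₀]
      field_simp
      ring
    rw [e]
    refine ((h.2.1.mul_right (h.1.mem y)).sub (h.2.2.mul_left (h.1.mem x))).mul_right
      (mul_mem (inv_mem_of_not_van ?_ (h.not_van_yc hJ ha hb)) (h.1.mem _))
    exact (W.inChartAt_false_iff.mp h.inChartAt).2.2
  van_w := by
    have hy := y_ne_zero_of_nonsingular hJ ha hb hP
    have hy' : W.base y ≠ 0 := (_root_.map_ne_zero _).mpr hy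
    have h0 := W.yc_ne_zero false
    have e : W.wc false - W.base y⁻¹ =
        -(W.yc false - W.base y) * ((W.yc false)⁻¹ * W.base y⁻¹) := by
      rw [wc, map_inv₀]
      field_simp
      ring
    rw [e]
    refine h.2.2.neg.mul_right
      (mul_mem (inv_mem_of_not_van ?_ (h.not_van_yc hJ ha hb)) (h.1.mem _))
    exact (W.inChartAt_false_iff.mp h.inChartAt).2.2

include hJ ha hb in
theorem IsCurveOf.exists_sectionData (h : W.IsCurveOf P C) : Nonempty (W.SectionData C) := by
  cases P with
  | zero => exact ⟨IsCurveOf.zeroSection h⟩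
  | some x y hP => exact ⟨IsCurveOf.affineSection hJ ha hb h⟩

/-- The chart `Y ≠ 0` contains the generic point of every section. There the values of the
coordinates determine the values of all functions, hence which of them vanish. -/
theorem SectionData.eq_of_eq (S : W.SectionData C) (S' : W.SectionData C') (hu : S.u = S'.u)
    (hw : S.w = S'.w) : C = C' := by
  refine Subtype.ext ((S'.inChartAt_true false).ext (S.inChartAt_true false) fun f hf => ?_)
  have key : ∃ r, W.VanAt C.1 (f - W.base r) ∧ W.VanAt C'.1 (f - W.base r) := by
    rw [W.chart_eq] at hf
    induction hf using Algebra.adjoin_induction with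
    | mem f hf =>
      obtain ⟨j, rfl⟩ := hf
      fin_cases j
      · exact ⟨baseCoord false, W.van_coord_zero _ false true, W.van_coord_zero _ false true⟩
      · exact ⟨S.u, S.van_u, hu ▸ S'.van_u⟩
      · exact ⟨S.w, S.van_w, hw ▸ S'.van_w⟩
    | algebraMap u =>
      refine ⟨RatFunc.C u, ?_, ?_⟩ <;> rw [W.base_C, sub_self] <;> exact van_zero
    | add f g _ _ hf hg =>
      obtain ⟨r, hr, hr'⟩ := hf
      obtain ⟨s, hs, hs'⟩ := hg
      refine ⟨r + s, ?_, ?_⟩ <;> rw [map_add, add_sub_add_comm]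
      exacts [hr.add hs, hr'.add hs']
    | mul f g _ _ hf hg =>
      obtain ⟨r, hr, hr'⟩ := hf
      obtain ⟨s, hs, hs'⟩ := hg
      refine ⟨r * s, ?_, ?_⟩ <;> rw [map_mul, show f * g - W.base r * W.base s =
        (f - W.base r) * (g - W.base s + W.base s) + W.base r * (g - W.base s) by ring]
      · have hB := S.horizontal.mem
        exact (hr.mul_right (add_mem hs.mem (hB s))).add (hs.mul_left (hB r))
      · have hB := S'.horizontal.mem
        exact (hr'.mul_right (add_mem hs'.mem (hB s))).add (hs'.mul_left (hB r))
  obtain ⟨r, hr, hr'⟩ := key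
  exact ((van_sub_congr hr).trans S.horizontal.van_iff).trans
    ((van_sub_congr hr').trans S'.horizontal.van_iff).symm

include hJ ha hb in
theorem IsCurveOf.unique (h : W.IsCurveOf P C) (h' : W.IsCurveOf P C') : C = C' := by
  cases P with
  | zero => exact (IsCurveOf.zeroSection h).eq_of_eq (IsCurveOf.zeroSection h') rfl rfl
  | some x y hP =>
    exact (IsCurveOf.affineSection hJ ha hb h).eq_of_eq (IsCurveOf.affineSection hJ ha hb h')
      rfl rfl

theorem horizontal_of_ordAt [∀ i, IsNoetherianRing (R i)]
    (h : ∀ r : RatFunc k, r ≠ 0 → ordAt (fieldEquiv R (false, false)) C (W.base r) = 0) :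
    W.Horizontal C.1 := by
  refine (W.horizontal_or_liesOver C.1).resolve_right ?_
  rintro ⟨c, hc⟩
  have h0 : W.base (unif c) ≠ 0 := (_root_.map_ne_zero _).mpr (unif_ne_zero c)
  exact (ne_of_gt ((ordAt_pos_iff hc.mem h0).mpr hc)) (h _ (unif_ne_zero c))

/-- A positive order gives vanishing only once the function is known to be regular, so the chart has
to be found first. In the chart `Z ≠ 0` the function `y` is regular and `1 / y` cannot have positive
order. -/
theorem isCurveOf_zero_of_ordAt [∀ i, IsNoetherianRing (R i)] (h : W.Horizontal C.1)
    (hu : 0 < ordAt (fieldEquiv R (false, false)) C (W.uc false))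
    (hw : 0 < ordAt (fieldEquiv R (false, false)) C (W.wc false)) : W.IsCurveOf 0 C := by
  obtain ⟨δ, hδ⟩ := h.exists_inChartAt false
  cases δ
  · have h1 := ordAt_nonneg (W.inChartAt_false_iff.mp hδ).2.2
    rw [wc, ordAt_inv] at hw
    lia
  · have h1 := W.inChartAt_true_iff.mp hδ
    exact ⟨h, (ordAt_pos_iff h1.2.1 (W.uc_ne_zero _)).mp hu,
      (ordAt_pos_iff h1.2.2 (W.wc_ne_zero _)).mp hw⟩

theorem Horizontal.van_wc_of_not_inChartAt (h : W.Horizontal C.1)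
    (h' : ¬ W.InChartAt C.1 (false, false)) :
    W.InChartAt C.1 (false, true) ∧ W.VanAt C.1 (W.wc false) := by
  obtain ⟨δ, hδ⟩ := h.exists_inChartAt false
  cases δ
  · exact absurd hδ h'
  · refine ⟨hδ, ?_⟩
    by_contra hv
    exact h' (hδ.to_false hv)

theorem Horizontal.isCurveOf_zero (h : W.Horizontal C.1)
    (h' : ¬ W.InChartAt C.1 (false, false)) : W.IsCurveOf 0 C := by
  obtain ⟨h1, h2⟩ := h.van_wc_of_not_inChartAt h'
  exact ⟨h, W.van_uc h1 (h.mem _) (h.mem _) h2, h2⟩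

/-- Outside the chart `Z ≠ 0` the function `1 / y` vanishes, and `y - y₀` is a unit divided by it;
its order would not be positive. -/
theorem isCurveOf_some_of_ordAt [∀ i, IsNoetherianRing (R i)] (h : W.Horizontal C.1)
    {x y : RatFunc k} (hP)
    (hx : 0 < ordAt (fieldEquiv R (false, false)) C (W.xc false - W.base x))
    (hy : 0 < ordAt (fieldEquiv R (false, false)) C (W.yc false - W.base y)) :
    W.IsCurveOf (.some x y hP) C := by
  by_cases hδ : W.InChartAt C.1 (false, false)
  · have h1 := W.inChartAt_false_iff.mp hδ
    exact ⟨h, (ordAt_pos_iff (sub_mem h1.2.1 (h.mem x)) (W.xc_sub_ne_zero _ _)).mp hx,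
      (ordAt_pos_iff (sub_mem h1.2.2 (h.mem y)) (W.yc_sub_ne_zero _ _)).mp hy⟩
  · exfalso
    obtain ⟨h1, h2⟩ := h.van_wc_of_not_inChartAt hδ
    have hw0 := W.wc_ne_zero false
    have e : W.yc false - W.base y = (1 - W.base y * W.wc false) / W.wc false := by
      rw [W.yc_eq, sub_div, mul_div_cancel_right₀ _ hw0, one_div]
    have h3 : W.VanAt C.1 (1 - (1 - W.base y * W.wc false)) := by
      rw [sub_sub_cancel]
      exact h2.mul_left (h.mem y)
    have h4 : ¬ W.VanAt C.1 (1 - W.base y * W.wc false) := fun h5 =>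
      not_van_one ((van_sub_congr h3).mpr h5)
    rw [e, ordAt_div (ne_zero_of_not_van h4) hw0, ordAt_eq_zero
      (sub_mem (one_mem _) (h2.mul_left (h.mem y)).mem) h4] at hy
    have h5 := ordAt_nonneg h2.mem
    lia

namespace SectionData
variable [∀ i, IsNoetherianRing (R i)] [CharZero k]

include hJ ha hb in
theorem ordAt_ell (S : W.SectionData C) :
    ordAt (fieldEquiv R (false, false)) C (S.ell false) = 1 := by
  obtain ⟨r, hr, hr', hv⟩ := S.exists_van_gen_div_ell hJ ha hb (some 0)
  have hr0 := (place_eq_zero hr hr').1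
  have h1 : ordAt (fieldEquiv R (false, false)) C (S.gen (some 0) / S.ell false) = 0 :=
    ordAt_eq_zero (mem_of_van_sub hv (S.horizontal.mem _)) fun h =>
      hr0 (S.horizontal.van_iff.mp ((van_sub_congr hv).mp h))
  have h2 := (S.completeCurve hJ ha hb).ordAt_gen (some 0)
  change ordAt _ C (S.gen (some 0)) = 1 at h2
  rw [ordAt_div (S.gen_ne_zero _) (S.ell_ne_zero _)] at h1
  lia

end SectionData

theorem Horizontal.ordAt_base [∀ i, IsNoetherianRing (R i)] (h : W.Horizontal C.1)
    {r : RatFunc k} (hr : r ≠ 0) :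
    ordAt (fieldEquiv R (false, false)) C (W.base r) = 0 :=
  ordAt_eq_zero (h r hr).1 (h r hr).2

section
variable [∀ i, IsNoetherianRing (R i)] [CharZero k]
include hJ ha hb

/-- As no section has order two, `y₀ ≠ 0` and `x - x₀` is a uniformizer along the curve. The
quotient restricts to the slope of the tangent. -/
theorem IsCurveOf.ordAt_xc_sub {x y : RatFunc k} {hP} (h : W.IsCurveOf (.some x y hP) C) :
    ordAt (fieldEquiv R (false, false)) C (W.xc false - W.base x) = 1 ∧
      (W.yc false - W.base y) / (W.xc false - W.base x) ∈ W.stalkAt C.1 := by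
  set S := IsCurveOf.affineSection hJ ha hb h with hS
  have hy := y_ne_zero_of_nonsingular hJ ha hb hP
  have hw : S.wAt false ≠ 0 := S.wAt_ne_zero_iff.mpr (inv_ne_zero hy)
  have ey : S.yAt false = y := by
    rw [SectionData.yAt, SectionData.wAt, scale_false, one_pow, div_one]
    exact inv_inv y
  have ex : S.xAt false = x := by
    rw [SectionData.xAt, SectionData.wAt, SectionData.uAt, scale_false, one_pow, div_one, div_one]
    change x / y / y⁻¹ = x
    rw [div_inv_eq_mul, div_mul_cancel₀ _ hy]
  have h1 := S.ordAt_ell hJ ha hb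
  have h2 := S.van_slope hw
  have hd := S.two_mul_yAt_ne_zero hw
  rw [SectionData.ell, if_neg (S.wAt_ne_zero_iff.mp hw), ordAt_div (W.xc_sub_ne_zero _ _)
    ((_root_.map_ne_zero _).mpr hd), h.1.ordAt_base hd, sub_zero, ex] at h1
  rw [ex, ey] at h2
  exact ⟨h1, SectionData.mem_of_van_sub h2 (h.1.mem _)⟩

theorem IsCurveOf.ordAt_uc (h : W.IsCurveOf 0 C) :
    ordAt (fieldEquiv R (false, false)) C (W.uc false) = 1 := by
  have h1 := (IsCurveOf.zeroSection h).ordAt_ell hJ ha hb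
  rwa [SectionData.ell, if_pos (show (IsCurveOf.zeroSection h).w = 0 from rfl)] at h1

/-- Near the zero section the equation reads `w * q = u ^ 3` with a unit `q`, and `u` is a
uniformizer. -/
theorem IsCurveOf.ordAt_wc (h : W.IsCurveOf 0 C) :
    ordAt (fieldEquiv R (false, false)) C (W.wc false) = 3 ∧
      W.VanAt C.1 (W.wc false / W.uc false) := by
  have hw0 := W.wc_ne_zero false
  have hu0 := W.uc_ne_zero false
  set q := 1 - (W.base (alpha a false) * W.uc false + W.base (beta b false) * W.wc false) *
    W.wc false with hq
  have hv : W.VanAt C.1 (1 - q) := by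
    rw [hq, sub_sub_cancel]
    exact h.2.2.mul_left (add_mem (mul_mem (h.1.mem _) h.2.1.mem)
      (mul_mem (h.1.mem _) h.2.2.mem))
  have hqv : ¬ W.VanAt C.1 q := fun h5 => not_van_one ((van_sub_congr hv).mpr h5)
  have hqm : q ∈ W.stalkAt C.1 := by simpa using sub_mem (one_mem _) hv.mem
  have hq0 := ne_zero_of_not_van hqv
  have e : W.wc false * q = W.uc false ^ 3 := by
    rw [hq]
    linear_combination W.wc_eq false
  have h1 := congrArg (ordAt (fieldEquiv R (false, false)) C) e
  rw [ordAt_mul hw0 hq0, ordAt_eq_zero hqm hqv, ordAt_pow hu0, h.ordAt_uc hJ ha hb] at h1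
  refine ⟨by simpa using h1, ?_⟩
  have e1 : W.wc false / W.uc false = W.uc false * (W.uc false * q⁻¹) := by
    field_simp
    linear_combination e
  rw [e1]
  exact h.2.1.mul_right (mul_mem h.2.1.mem (inv_mem_of_not_van hqm hqv))

/-- Here `x = u / w` has order `1 - 3`, and subtracting a function of the base changes it by a unit
factor. -/
theorem IsCurveOf.ordAt_xc_sub_base (h : W.IsCurveOf 0 C) (x : RatFunc k) :
    ordAt (fieldEquiv R (false, false)) C (W.xc false - W.base x) = -2 := by
  have hw0 := W.wc_ne_zero false
  have hu0 := W.uc_ne_zero false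
  obtain ⟨h1, h2⟩ := h.ordAt_wc hJ ha hb
  have hv : W.VanAt C.1 (1 - (1 - W.base x * (W.wc false / W.uc false))) := by
    rw [sub_sub_cancel]
    exact h2.mul_left (h.1.mem x)
  have hqv : ¬ W.VanAt C.1 (1 - W.base x * (W.wc false / W.uc false)) := fun h5 =>
    not_van_one ((van_sub_congr hv).mpr h5)
  have e : W.xc false - W.base x =
      W.uc false * (1 - W.base x * (W.wc false / W.uc false)) / W.wc false := by
    rw [W.xc_eq]
    field_simp
  rw [e, ordAt_div (mul_ne_zero hu0 (ne_zero_of_not_van hqv)) hw0,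
    ordAt_mul hu0 (ne_zero_of_not_van hqv), h1, h.ordAt_uc hJ ha hb,
    ordAt_eq_zero (sub_mem (one_mem _) (h2.mul_left (h.1.mem x)).mem) hqv]
  norm_num

/-- The triple pole of `y = 1 / w` outweighs the poles of the linear function of `x`. -/
theorem IsCurveOf.ordAt_line (h : W.IsCurveOf 0 C) (l m : RatFunc k) :
    ordAt (fieldEquiv R (false, false)) C
      (W.yc false - (W.base l * W.xc false + W.base m)) = -3 := by
  have hw0 := W.wc_ne_zero false
  have hu0 := W.uc_ne_zero false
  obtain ⟨h1, -⟩ := h.ordAt_wc hJ ha hb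
  have hv : W.VanAt C.1 (1 - (1 - (W.base l * W.uc false + W.base m * W.wc false))) := by
    rw [sub_sub_cancel]
    exact (h.2.1.mul_left (h.1.mem l)).add (h.2.2.mul_left (h.1.mem m))
  have hqv : ¬ W.VanAt C.1 (1 - (W.base l * W.uc false + W.base m * W.wc false)) := fun h5 =>
    not_van_one ((van_sub_congr hv).mpr h5)
  have e : W.yc false - (W.base l * W.xc false + W.base m) =
      (1 - (W.base l * W.uc false + W.base m * W.wc false)) / W.wc false := by
    rw [W.xc_eq, W.yc_eq]
    field_simp
  rw [e, ordAt_div (ne_zero_of_not_van hqv) hw0, h1, ordAt_eq_zero (sub_mem (one_mem _)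
    (add_mem (mul_mem (h.1.mem _) h.2.1.mem) (mul_mem (h.1.mem _) h.2.2.mem))) hqv]
  norm_num

end

end WeierstrassModel
end
end EllipticSurface

/-! ### Orders of ideals and the group law of the generic fibre -/

namespace DivisorTheory
open AlgebraicGeometry CategoryTheory

section
variable {X : Scheme.{0}} [AlgebraicGeometry.IsIntegral X] [IsLocallyNoetherian X]
  {F O : Type} [Field F] [CommRing O] (φ : F ≃+* X.functionField) (C : PrimeDivisor X)
  (ι : O →+* F)

/-- The ideal `J` generates a principal ideal of order `n` in the local ring of `C`. -/
def HasIdealOrd (J : Ideal O) (n : ℤ) : Prop :=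
  ∃ j ∈ J, ι j ≠ 0 ∧ ordAt φ C (ι j) = n ∧ ∀ i ∈ J, ι i / ι j ∈ stk φ C.1

variable {φ C ι} {J J' : Ideal O} {m n : ℤ}

/-- Two such generators divide each other in the local ring, so their orders agree. -/
theorem HasIdealOrd.unique (h : HasIdealOrd φ C ι J m) (h' : HasIdealOrd φ C ι J n) : m = n := by
  obtain ⟨j, hj, hj0, rfl, H⟩ := h
  obtain ⟨i, hi, hi0, rfl, H'⟩ := h'
  have h1 := ordAt_nonneg (H i hi)
  have h2 := ordAt_nonneg (H' j hj)
  rw [ordAt_div hi0 hj0] at h1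
  rw [ordAt_div hj0 hi0] at h2
  lia

/-- Additivity transports identities between ideals of the coordinate ring, by which the group law
is expressed, to identities between orders along curves. -/
theorem HasIdealOrd.mul (h : HasIdealOrd φ C ι J m) (h' : HasIdealOrd φ C ι J' n) :
    HasIdealOrd φ C ι (J * J') (m + n) := by
  obtain ⟨j, hj, hj0, rfl, H⟩ := h
  obtain ⟨i, hi, hi0, rfl, H'⟩ := h'
  refine ⟨j * i, Ideal.mul_mem_mul hj hi, by rw [map_mul]; exact mul_ne_zero hj0 hi0,
    by rw [map_mul, ordAt_mul hj0 hi0], fun r hr => ?_⟩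
  induction hr using Submodule.mul_induction_on' with
  | mem_mul_mem p hp q hq =>
    rw [map_mul, map_mul, mul_div_mul_comm]
    exact mul_mem (H p hp) (H' q hq)
  | add p _ q _ hp hq =>
    rw [map_add, add_div]
    exact add_mem hp hq

theorem hasIdealOrd_span_singleton (h : ∀ r, ι r ∈ stk φ C.1) {f : O} (hf : ι f ≠ 0) :
    HasIdealOrd φ C ι (Ideal.span {f}) (ordAt φ C (ι f)) := by
  refine ⟨f, Ideal.mem_span_singleton_self f, hf, rfl, fun i hi => ?_⟩
  obtain ⟨r, rfl⟩ := Ideal.mem_span_singleton.mp hi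
  rw [map_mul, mul_div_cancel_left₀ _ hf]
  exact h r

theorem hasIdealOrd_span_pair (h : ∀ r, ι r ∈ stk φ C.1) {f g : O} (hf : ι f ≠ 0)
    (hg : ι g / ι f ∈ stk φ C.1) :
    HasIdealOrd φ C ι (Ideal.span {f, g}) (ordAt φ C (ι f)) := by
  refine ⟨f, Ideal.subset_span (by simp), hf, rfl, fun i hi => ?_⟩
  obtain ⟨r, s, rfl⟩ := Ideal.mem_span_pair.mp hi
  rw [map_add, map_mul, map_mul, add_div, mul_div_cancel_right₀ _ hf, mul_div_assoc]
  exact add_mem (h r) (mul_mem (h s) hg)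

end
end DivisorTheory

namespace EllipticSurface
open AlgebraicGeometry CategoryTheory Polynomial Glue DivisorTheory
open RatFunc hiding C X eval_C eval_X

section
variable {k K : Type} [Field k] [Field K] [Algebra k K] {R : Bool × Bool → Subalgebra k K}
  {a b : k[X]} (W : WeierstrassModel R a b)

namespace WeierstrassModel
open WeierstrassCurve.Affine

/-- The inclusion of the coordinate ring of the generic fibre. -/
noncomputable def genericHom : (genericFiber a b).CoordinateRing →+* K :=
  shortCurve.lift W.base W.x W.y W.y_sq

theorem genericHom_mk_C (p : (RatFunc k)[X]) :
    W.genericHom (CoordinateRing.mk _ (C p)) = p.eval₂ W.base W.x := shortCurve.lift_mk_C _ _ p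

theorem genericHom_mk_X : W.genericHom (CoordinateRing.mk _ X) = W.y := shortCurve.lift_mk_X _ _

theorem genericHom_XClass (x : RatFunc k) :
    W.genericHom (CoordinateRing.XClass _ x) = W.xc false - W.base x := by
  rw [CoordinateRing.XClass, genericHom_mk_C, eval₂_sub, eval₂_X, eval₂_C, xc_false]

theorem genericHom_YClass (p : (RatFunc k)[X]) :
    W.genericHom (CoordinateRing.YClass _ p) = W.yc false - p.eval₂ W.base W.x := by
  rw [CoordinateRing.YClass, map_sub, map_sub, genericHom_mk_C, genericHom_mk_X, yc_false]

variable [IsGluable R] [IsFractionRing (R (false, false)) K]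
variable {W} {C : PrimeDivisor (glued R)}

theorem Horizontal.genericHom_mem (h : W.Horizontal C.1) (h' : W.InChartAt C.1 (false, false))
    (r : (genericFiber a b).CoordinateRing) : W.genericHom r ∈ W.stalkAt C.1 := by
  rw [W.inChartAt_false_iff, xc_false, yc_false] at h'
  have hp : ∀ p : (RatFunc k)[X], p.eval₂ W.base W.x ∈ W.stalkAt C.1 := fun p => by
    rw [eval₂_eq_sum_range]
    exact sum_mem fun n _ => mul_mem (h.mem _) (pow_mem h'.2.1 n)
  obtain ⟨p, q, rfl⟩ := CoordinateRing.exists_smul_basis_eq r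
  rw [map_add, CoordinateRing.smul, CoordinateRing.smul, map_mul, map_mul, genericHom_mk_C,
    genericHom_mk_C, genericHom_mk_X, map_one, mul_one]
  exact add_mem (hp p) (mul_mem (hp q) h'.2.2)

theorem IsCurveOf.not_inChartAt (h : W.IsCurveOf 0 C) : ¬ W.InChartAt C.1 (false, false) :=
  fun h' => not_van_of_inv_mem (W.wc_ne_zero false)
    (by rw [wc, inv_inv]; exact (W.inChartAt_false_iff.mp h').2.2) h.2.2

variable (W) in
open Classical in
/-- The order along the curve `C` of the divisor `(P) - (O)` of the generic fibre. -/
noncomputable def pointOrd (P : (genericFiber a b).Point) (C : PrimeDivisor (glued R)) : ℤ :=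
  (if W.IsCurveOf P C then 1 else 0) - (if W.IsCurveOf 0 C then 1 else 0)

theorem pointOrd_zero : W.pointOrd 0 C = 0 := sub_self _

theorem IsCurveOf.pointOrd_some (h : W.IsCurveOf 0 C) {x y : RatFunc k} (hP) :
    W.pointOrd (.some x y hP) C = -1 := by
  rw [pointOrd, if_neg, if_pos h, zero_sub]
  exact fun h' => h.not_inChartAt h'.inChartAt

variable [∀ i, IsNoetherianRing (R i)] [CharZero k] [IsAlgClosed k]
  (hJ : JacobianCriterion a b) (ha : a.natDegree ≤ 12) (hb : b.natDegree ≤ 18)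

include hJ ha hb in
-- Along the curve of the point, `x - x₀` is a uniformizer dividing `y - y₀`. Along any other
-- horizontal curve apart from the zero section, one of the two generators is a unit.
theorem Horizontal.hasIdealOrd (h : W.Horizontal C.1) (h0 : ¬ W.IsCurveOf 0 C)
    {x y : RatFunc k} (hP : (genericFiber a b).Nonsingular x y) :
    HasIdealOrd (fieldEquiv R (false, false)) C W.genericHom
      (CoordinateRing.XYIdeal _ x (Polynomial.C y)) (W.pointOrd (.some x y hP) C) := by
  have hc : W.InChartAt C.1 (false, false) := by
    by_contra h'
    exact h0 (h.isCurveOf_zero h')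
  have hι := h.genericHom_mem hc
  have hxm := hι (CoordinateRing.XClass _ x)
  have hym := hι (CoordinateRing.YClass _ (Polynomial.C y))
  have hY : W.genericHom (CoordinateRing.YClass _ (Polynomial.C y)) = W.yc false - W.base y := by
    rw [genericHom_YClass, eval₂_C]
  rw [pointOrd, if_neg h0, sub_zero, CoordinateRing.XYIdeal]
  rw [genericHom_XClass] at hxm
  rw [hY] at hym
  by_cases hC : W.IsCurveOf (.some x y hP) C
  · obtain ⟨h1, h2⟩ := hC.ordAt_xc_sub hJ ha hb
    rw [if_pos hC, ← h1, ← genericHom_XClass]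
    refine hasIdealOrd_span_pair hι ?_ ?_
    · rw [genericHom_XClass]; exact W.xc_sub_ne_zero _ _
    · rw [genericHom_XClass, hY]; exact h2
  · rw [if_neg hC]
    by_cases hx : W.VanAt C.1 (W.xc false - W.base x)
    · have hy : ¬ W.VanAt C.1 (W.yc false - W.base y) := fun hy => hC ⟨h, hx, hy⟩
      rw [← ordAt_eq_zero hym hy, ← hY, Set.pair_comm]
      refine hasIdealOrd_span_pair hι ?_ ?_
      · rw [hY]; exact W.yc_sub_ne_zero _ _
      · rw [hY, genericHom_XClass, div_eq_mul_inv]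
        exact mul_mem hxm (inv_mem_of_not_van hym hy)
    · rw [← ordAt_eq_zero hxm hx, ← genericHom_XClass]
      refine hasIdealOrd_span_pair hι ?_ ?_
      · rw [genericHom_XClass]; exact W.xc_sub_ne_zero _ _
      · rw [hY, genericHom_XClass, div_eq_mul_inv]
        exact mul_mem hym (inv_mem_of_not_van hxm hx)

variable (W)

include hJ ha hb in
/-- The divisor `(P + Q) - (P) - (Q) + (O)` of the generic fibre is principal. -/
theorem exists_ordAt_eq_pointOrd_add (P Q : (genericFiber a b).Point) : ∃ g : K, g ≠ 0 ∧
    ∀ C : PrimeDivisor (glued R), W.Horizontal C.1 →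
      ordAt (fieldEquiv R (false, false)) C g =
        W.pointOrd (P + Q) C - W.pointOrd P C - W.pointOrd Q C := by
  match P, Q with
  | 0, Q => exact ⟨1, one_ne_zero, fun C _ => by rw [zero_add, pointOrd_zero, ordAt_one]; ring⟩
  | .some x₁ y₁ h₁, 0 =>
    exact ⟨1, one_ne_zero, fun C _ => by rw [add_zero, pointOrd_zero, ordAt_one]; ring⟩
  | .some x₁ y₁ h₁, .some x₂ y₂ h₂ =>
    -- For opposite points the function is the inverse of the equation of the vertical line through
    -- them.
    by_cases hxy : x₁ = x₂ ∧ y₁ = (genericFiber a b).negY x₂ y₂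
    · rw [Point.add_of_Y_eq hxy.1 hxy.2]
      have hg := W.xc_sub_ne_zero false x₂
      refine ⟨(W.xc false - W.base x₂)⁻¹, inv_ne_zero hg, fun C hC => ?_⟩
      rw [ordAt_inv, pointOrd_zero]
      by_cases h0 : W.IsCurveOf 0 C
      · rw [h0.ordAt_xc_sub_base hJ ha hb, h0.pointOrd_some, h0.pointOrd_some]
        norm_num
      · have hc : W.InChartAt C.1 (false, false) := by
          by_contra h'
          exact h0 (hC.isCurveOf_zero h')
        have e1 := (hC.hasIdealOrd hJ ha hb h0 h₁).mul (hC.hasIdealOrd hJ ha hb h0 h₂)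
        have e2 := hasIdealOrd_span_singleton (hC.genericHom_mem hc)
          (f := CoordinateRing.XClass _ x₂) (by rw [genericHom_XClass]; exact hg)
        have e3 : CoordinateRing.XYIdeal _ x₁ (Polynomial.C y₁) *
            CoordinateRing.XYIdeal _ x₂ (Polynomial.C y₂) =
            CoordinateRing.XIdeal (genericFiber a b) x₂ := by
          rw [hxy.1, hxy.2, CoordinateRing.XYIdeal_neg_mul h₂]
        rw [e3] at e1
        have e4 := e1.unique e2
        rw [genericHom_XClass] at e4
        lia
    · rw [Point.add_some hxy]
      -- Let `ℓ` be the equation of the chord or tangent through `P` and `Q`. The identity of ideals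
      -- is `(x - x₃) I_P I_Q = (ℓ) I_{P + Q}`, so the function is `(x - x₃) / ℓ`. Ideals describe
      -- only the affine part; along the zero section the order is found from the pole orders `2`
      -- and `3`.
      have e3 := CoordinateRing.XYIdeal_mul_XYIdeal h₁.1 h₂.1 hxy
      set l := (genericFiber a b).slope x₁ x₂ y₁ y₂ with hl
      set x₃ := (genericFiber a b).addX x₁ x₂ l with hx₃
      set y₃ := (genericFiber a b).addY x₁ x₂ y₁ l with hy₃
      have hY : W.genericHom (CoordinateRing.YClass _ (linePolynomial x₁ y₁ l)) =
          W.yc false - (W.base l * W.xc false + W.base (y₁ - l * x₁)) := by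
        rw [genericHom_YClass, linePolynomial, eval₂_add, eval₂_mul, eval₂_sub, eval₂_C, eval₂_C,
          eval₂_C, eval₂_X, xc_false, map_sub, map_mul]
        ring
      have hY0 : W.yc false - (W.base l * W.xc false + W.base (y₁ - l * x₁)) ≠ 0 := by
        intro h
        have h1 := (W.indep (-(Polynomial.C l * X + Polynomial.C (y₁ - l * x₁))) 1 (by
          rw [eval₂_neg, eval₂_add, eval₂_mul, eval₂_C, eval₂_C, eval₂_X, eval₂_one]
          rw [xc_false, yc_false] at h
          linear_combination h)).2
        exact one_ne_zero h1
      have hX0 := W.xc_sub_ne_zero false x₃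
      refine ⟨(W.xc false - W.base x₃) /
        (W.yc false - (W.base l * W.xc false + W.base (y₁ - l * x₁))), div_ne_zero hX0 hY0,
        fun C hC => ?_⟩
      rw [ordAt_div hX0 hY0]
      by_cases h0 : W.IsCurveOf 0 C
      · rw [h0.ordAt_xc_sub_base hJ ha hb, h0.ordAt_line hJ ha hb, h0.pointOrd_some,
          h0.pointOrd_some, h0.pointOrd_some]
        norm_num
      · have hc : W.InChartAt C.1 (false, false) := by
          by_contra h'
          exact h0 (hC.isCurveOf_zero h')
        have hι := hC.genericHom_mem hc
        have e1 := (hasIdealOrd_span_singleton hι (f := CoordinateRing.XClass _ x₃)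
          (by rw [genericHom_XClass]; exact hX0)).mul
          ((hC.hasIdealOrd hJ ha hb h0 h₁).mul (hC.hasIdealOrd hJ ha hb h0 h₂))
        have e2 := (hasIdealOrd_span_singleton hι
          (f := CoordinateRing.YClass _ (linePolynomial x₁ y₁ l)) (by rw [hY]; exact hY0)).mul
          (hC.hasIdealOrd hJ ha hb h0 (nonsingular_add h₁ h₂ hxy))
        have e4 := e1.unique (e3 ▸ e2)
        rw [hY, genericHom_XClass] at e4
        lia

include hJ ha hb in
/-- The divisor `(n P) - n (P) + (n - 1) (O)` of the generic fibre is principal. -/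
theorem exists_ordAt_eq_pointOrd_zsmul (P : (genericFiber a b).Point) (n : ℤ) : ∃ g : K, g ≠ 0 ∧
    ∀ C : PrimeDivisor (glued R), W.Horizontal C.1 →
      ordAt (fieldEquiv R (false, false)) C g = W.pointOrd (n • P) C - n * W.pointOrd P C := by
  induction n using Int.induction_on with
  | zero =>
    exact ⟨1, one_ne_zero, fun C _ => by rw [zero_zsmul, pointOrd_zero, ordAt_one]; ring⟩
  | succ n ih =>
    obtain ⟨g, hg, h⟩ := ih
    obtain ⟨f, hf, h'⟩ := W.exists_ordAt_eq_pointOrd_add hJ ha hb ((n : ℤ) • P) P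
    refine ⟨g * f, mul_ne_zero hg hf, fun C hC => ?_⟩
    rw [ordAt_mul hg hf, h C hC, h' C hC, add_zsmul, one_zsmul]
    ring
  | pred n ih =>
    obtain ⟨g, hg, h⟩ := ih
    obtain ⟨f, hf, h'⟩ := W.exists_ordAt_eq_pointOrd_add hJ ha hb ((-(n : ℤ) - 1) • P) P
    refine ⟨g / f, div_ne_zero hg hf, fun C hC => ?_⟩
    have e : (-(n : ℤ) - 1) • P + P = (-(n : ℤ)) • P := by
      rw [sub_zsmul, one_zsmul, neg_add_cancel_right]
    rw [ordAt_div hg hf, h C hC, h' C hC, e]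
    ring

end WeierstrassModel
end
end EllipticSurface

/-! ### Irreducibility and reducedness of the fibres -/

namespace EllipticSurface
open AlgebraicGeometry CategoryTheory Polynomial Glue DivisorTheory
open RatFunc hiding C X eval_C eval_X

section
variable {k K : Type} [Field k] [Field K] [Algebra k K] {R : Bool × Bool → Subalgebra k K}
  {a b : k[X]}

namespace shortCurve
open WeierstrassCurve.Affine

/-- The coordinate ring is free over `k[t][x]` with basis `1, y`, and reduction at `t = c` acts on
the coefficients, where vanishing means divisibility by `t - c`. -/
theorem map_eq_zero_iff (A B : k[X]) (c : k) (r : (shortCurve A B).CoordinateRing) :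
    CoordinateRing.map (shortCurve A B) (evalRingHom c) r = 0 ↔
      ∃ s, r = CoordinateRing.mk (shortCurve A B) (C (C (X - C c))) * s := by
  constructor
  · intro h
    obtain ⟨p, q, rfl⟩ := CoordinateRing.exists_smul_basis_eq r
    rw [map_add, CoordinateRing.map_smul, CoordinateRing.map_smul, CoordinateRing.map_mk,
      Polynomial.map_X, _root_.map_one] at h
    obtain ⟨hp, hq⟩ := CoordinateRing.smul_basis_eq_zero h
    have key : ∀ p : k[X][X], p.map (evalRingHom c) = 0 → ∃ s, p = C (X - C c) * s := by
      intro p hp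
      refine C_dvd_iff_dvd_coeff _ _ |>.mpr fun i => ?_
      rw [dvd_iff_isRoot]
      have h1 := congrArg (fun q => q.coeff i) hp
      simpa using h1
    obtain ⟨s, rfl⟩ := key p hp
    obtain ⟨t, rfl⟩ := key q hq
    refine ⟨s • 1 + t • CoordinateRing.mk _ X, ?_⟩
    simp only [CoordinateRing.smul, map_mul]
    ring
  · rintro ⟨s, rfl⟩
    rw [_root_.map_mul, CoordinateRing.map_mk]
    simp

end shortCurve

namespace WeierstrassModel
open WeierstrassCurve.Affine
variable (W : WeierstrassModel R a b) (ha : a.natDegree ≤ 12) (hb : b.natDegree ≤ 18)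

theorem chartHom_X_sub_C (c : Option k) :
    W.chartHom ha hb (chartAt c) (CoordinateRing.mk _ (C (C (X - C (coordAt c))))) =
      W.base (unif c) := by
  rw [chartHom, shortCurve.lift_mk_C, eval₂_C, map_sub, basePoly_X, basePoly_C, ← W.base_C,
    ← map_sub, baseCoord_chartAt, add_sub_cancel_left]

variable [IsGluable R] [IsFractionRing (R (false, false)) K]
variable [∀ i, IsNoetherianRing (R i)]

include ha hb in
/-- The fibre over a point of the base. -/
theorem exists_fiber (c : Option k) : ∃ V : PrimeDivisor (glued R),
    W.InChartAt V.1 (chartAt c, false) ∧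
    (∀ f ∈ R (chartAt c, false), W.VanAt V.1 f → f / W.base (unif c) ∈ R (chartAt c, false)) ∧
    ordAt (fieldEquiv R (false, false)) V (W.base (unif c)) = 1 := by
  set ε := chartAt c with hε
  set E := W.chartEquiv ha hb ε with hE
  set f := CoordinateRing.map (chartCurve a b ε) (evalRingHom (coordAt c)) with hf
  set t := CoordinateRing.mk (chartCurve a b ε) (C (C (X - C (coordAt c)))) with ht
  have hEt : (E t : K) = W.base (unif c) := W.chartHom_X_sub_C ha hb c
  have hu0 : W.base (unif c) ≠ 0 := (_root_.map_ne_zero _).mpr (unif_ne_zero c)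
  -- The fibre is defined by the kernel of reduction at `c`. This ideal is prime because the
  -- coordinate ring of a Weierstrass cubic over a field is a domain, even if the cubic is singular;
  -- and it is generated by the uniformizer, so the fibre is reduced.
  let q : Ideal (R (ε, false)) := (RingHom.ker f).comap E.symm
  have hker : (RingHom.ker f).IsPrime := RingHom.ker_isPrime f
  have hq : q.IsPrime := Ideal.comap_isPrime _ _
  obtain ⟨p, hp, hpq⟩ := exists_point R (false, false) (ε, false) q
  have key : ∀ g ∈ R (ε, false), W.VanAt p g → g / W.base (unif c) ∈ R (ε, false) := by
    intro g hg hv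
    have h1 : f (E.symm ⟨g, hg⟩) = 0 := (hpq ⟨g, hg⟩).mp hv
    obtain ⟨s, hs⟩ := (shortCurve.map_eq_zero_iff _ _ _ _).mp h1
    have h2 : (⟨g, hg⟩ : R (ε, false)) = E t * E s := by
      rw [← map_mul, ← hs, E.apply_symm_apply]
    have h3 : g = W.base (unif c) * (E s : K) := by
      rw [← hEt]
      exact congrArg Subtype.val h2
    rw [h3, mul_div_cancel_left₀ _ hu0]
    exact (E s).2
  have hvan : W.VanAt p (W.base (unif c)) := by
    rw [← hEt]
    refine (hpq _).mpr ?_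
    change f (E.symm (E t)) = 0
    rw [E.symm_apply_apply]
    exact (shortCurve.map_eq_zero_iff _ _ _ _).mpr ⟨1, (mul_one _).symm⟩
  have hdiv : ∀ g, W.VanAt p g → g / W.base (unif c) ∈ W.stalkAt p := by
    intro g hg
    obtain ⟨x, hx, y, hy, hyv, rfl⟩ := hp.exists_div hg.mem
    have hx' : W.VanAt p x := by
      have h4 := hg.mul_right (hp y hy)
      rwa [div_mul_cancel₀ _ (ne_zero_of_not_van hyv)] at h4
    rw [div_right_comm, div_eq_mul_inv _ y]
    exact mul_mem (hp _ (key x hx hx')) (inv_mem_of_not_van (hp y hy) hyv)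
  exact ⟨⟨p, coheight_eq_one_of_generator _ hu0 hvan hdiv⟩, hp, key,
    ordAt_eq_one hvan hdiv hu0⟩

variable {W} {C C' z : PrimeDivisor (glued R)} {c : Option k}

/-- Modulo `u` and `w` every function of the chart `Y ≠ 0` is a polynomial in the coordinate of the
base. The same polynomial serves wherever `u` and `w` vanish, in particular along the zero section.
-/
theorem exists_van_sub_basePoly (hz : W.IsCurveOf 0 z) {p : glued R} {ε : Bool}
    (hc : W.InChartAt p (ε, true)) (hu : W.VanAt p (W.uc ε)) (hw : W.VanAt p (W.wc ε)) {f : K}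
    (hf : f ∈ R (ε, true)) :
    ∃ r : k[X], W.VanAt z.1 (f - W.basePoly ε r) ∧ W.VanAt p (f - W.basePoly ε r) := by
  set S := IsCurveOf.zeroSection hz with hS
  have hzc := S.inChartAt_true ε
  have hzu := S.van_uc_sub ε
  have hzw := S.van_wc_sub ε
  have hu0 : S.uAt ε = 0 := zero_div _
  have hw0 : S.wAt ε = 0 := zero_div _
  rw [hu0, map_zero] at hzu
  rw [hw0, map_zero] at hzw
  have hB : ∀ {p : glued R}, W.InChartAt p (ε, true) → ∀ r, W.basePoly ε r ∈ W.stalkAt p := by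
    intro p hp r
    refine hp _ ?_
    induction r using Polynomial.induction_on' with
    | add p q hp hq => rw [map_add]; exact add_mem hp hq
    | monomial n u =>
      rw [← C_mul_X_pow_eq_monomial, map_mul, map_pow, W.basePoly_C, W.basePoly_X]
      exact mul_mem ((R (ε, true)).algebraMap_mem u) (pow_mem (W.coord_mem ε true 0) n)
  rw [W.chart_eq] at hf
  induction hf using Algebra.adjoin_induction with
  | mem f hf =>
    obtain ⟨j, rfl⟩ := hf
    fin_cases j
    · refine ⟨X, ?_, ?_⟩ <;> rw [W.basePoly_X] <;> exact W.van_coord_zero _ ε true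
    · refine ⟨0, ?_, ?_⟩ <;> rw [map_zero]
      exacts [hzu, by rw [sub_zero]; exact hu]
    · refine ⟨0, ?_, ?_⟩ <;> rw [map_zero]
      exacts [hzw, by rw [sub_zero]; exact hw]
  | algebraMap u =>
    refine ⟨C u, ?_, ?_⟩ <;> rw [W.basePoly_C, sub_self] <;> exact van_zero
  | add f g _ _ hf hg =>
    obtain ⟨r, hr, hr'⟩ := hf
    obtain ⟨s, hs, hs'⟩ := hg
    refine ⟨r + s, ?_, ?_⟩ <;> rw [map_add, add_sub_add_comm]
    exacts [hr.add hs, hr'.add hs']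
  | mul f g _ _ hf hg =>
    obtain ⟨r, hr, hr'⟩ := hf
    obtain ⟨s, hs, hs'⟩ := hg
    refine ⟨r * s, ?_, ?_⟩ <;> rw [map_mul, show f * g - W.basePoly ε r * W.basePoly ε s =
      (f - W.basePoly ε r) * (g - W.basePoly ε s + W.basePoly ε s) +
        W.basePoly ε r * (g - W.basePoly ε s) by ring]
    · exact (hr.mul_right (add_mem hs.mem (hB hzc s))).add (hs.mul_left (hB hzc r))
    · exact (hr'.mul_right (add_mem hs'.mem (hB hc s))).add (hs'.mul_left (hB hc r))

variable [IsAlgClosed k]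

include ha hb in
-- If `w` vanished along `C`, so would `u`, and `C` would be a specialization of `z`. Both being
-- prime divisors, `C` would be `z`, which is not vertical.
theorem LiesOver.inChartAt_false (hz : W.IsCurveOf 0 z) (h : W.LiesOver C.1 c) :
    W.InChartAt C.1 (chartAt c, false) := by
  obtain ⟨δ, hδ⟩ := h.exists_inChartAt
  cases δ
  · exact hδ
  · refine hδ.to_false fun hw => ?_
    have hzc := (IsCurveOf.zeroSection hz).inChartAt_true (chartAt c)
    have hu := W.van_uc hδ (SectionData.base_alpha_mem ha h) (SectionData.base_beta_mem hb h) hw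
    have h1 : z.1 ⤳ C.1 := by
      refine hδ.specializes hzc fun f hf hv => ?_
      obtain ⟨r, hr, hr'⟩ := exists_van_sub_basePoly hz hδ hu hw hf
      have h2 := (van_sub_congr hr).mp hv
      have h3 : aeval (baseCoord (chartAt c)) r = (0 : RatFunc k) := hz.1.van_iff.mp h2
      have h4 : W.basePoly (chartAt c) r = 0 := by
        change W.base _ = 0
        exact (congrArg W.base h3).trans (map_zero _)
      rwa [h4, sub_zero] at hr'
    rw [← PrimeDivisor.eq_of_specializes h1] at h
    exact (hz.1 _ (unif_ne_zero c)).2 h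

include ha hb in
-- A vertical prime divisor meets the chart `Z ≠ 0`, where the ideal of the fibre is generated by
-- the uniformizer. Hence the fibre specializes to the divisor and is equal to it.
theorem LiesOver.ordAt_unif_and_unique (hz : W.IsCurveOf 0 z) (h : W.LiesOver C.1 c) :
    ordAt (fieldEquiv R (false, false)) C (W.base (unif c)) = 1 ∧
      ∀ C' : PrimeDivisor (glued R), W.LiesOver C'.1 c → C' = C := by
  obtain ⟨V, hV, hVd, hV1⟩ := W.exists_fiber ha hb c
  have key : ∀ C : PrimeDivisor (glued R), W.LiesOver C.1 c → V = C := by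
    intro C hC
    have hu0 : W.base (unif c) ≠ 0 := (_root_.map_ne_zero _).mpr (unif_ne_zero c)
    have hCc := hC.inChartAt_false ha hb hz
    refine PrimeDivisor.eq_of_specializes (hCc.specializes hV fun f hf hv => ?_)
    have h1 := Van.mul_left hC (hCc _ (hVd f hf hv))
    rwa [div_mul_cancel₀ _ hu0] at h1
  rw [← key C h]
  exact ⟨hV1, fun C' hC' => (key C' hC').symm⟩

include ha hb in
-- A function on the base is a power of the uniformizer times a function invertible at `c`, and the
-- uniformizer has order one along the fibre.
theorem LiesOver.ordAt_base (hz : W.IsCurveOf 0 z) (h : W.LiesOver C.1 c) {r : RatFunc k}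
    (hr : r ≠ 0) : ordAt (fieldEquiv R (false, false)) C (W.base r) = (place c).v r := by
  have hu := unif_ne_zero c
  have hu0 : W.base (unif c) ≠ 0 := (_root_.map_ne_zero _).mpr hu
  have h1 := (h.ordAt_unif_and_unique ha hb hz).1
  have hunit : ∀ s : RatFunc k, s ≠ 0 → (place c).v s = 0 →
      ordAt (fieldEquiv R (false, false)) C (W.base s) = 0 := by
    intro s hs0 hs
    have hm : s ∈ (place c).ring := (DiscPlace.mem_ring_iff _ hs0).mpr hs.ge
    refine ordAt_eq_zero (h.base_mem hm) fun hv => ?_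
    rcases inMax_iff.mp ((h.van_base_iff hm).mp hv) with h2 | h2
    · exact hs0 h2
    · lia
  have hpu := place_unif c
  obtain ⟨m, hm | hm⟩ := ((place c).v r).eq_nat_or_neg
  · have hs := hunit (r / unif c ^ m) (div_ne_zero hr (pow_ne_zero m hu)) (by
      rw [DiscPlace.map_div _ hr (pow_ne_zero m hu), DiscPlace.map_pow _ hu, hpu, hm]; ring)
    rw [map_div₀, map_pow, ordAt_div ((_root_.map_ne_zero _).mpr hr) (pow_ne_zero m hu0),
      ordAt_pow hu0, h1] at hs
    lia
  · have hs := hunit (r * unif c ^ m) (mul_ne_zero hr (pow_ne_zero m hu)) (by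
      rw [DiscPlace.map_mul _ hr (pow_ne_zero m hu), DiscPlace.map_pow _ hu, hpu, hm]; ring)
    rw [map_mul, map_pow, ordAt_mul ((_root_.map_ne_zero _).mpr hr) (pow_ne_zero m hu0),
      ordAt_pow hu0, h1] at hs
    lia

end WeierstrassModel
end
end EllipticSurface

/-! ### Vertical divisors and the final computation -/

namespace RatFunc
open Polynomial

section
variable {k : Type} [Field k]

open Classical in
theorem place_X_sub_C (c : Option k) (a : k) : (place c).v (RatFunc.X - RatFunc.C a) =
    (if c = some a then 1 else 0) - (if c = none then 1 else 0) := by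
  cases c with
  | none => simp [place, intDegree_X_sub_C]
  | some c =>
    change orderAt c _ = _
    simp [orderAt_X_sub_C]

open Classical in
theorem place_X (c : Option k) : (place c).v (RatFunc.X : RatFunc k) =
    (if c = some 0 then 1 else 0) - (if c = none then 1 else 0) := by
  have h := place_X_sub_C c (0 : k)
  rwa [_root_.map_zero, sub_zero] at h

open Classical in
-- Every point of the projective line is linearly equivalent to `0`. Pulled back to the surface,
-- this makes all fibres linearly equivalent.
theorem exists_place_eq_sub (c : Option k) : ∃ r : RatFunc k, r ≠ 0 ∧ ∀ c', (place c').v r =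
    (if c' = c then 1 else 0) - (if c' = some 0 then 1 else 0) := by
  have hX := RatFunc.X_ne_zero (K := k)
  cases c with
  | none =>
    refine ⟨RatFunc.X⁻¹, inv_ne_zero hX, fun c' => ?_⟩
    rw [DiscPlace.map_inv _ hX, place_X]
    ring
  | some a =>
    refine ⟨(RatFunc.X - RatFunc.C a) / RatFunc.X, div_ne_zero (X_sub_C_ne_zero a) hX,
      fun c' => ?_⟩
    rw [DiscPlace.map_div _ (X_sub_C_ne_zero a) hX, place_X, place_X_sub_C]
    ring

end
end RatFunc

namespace EllipticSurface
open AlgebraicGeometry CategoryTheory Polynomial Glue DivisorTheory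
open RatFunc hiding C X eval_C eval_X

section
variable {k K : Type} [Field k] [Field K] [Algebra k K] {R : Bool × Bool → Subalgebra k K}
  {a b : k[X]} (W : WeierstrassModel R a b)

namespace WeierstrassModel
variable [IsGluable R] [IsFractionRing (R (false, false)) K] [∀ i, IsNoetherianRing (R i)]
  [IsAlgClosed k]
variable {C z : PrimeDivisor (glued R)} {c : Option k}

/-- The fibre over `t = 0`. -/
noncomputable abbrev fiberZero (W : WeierstrassModel R a b) : WeilDivisor (glued R) :=
  zerosOf (fieldEquiv R (false, false) (W.base RatFunc.X))

theorem fiberZero_apply (C : PrimeDivisor (glued R)) : W.fiberZero C =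
    max (ordAt (fieldEquiv R (false, false)) C (W.base RatFunc.X)) 0 := rfl

variable {W} (ha : a.natDegree ≤ 12) (hb : b.natDegree ≤ 18)

theorem LiesOver.not_horizontal (h : W.LiesOver C.1 c) : ¬ W.Horizontal C.1 := fun h' =>
  (h' _ (unif_ne_zero c)).2 h

include ha hb in
-- The function on the base with divisor `(c) - (0)` is pulled back. It has order zero along
-- horizontal curves, and along a fibre its order is its valuation at the point below.
theorem LiesOver.single_sub_mem (hz : W.IsCurveOf 0 z) (h : W.LiesOver C.1 c) :
    Finsupp.single C 1 - W.fiberZero ∈ AddSubgroup.closure (principalDivisors (glued R)) := by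
  classical
  obtain ⟨r, hr0, hr⟩ := exists_place_eq_sub c
  refine AddSubgroup.subset_closure ⟨fieldEquiv R (false, false) (W.base r),
    (_root_.map_ne_zero _).mpr ((_root_.map_ne_zero _).mpr hr0), ?_⟩
  ext C'
  rw [LocalCurve.divOf_apply, Finsupp.sub_apply, fiberZero_apply]
  rcases W.horizontal_or_liesOver C'.1 with h' | ⟨c', h'⟩
  · rw [h'.ordAt_base hr0, h'.ordAt_base RatFunc.X_ne_zero, Finsupp.single_eq_of_ne, max_self,
      sub_zero]
    rintro rfl
    exact h.not_horizontal h'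
  · rw [h'.ordAt_base ha hb hz hr0, h'.ordAt_base ha hb hz RatFunc.X_ne_zero, hr, place_X]
    have h1 : (Finsupp.single C 1 : WeilDivisor (glued R)) C' = if c' = c then 1 else 0 := by
      rw [Finsupp.single_apply]
      refine if_congr ⟨?_, ?_⟩ rfl rfl
      · rintro rfl
        exact h'.unique h
      · rintro rfl
        exact (h'.ordAt_unif_and_unique ha hb hz).2 C h
    rw [h1]
    congr 1
    cases c' with
    | none => simp
    | some c' =>
      rw [if_neg (Option.some_ne_none c'), sub_zero]
      split_ifs <;> simp

include ha hb in
-- Every component of a vertical divisor is a whole fibre, and each fibre is equivalent to the one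
-- over `0`.
theorem exists_sub_fiberZero_mem (hz : W.IsCurveOf 0 z) (D : WeilDivisor (glued R))
    (hD : ∀ C, W.Horizontal C.1 → D C = 0) : ∃ m : ℤ,
    D - m • W.fiberZero ∈ AddSubgroup.closure (principalDivisors (glued R)) := by
  have key : D ∈ AddSubgroup.closure (principalDivisors (glued R)) ⊔
      AddSubgroup.zmultiples W.fiberZero := by
    rw [← D.sum_single]
    refine sum_mem fun C hC => ?_
    obtain ⟨c, hc⟩ := (W.horizontal_or_liesOver C.1).resolve_left fun h =>
      Finsupp.mem_support_iff.mp hC (hD C h)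
    have e : (Finsupp.single C (D C) : WeilDivisor (glued R)) =
        D C • ((Finsupp.single C 1 - W.fiberZero) + W.fiberZero) := by
      rw [sub_add_cancel, Finsupp.smul_single, smul_eq_mul, mul_one]
    rw [e]
    exact zsmul_mem (add_mem (AddSubgroup.mem_sup_left (hc.single_sub_mem ha hb hz))
      (AddSubgroup.mem_sup_right (AddSubgroup.mem_zmultiples _))) _
  obtain ⟨E, hE, F, hF, h⟩ := AddSubgroup.mem_sup.mp key
  obtain ⟨m, rfl⟩ := AddSubgroup.mem_zmultiples_iff.mp hF
  exact ⟨m, by rw [← h, add_sub_cancel_right]; exact hE⟩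

variable [CharZero k] (hJ : JacobianCriterion a b) {σ τ : PrimeDivisor (glued R)}
  {P : (genericFiber a b).Point} {n : ℤ}

include hJ ha hb in
/-- The divisor `τ - n σ + (n - 1) z` is linearly equivalent to a multiple of a fibre. -/
theorem exists_sub_mem (hz : W.IsCurveOf 0 z) (hσ : W.IsCurveOf P σ)
    (hτ : W.IsCurveOf (n • P) τ) : ∃ m : ℤ,
    Finsupp.single τ 1 - n • Finsupp.single σ 1 + (n - 1) • Finsupp.single z 1 +
      m • W.fiberZero ∈ AddSubgroup.closure (principalDivisors (glued R)) := by
  classical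
  obtain ⟨g, hg0, hg⟩ := W.exists_ordAt_eq_pointOrd_zsmul hJ ha hb P n
  set D := divOf (fieldEquiv R (false, false) g) with hD
  set E : WeilDivisor (glued R) := Finsupp.single τ 1 - n • Finsupp.single σ 1 +
    (n - 1) • Finsupp.single z 1 with hE
  have hiff : ∀ {Q : (genericFiber a b).Point} {C₀ : PrimeDivisor (glued R)},
      W.IsCurveOf Q C₀ → ∀ C, W.IsCurveOf Q C ↔ C₀ = C := fun h C =>
    ⟨fun h' => h.unique hJ ha hb h', fun h' => h' ▸ h⟩
  -- Since `pointOrd` stands for `(Q) - (O)`, the coefficient of the origin in `pointOrd (n • P) - n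
  -- * pointOrd P` is `n - 1`.
  have hDE : ∀ C : PrimeDivisor (glued R), W.Horizontal C.1 → (E - D) C = 0 := by
    intro C hC
    rw [Finsupp.sub_apply, LocalCurve.divOf_apply, hg C hC, hE]
    simp only [Finsupp.add_apply, Finsupp.sub_apply, Finsupp.smul_apply, Finsupp.single_apply,
      pointOrd, hiff hz, hiff hσ, hiff hτ, smul_eq_mul]
    ring
  obtain ⟨m, hm⟩ := exists_sub_fiberZero_mem ha hb hz (E - D) hDE
  refine ⟨-m, ?_⟩
  have h1 : D ∈ AddSubgroup.closure (principalDivisors (glued R)) :=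
    AddSubgroup.subset_closure ⟨_, (_root_.map_ne_zero _).mpr hg0, rfl⟩
  have h2 := add_mem hm h1
  have e : E - D - m • W.fiberZero + D = E + -m • W.fiberZero := by
    rw [neg_smul]; abel
  rwa [e] at h2

omit [CharZero k] in
theorem _root_.DivisorTheory.CompleteCurve.interNumber_eq_zero_of_mem
    (T : CompleteCurve (fieldEquiv R (false, false)) (placeSystem (k := k)) σ)
    {D : WeilDivisor (glued R)}
    (hD : D ∈ AddSubgroup.closure (principalDivisors (glued R))) : interNumber D σ = 0 := by
  induction hD using AddSubgroup.closure_induction with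
  | mem D hD =>
    obtain ⟨g, hg, rfl⟩ := hD
    have h := T.interNumber_divOf (f := (fieldEquiv R (false, false)).symm g)
      ((_root_.map_ne_zero _).mpr hg)
    rwa [RingEquiv.apply_symm_apply] at h
  | zero => exact T.interNumber_zero
  | add D D' _ _ h h' => rw [T.interNumber_add, h, h', add_zero]
  | neg D _ h => rw [T.interNumber_neg, h, neg_zero]

include hJ ha hb in
/-- The class of a multiple of a section, up to linear equivalence. -/
theorem single_sub_mem_closure (hz : W.IsCurveOf 0 z) (hσ : W.IsCurveOf P σ)
    (hτ : W.IsCurveOf (n • P) τ) :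
    Finsupp.single τ 1 - (n • Finsupp.single σ 1 - (n - 1) • Finsupp.single z 1 +
      ((interNumber (Finsupp.single z 1) σ + 3) * n * (n - 1)) • W.fiberZero) ∈
      AddSubgroup.closure (principalDivisors (glued R)) := by
  obtain ⟨m, hm⟩ := exists_sub_mem ha hb hJ hz hσ hτ
  obtain ⟨Sz⟩ := hz.exists_sectionData hJ ha hb
  obtain ⟨Sσ⟩ := hσ.exists_sectionData hJ ha hb
  obtain ⟨Sτ⟩ := hτ.exists_sectionData hJ ha hb
  -- For distinct curves both numbers are sums of lengths of quotients by the same ideals.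
  have symm : ∀ {C C' : PrimeDivisor (glued R)}, W.SectionData C → W.SectionData C' →
      interNumber (Finsupp.single C 1) C' = interNumber (Finsupp.single C' 1) C := by
    intro C C' S S'
    by_cases h : C = C'
    · rw [h]
    · rw [(S'.completeCurve hJ ha hb).interNumber_single h,
        (S.completeCurve hJ ha hb).interNumber_single (Ne.symm h)]
      exact congrArg Nat.cast (finsum_congr fun p => by rw [sup_comm])
  have expand : ∀ {C : PrimeDivisor (glued R)}, W.SectionData C →
      interNumber (Finsupp.single τ 1) C - n * interNumber (Finsupp.single σ 1) C +
        (n - 1) * interNumber (Finsupp.single z 1) C + m = 0 := by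
    intro C S
    have T := S.completeCurve hJ ha hb
    have h1 := T.interNumber_eq_zero_of_mem hm
    rw [T.interNumber_add, T.interNumber_add, sub_eq_add_neg, T.interNumber_add, T.interNumber_neg,
      T.interNumber_zsmul, T.interNumber_zsmul, T.interNumber_zsmul,
      S.interNumber_fiber hJ ha hb] at h1
    linear_combination h1
  have h1 := expand Sz
  have h2 := expand Sσ
  have h3 := expand Sτ
  rw [Sz.interNumber_self hJ ha hb, symm Sσ Sz, symm Sτ Sz] at h1
  rw [Sσ.interNumber_self hJ ha hb, symm Sτ Sσ] at h2
  rw [Sτ.interNumber_self hJ ha hb] at h3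
  have hmn : m = - ((interNumber (Finsupp.single z 1) σ + 3) * n * (n - 1)) := by
    have h4 : 2 * m = 2 * - ((interNumber (Finsupp.single z 1) σ + 3) * n * (n - 1)) := by
      -- The combination cancels the unknown numbers `τ · z` and `τ · σ` and leaves `6 n (n - 1) + 2
      -- n (n - 1) (z · σ) + 2 m = 0`. No two of the three sections need to be distinct.
      linear_combination h3 + n * h2 - (n - 1) * h1
    lia
  rw [hmn] at hm
  convert hm using 1
  rw [neg_smul]
  abel

end WeierstrassModel
end
end EllipticSurface

/-! ### The surface of the theorem as a Weierstrass model -/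

namespace EllipticSurface
open AlgebraicGeometry CategoryTheory Polynomial Glue DivisorTheory
open RatFunc hiding C X eval_C eval_X

section
variable {k : Type} [Field k] (a b : k[X])

/-- The inclusion of the function field of the base. -/
noncomputable def baseHom : RatFunc k →+* FunField a b :=
  (algebraMap (genericFiber a b).CoordinateRing (FunField a b)).comp (algebraMap _ _)

/-- Polynomials in `x` and `y`, as rational functions on the surface. -/
noncomputable def polyHom : (RatFunc k)[X][X] →+* FunField a b :=
  (algebraMap (genericFiber a b).CoordinateRing (FunField a b)).comp
    (WeierstrassCurve.Affine.CoordinateRing.mk (genericFiber a b))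

theorem polyHom_C (p : (RatFunc k)[X]) : polyHom a b (C p) = p.eval₂ (baseHom a b) (xFun a b) := by
  have h : (polyHom a b).comp C = eval₂RingHom (baseHom a b) (xFun a b) := by
    refine Polynomial.ringHom_ext (fun r => ?_) ?_
    · rw [coe_eval₂RingHom, eval₂_C]
      rfl
    · rw [coe_eval₂RingHom, eval₂_X]
      rfl
  exact congrArg (fun f => f p) h

theorem yFun_sq : yFun a b ^ 2 = xFun a b ^ 3 +
    baseHom a b (algebraMap k[X] (RatFunc k) a) * xFun a b +
      baseHom a b (algebraMap k[X] (RatFunc k) b) := by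
  have h : polyHom a b (genericFiber a b).polynomial = 0 := by
    rw [polyHom, RingHom.comp_apply, show WeierstrassCurve.Affine.CoordinateRing.mk
      (genericFiber a b) (genericFiber a b).polynomial = 0 from AdjoinRoot.mk_self, map_zero]
  have e : (genericFiber a b).polynomial = X ^ 2 - (C X ^ 3 +
      C (C (algebraMap k[X] (RatFunc k) a)) * C X + C (C (algebraMap k[X] (RatFunc k) b))) := by
    simp [WeierstrassCurve.Affine.polynomial, genericFiber]
  have h := (congrArg (polyHom a b) e).symm.trans h
  rw [map_sub, map_add, map_add, map_pow, map_pow, map_mul] at h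
  exact sub_eq_zero.mp h

theorem fun_indep (p q : (RatFunc k)[X]) (h : p.eval₂ (baseHom a b) (xFun a b) +
    q.eval₂ (baseHom a b) (xFun a b) * yFun a b = 0) : p = 0 ∧ q = 0 := by
  rw [← polyHom_C, ← polyHom_C] at h
  have h1 : algebraMap (genericFiber a b).CoordinateRing (FunField a b)
      (p • 1 + q • WeierstrassCurve.Affine.CoordinateRing.mk _ X) = 0 := by
    rw [WeierstrassCurve.Affine.CoordinateRing.smul, WeierstrassCurve.Affine.CoordinateRing.smul,
      mul_one, map_add, map_mul]
    exact h
  exact WeierstrassCurve.Affine.CoordinateRing.smul_basis_eq_zero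
    ((map_eq_zero_iff _ (IsFractionRing.injective _ _)).mp h1)

theorem coord_false (ε : Bool) : coord a b (ε, false) = ![baseHom a b (baseCoord ε),
    baseHom a b (scale ε) ^ 2 * xFun a b, baseHom a b (scale ε) ^ 3 * yFun a b] := by
  cases ε
  · simp [coord, scale, baseCoord]
    rfl
  · have h : baseHom a b RatFunc.X⁻¹ = (tFun a b)⁻¹ := map_inv₀ _ _
    simp only [coord, scale, baseCoord, map_pow, h]
    congr 1
    · rw [one_div]
    · congr 1
      · rw [← pow_mul, inv_pow]; ring
      · congr 1
        rw [← pow_mul, inv_pow]; ring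

theorem coord_true (ε : Bool) : coord a b (ε, true) = ![baseHom a b (baseCoord ε),
    baseHom a b (scale ε) ^ 2 * xFun a b / (baseHom a b (scale ε) ^ 3 * yFun a b),
    (baseHom a b (scale ε) ^ 3 * yFun a b)⁻¹] := by
  have h : ∀ ε, coord a b (ε, true) = ![coord a b (ε, false) 0,
      coord a b (ε, false) 1 / coord a b (ε, false) 2, (coord a b (ε, false) 2)⁻¹] := by
    rintro (_ | _) <;> simp [coord]
  rw [h, coord_false]
  rfl

/-- The surface as a Weierstrass model. -/
noncomputable def model : WeierstrassModel (chartRing a b) a b where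
  base := baseHom a b
  x := xFun a b
  y := yFun a b
  base_C _ := rfl
  y_sq := yFun_sq a b
  indep := fun_indep a b
  chart_false ε := by rw [← coord_false]; rfl
  chart_true ε := by rw [← coord_true]; rfl

variable {a b} [IsAlgClosed k] [CharZero k]

theorem isCurveOf_of_isSectionCurve {P : (genericFiber a b).Point}
    {C : PrimeDivisor (surface a b)} (h : IsSectionCurve a b P C) :
    (model a b).IsCurveOf P C := by
  have hh : (model a b).Horizontal C.1 := WeierstrassModel.horizontal_of_ordAt h.1
  -- The alternative `f = 0` allowed by `VanishesAlong` does not occur, since none of the functions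
  -- concerned is zero.
  have pos : ∀ {f g : FunField a b}, g = f → f ≠ 0 → VanishesAlong a b g C →
      0 < ordAt (fieldEquiv (chartRing a b) (false, false)) C f := by
    rintro f _ rfl hf hv
    exact hv.resolve_left hf
  cases P with
  | zero =>
    refine WeierstrassModel.isCurveOf_zero_of_ordAt hh (pos ?_ ((model a b).uc_ne_zero _) h.2.1)
      (pos ?_ ((model a b).wc_ne_zero _) h.2.2)
    · rw [WeierstrassModel.uc, WeierstrassModel.xc_false, WeierstrassModel.yc_false]
      rfl
    · rw [WeierstrassModel.wc, WeierstrassModel.yc_false, one_div]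
      rfl
  | some x y hP =>
    refine WeierstrassModel.isCurveOf_some_of_ordAt hh hP
      (pos ?_ ((model a b).xc_sub_ne_zero _ _) h.2.1)
      (pos ?_ ((model a b).yc_sub_ne_zero _ _) h.2.2)
    · rw [WeierstrassModel.xc_false]
      rfl
    · rw [WeierstrassModel.yc_false]
      rfl

end
end EllipticSurface
theorem mainTheorem10 (a b : Polynomial ℂ) (ha : a.natDegree ≤ 12) (hb : b.natDegree ≤ 18)
    (hS : AlgebraicGeometry.Smooth (EllipticSurface.surfaceToSpec a b))
    (P : (EllipticSurface.genericFiber a b).Point) (k : ℤ)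
    (z σ τ : DivisorTheory.PrimeDivisor (EllipticSurface.surface a b))
    (hz : EllipticSurface.IsSectionCurve a b 0 z)
    (hσ : EllipticSurface.IsSectionCurve a b P σ)
    (hτ : EllipticSurface.IsSectionCurve a b (k • P) τ) :
    EllipticSurface.curveClass a b τ =
      k • EllipticSurface.curveClass a b σ - (k - 1) • EllipticSurface.curveClass a b z +
        ((DivisorTheory.interNumber (Finsupp.single z 1) σ + 3) * k * (k - 1)) •
          EllipticSurface.fiberClass a b := by
  have hJ := (EllipticSurface.model a b).jacobianCriterion_of_smooth ha hb hS
  have h := EllipticSurface.WeierstrassModel.single_sub_mem_closure ha hb hJ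
    (EllipticSurface.isCurveOf_of_isSectionCurve hz)
    (EllipticSurface.isCurveOf_of_isSectionCurve hσ)
    (EllipticSurface.isCurveOf_of_isSectionCurve hτ)
  -- The relation already holds up to linear equivalence, and the Néron–Severi group is a further
  -- quotient.
  have h' := AddSubgroup.closure_mono (Set.subset_union_left
    (t := DivisorTheory.algTrivialDivisors (EllipticSurface.surfaceToSpec a b))) h
  exact (QuotientAddGroup.eq_iff_sub_mem).mpr h'
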